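/- **Setting.** Let $d\in\{2,3\}$ and let $\Omega$ be either a box $\prod_{i=1}^d(0,\ell_i)$ with periodic boundary conditions, or a bounded domain in $\mathbb R^d$ satisfying the interior cone condition, with homogeneous Neumann boundary conditions. Write $(\cdot,\cdot)$ and $\|\cdot\|$ for the $L^2(\Omega)$ inner product and norm. Let $H^1$ be $H^1(\Omega)$ (Neumann) or the space of periodic $H^1$ functions (periodic), and let $\Delta$ be the Laplacian with the boundary condition: $u\in D(\Delta)$ and $\Delta u=g\in L^2(\Omega)$ mean that $u\in H^1$ and $(\nabla u,\nabla v)=-(g,v)$ for all $v\in H^1$. Let $\varepsilon\in(0,1)$, $a\ge 0$, $P_a=(\Delta+I)^2+aI$, $F(x)=\frac14x^4-\frac{\varepsilon+a}2x^2$, $f=F'$, and, for $u\in D(\Delta)$, $$\mathcal E(u)=\int_\Omega\Big(\tfrac12\,u(\Delta+I)^2u+\tfrac a2u^2+F(u)\Big)dx,\qquad \int_\Omega u(\Delta+I)^2u\,dx:=\|(\Delta+I)u\|^2 .$$ **The bound $M_0$.** There are constants $C_\Omega,C_p>0$, depending only on $\Omega$ and the boundary condition, such that $\|u\|_{L^\infty}\le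 C_\Omega(\|u\|^2+\|\nabla u\|^2+\|\Delta u\|^2)^{1/2}$ for $u\in D(\Delta)$ and $\|u-\bar u\|\le C_p\|\nabla u\|$ for $u\in H^1$, where $\bar u=\frac1{|\Omega|}\int_\Omega u\,dx$. Take any such constants and any $\delta>0$ with $\frac{\delta}{2}C_p\le\frac12$. For $\phi_0\in D(\Delta)$ put $M_1=2(\mathcal E(\phi_0)+|\Omega|)^{1/2}$, $M_2=\frac{C_p}{\delta}M_1+2\|\bar\phi_0\|$, $M_3=\delta\|\bar\phi_0\|+\big(\frac{C_p}2+\frac1{2\delta}\big)M_1$ and $$M_0=M(\phi_0,\Omega)=C_\Omega\sqrt{M_1^2+M_2^2+M_3^2}.$$ Let $\tilde f$ be the truncation of $f$: $\tilde f(x)=f(x)$ for $|x|\le M_0$ and $\tilde f(x)=(3M_0^2-(\varepsilon+a))x\mp 2M_0^3$ for $\pm x>M_0$. Let $L\ge 0$ be a Lipschitz constant of $\tilde f$. **The scheme.** Let $s\ge1$. Let $A=(a_{ij})$ and $\hat A=(\hat a_{ij})$ be lower triangular $s\times s$ real matrices with equal row sums, $\hat A$ invertible; they form the Butcher tables of a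 diagonally implicit and an explicit $s$-stage method with $b_j=a_{sj}$, $\hat b_j=\hat a_{sj}$. For $\tau>0$, $K\in\mathbb N$ and real $\alpha,\beta$, the IMEX-RK scheme with nonlinearity $g\in\{f,\tilde f\}$ (the original scheme for $g=f$, the auxiliary scheme for $g=\tilde f$) asks for $u^n_i\in D(\Delta)$, $0\le n<K$, $0\le i\le s$, with $u^0_0=\phi_0$, $u^{n+1}_0=u^n_s$ and, for $1\le i\le s$, $$u^n_i=u^n_0+\tau\Big(\sum_{j=1}^i a_{ij}\mathcal L u^n_j+\sum_{j=1}^i\hat a_{ij}N_g(u^n_{j-1})\Big),$$ $$\mathcal L u=\Delta\big((1+\alpha)P_au+\beta u\big),\qquad N_g(u)=-\Delta\big(-g(u)+\alpha P_au+\beta u\big).$$ The stage equations are understood weakly: they are tested with all $v\in D(\Delta)$ such that $\Delta v\in D(\Delta)$, the outer Laplacian being moved to $v$, with $(P_au,w):=((\Delta+I)u,(\Delta+I)w)+a(u,w)$ for $u,w\in D(\Delta)$. Write $\phi^n=u^n_0$ and $\phi^{n+1}=u^n_s$. **Matrices.** Let $E$ be the $s\times s$ matrix of ones, $E_L$ the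 matrix with ones on and below the diagonal and zeros above, $\bar M=\frac12(M+M^{\mathsf T})$, and $$H_0=\hat A^{-1}E_L,\quad Q=(\hat A^{-1}A-I)E_L+I,\quad H_1(\beta)=\beta Q-\tfrac L2I,\quad H_2(\alpha)=\alpha Q-\tfrac12E+\hat A^{-1}AE_L .$$ **Theorem.** Suppose that $\bar Q$ and $\bar H_0$ are positive definite and that $$\alpha\ge\frac1{2\lambda_{\min}(\bar Q)}-1,\qquad \beta\ge\frac L{2\lambda_{\min}(\bar Q)} .$$ Then $\bar H_1(\beta)$ and $\bar H_2(\alpha)$ are positive semidefinite, and each is positive definite if the corresponding inequality is strict. Moreover, for every $\tau>0$ and every number $K$ of steps, the auxiliary scheme has exactly one solution $(\tilde u^n_i)$, and: (i) it dissipates the original energy: $\mathcal E(\tilde\phi^{n+1})\le\mathcal E(\tilde\phi^n)$ for $0\le n<K$; (ii) all stage values satisfy $\|\tilde u^n_i\|_{L^\infty}\le M_0$, $0\le i\le s$, $0\le n<K$; (iii) a family $(u^n_i)$ solves the original scheme if and only if it solves the auxiliary scheme; so both schemes have the same, unique, numerical solution. -/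

import Mathlib

open MeasureTheory Set
open scoped InnerProductSpace ContDiff NNReal ENNReal

noncomputable section

namespace PFC

/-! ### Domains and boundary conditions -/

/-- The ambient space `ℝᵈ` with its Euclidean norm. -/
abbrev Space (d : ℕ) : Type := EuclideanSpace ℝ (Fin d)

/-- The open box `(0, ℓ₁) × ⋯ × (0, ℓ_d)`. -/
def box {d : ℕ} (l : Fin d → ℝ) : Set (Space d) := {x | ∀ i, 0 < x i ∧ x i < l i}

/-- The interior cone condition: every point of `Ω` is the vertex of a finite open cone contained
in `Ω`, all these cones having the same height `r` and the same opening (of cosine `κ`). -/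
def ConeCondition {d : ℕ} (Ω : Set (Space d)) : Prop :=
  ∃ r κ : ℝ, 0 < r ∧ 0 < κ ∧ κ < 1 ∧ ∀ x ∈ Ω, ∃ e : Space d, ‖e‖ = 1 ∧
    ∀ y : Space d, ‖y‖ < r → κ * ‖y‖ < ⟪e, y⟫_ℝ → x + y ∈ Ω

/-- A spatial domain together with a boundary condition: either a box with periodic boundary
conditions, or a bounded domain (open, connected, with the cone condition) with homogeneous
Neumann boundary conditions. -/
inductive Setting (d : ℕ) : Type
  | periodic (l : Fin d → ℝ) (pos : ∀ i, 0 < l i) : Setting d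
  | neumann (Ω : Set (Space d)) (isOpen : IsOpen Ω) (isConnected : IsConnected Ω)
      (isBounded : Bornology.IsBounded Ω) (cone : ConeCondition Ω) : Setting d

namespace Setting

variable {d : ℕ}

/-- The domain `Ω`. -/
def domain : Setting d → Set (Space d)
  | periodic l _ => box l
  | neumann Ω _ _ _ _ => Ω

/-- The test functions that define the weak gradient: smooth functions that are periodic with
respect to the box, or smooth functions with compact support in `Ω`. -/
def tests : Setting d → Set (Space d → ℝ)
  | periodic l _ => {ψ | ContDiff ℝ ∞ ψ ∧
      ∀ (x : Space d) (i : Fin d), ψ (x + l i • EuclideanSpace.single i (1 : ℝ)) = ψ x}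
  | neumann Ω _ _ _ _ => {ψ | ContDiff ℝ ∞ ψ ∧ HasCompactSupport ψ ∧ tsupport ψ ⊆ Ω}

/-- Lebesgue measure on `Ω`. -/
abbrev mu (S : Setting d) : Measure (Space d) := volume.restrict S.domain

/-- The Hilbert space `L²(Ω)`. -/
abbrev L2 (S : Setting d) : Type := Lp ℝ 2 S.mu

/-- The Hilbert space `L²(Ω; ℝᵈ)`. -/
abbrev L2Vec (S : Setting d) : Type := Lp (Space d) 2 S.mu

/-- `S.HasGrad u G`: the function `u ∈ L²(Ω)` belongs to the Sobolev space `H¹` (to `H¹(Ω)` in the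
Neumann case, to `H¹` of the torus in the periodic case), with weak gradient `G ∈ L²(Ω; ℝᵈ)`. -/
def HasGrad (S : Setting d) (u : S.L2) (G : S.L2Vec) : Prop :=
  ∀ ψ ∈ S.tests, ∀ i : Fin d,
    ∫ x, u x * fderiv ℝ ψ x (EuclideanSpace.single i 1) ∂S.mu = -∫ x, (G x) i * ψ x ∂S.mu

/-- `S.HasLap u g`: `Δ u = g` with the boundary condition, in the usual weak sense: `u ∈ H¹`,
`g ∈ L²` and `(∇u, ∇v) = -(g, v)` for all `v ∈ H¹`. In the Neumann case this contains `∂u/∂n = 0`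
as natural boundary condition. -/
def HasLap (S : Setting d) (u g : S.L2) : Prop :=
  (∃ G : S.L2Vec, S.HasGrad u G) ∧
    ∀ (G : S.L2Vec) (v : S.L2) (H : S.L2Vec),
      S.HasGrad u G → S.HasGrad v H → ⟪G, H⟫_ℝ = -⟪g, v⟫_ℝ

theorem isOpen_domain (S : Setting d) : IsOpen S.domain := by
  cases S with
  | periodic l pos =>
    have : box l = ⋂ i : Fin d, {x : Space d | 0 < x i ∧ x i < l i} := by
      ext x; simp [box]
    change IsOpen (box l)
    rw [this]
    refine isOpen_iInter_of_finite fun i => ?_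
    have h : Continuous fun x : Space d => x i := by fun_prop
    exact (isOpen_lt continuous_const h).inter (isOpen_lt h continuous_const)
  | neumann Ω h _ _ _ => exact h

theorem tests_contDiff (S : Setting d) {ψ : Space d → ℝ} (h : ψ ∈ S.tests) : ContDiff ℝ ∞ ψ := by
  cases S with
  | periodic l pos => exact h.1
  | neumann Ω _ _ _ _ => exact h.1

/-- Smooth functions with compact support in `Ω` have their classical gradient as weak gradient. -/
theorem exists_hasGrad (S : Setting d) {ψ : Space d → ℝ} (hψ : ContDiff ℝ ∞ ψ)
    (hc : HasCompactSupport ψ) (hs : tsupport ψ ⊆ S.domain) :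
    ∃ (v : S.L2) (H : S.L2Vec), v =ᵐ[S.mu] ψ ∧ S.HasGrad v H := by
  have hd : ∀ i : Fin d, Continuous fun x => fderiv ℝ ψ x (EuclideanSpace.single i (1 : ℝ)) :=
    fun i => (hψ.continuous_fderiv (by simp)).clm_apply continuous_const
  have hv : MemLp ψ 2 S.mu := hψ.continuous.memLp_of_hasCompactSupport hc
  let D : Space d → Space d := fun x =>
    WithLp.toLp 2 fun i => fderiv ℝ ψ x (EuclideanSpace.single i (1 : ℝ))
  have hDc : Continuous D := by
    refine (PiLp.continuous_toLp 2 _).comp ?_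
    exact continuous_pi hd
  have hDs : HasCompactSupport D := by
    refine (hc.fderiv (𝕜 := ℝ)).comp_left
      (g := fun A : Space d →L[ℝ] ℝ =>
        (WithLp.toLp 2 fun i => A (EuclideanSpace.single i (1 : ℝ)) : Space d)) ?_
    ext i; simp
  have hH : MemLp D 2 S.mu := hDc.memLp_of_hasCompactSupport hDs
  refine ⟨hv.toLp ψ, hH.toLp D, hv.coeFn_toLp, fun η hη i => ?_⟩
  have hη' := S.tests_contDiff hη
  have e1 : ∫ x, (hv.toLp ψ) x * fderiv ℝ η x (EuclideanSpace.single i 1) ∂S.mu =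
      ∫ x, ψ x * fderiv ℝ η x (EuclideanSpace.single i 1) := by
    rw [← setIntegral_eq_integral_of_forall_compl_eq_zero (s := S.domain)
      (f := fun x => ψ x * fderiv ℝ η x (EuclideanSpace.single i 1))]
    · refine integral_congr_ae ?_
      filter_upwards [hv.coeFn_toLp] with x hx
      rw [hx]
    · intro x hx
      rw [image_eq_zero_of_notMem_tsupport (fun h => hx (hs h)), zero_mul]
  have e2 : ∫ x, (hH.toLp D x) i * η x ∂S.mu =
      ∫ x, fderiv ℝ ψ x (EuclideanSpace.single i 1) * η x := by
    rw [← setIntegral_eq_integral_of_forall_compl_eq_zero (s := S.domain)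
      (f := fun x => fderiv ℝ ψ x (EuclideanSpace.single i 1) * η x)]
    · refine integral_congr_ae ?_
      filter_upwards [hH.coeFn_toLp] with x hx
      rw [hx]
    · intro x hx
      have h0 : fderiv ℝ ψ x = 0 := image_eq_zero_of_notMem_tsupport
        (fun h => hx (hs (tsupport_fderiv_subset ℝ h)))
      rw [h0]; simp
  have hsd : HasCompactSupport fun x => fderiv ℝ ψ x (EuclideanSpace.single i (1 : ℝ)) :=
    hc.fderiv_apply (𝕜 := ℝ) _
  have cη : Continuous fun x => fderiv ℝ η x (EuclideanSpace.single i (1 : ℝ)) :=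
    (hη'.continuous_fderiv (by simp)).clm_apply continuous_const
  rw [e1, e2]
  refine integral_mul_fderiv_eq_neg_fderiv_mul_of_integrable ?_ ?_ ?_ ?_ ?_
  · exact ((hd i).mul hη'.continuous).integrable_of_hasCompactSupport hsd.mul_right
  · exact (hψ.continuous.mul cη).integrable_of_hasCompactSupport hc.mul_right
  · exact (hψ.continuous.mul hη'.continuous).integrable_of_hasCompactSupport hc.mul_right
  · exact fun x _ => hψ.differentiable (by simp) x
  · exact fun x _ => hη'.differentiable (by simp) x

/-- The weak Laplacian of a function is unique. -/
theorem HasLap.unique {S : Setting d} {u g₁ g₂ : S.L2} (h₁ : S.HasLap u g₁)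
    (h₂ : S.HasLap u g₂) : g₁ = g₂ := by
  obtain ⟨G, hG⟩ := h₁.1
  have key : ∀ (v : S.L2) (H : S.L2Vec), S.HasGrad v H → ⟪g₁ - g₂, v⟫_ℝ = 0 := by
    intro v H hv
    have e₁ := h₁.2 G v H hG hv
    have e₂ := h₂.2 G v H hG hv
    rw [inner_sub_left]; linarith
  have hloc : LocallyIntegrableOn (fun x => (g₁ - g₂ : S.L2) x) S.domain volume := by
    have h : LocallyIntegrable (fun x => (g₁ - g₂ : S.L2) x) S.mu :=
      (Lp.memLp (g₁ - g₂)).locallyIntegrable (by norm_num)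
    exact locallyIntegrableOn_of_locallyIntegrable_restrict h
  have hz := S.isOpen_domain.ae_eq_zero_of_integral_contDiff_smul_eq_zero hloc (by
    intro ψ hψ hc hs
    obtain ⟨v, H, hv, hH⟩ := S.exists_hasGrad hψ hc hs
    have h0 := key v H hH
    rw [L2.inner_def] at h0
    rw [← setIntegral_eq_integral_of_forall_compl_eq_zero (s := S.domain), ← h0]
    · refine integral_congr_ae ?_
      filter_upwards [hv] with x hx
      simp [hx]
    · intro x hx
      rw [image_eq_zero_of_notMem_tsupport (fun h => hx (hs h)), zero_smul])
  have hz' : (g₁ - g₂ : S.L2) =ᵐ[S.mu] 0 :=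
    (ae_restrict_iff' S.isOpen_domain.measurableSet).2 hz
  exact sub_eq_zero.1 ((Lp.eq_zero_iff_ae_eq_zero).2 hz')

/-- The domain of the Laplacian with the given boundary condition. -/
def InDom (S : Setting d) (u : S.L2) : Prop := ∃ g, S.HasLap u g

open Classical in
/-- The Laplacian with the given boundary condition (used on its domain only; there the value is
unique by `HasLap.unique`). -/
def lap (S : Setting d) (u : S.L2) : S.L2 := if h : S.InDom u then h.choose else 0

theorem HasLap.lap_eq {S : Setting d} {u g : S.L2} (h : S.HasLap u g) : S.lap u = g := by
  have hu : S.InDom u := ⟨g, h⟩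
  have hs : S.HasLap u (S.lap u) := by
    simp only [lap, dif_pos hu]
    exact hu.choose_spec
  exact hs.unique h

/-- The volume `|Ω|`. -/
def vol (S : Setting d) : ℝ := (volume S.domain).toReal

/-- The mean value of `u` over `Ω`. -/
def mean (S : Setting d) (u : S.L2) : ℝ := (∫ x, u x ∂S.mu) / S.vol

/-- The `L^∞(Ω)` norm. -/
def supNorm (S : Setting d) (u : S.L2) : ℝ≥0∞ := eLpNorm u ∞ S.mu

/-- `C` is a constant in the Sobolev inequality
`‖u‖_∞ ≤ C √(‖u‖² + ‖∇u‖² + ‖Δu‖²)` on `Ω`. -/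
def IsSobolevConst (S : Setting d) (C : ℝ) : Prop :=
  0 < C ∧ ∀ (u : S.L2) (G : S.L2Vec) (g : S.L2), S.HasGrad u G → S.HasLap u g →
    S.supNorm u ≤ ENNReal.ofReal (C * √(‖u‖ ^ 2 + ‖G‖ ^ 2 + ‖g‖ ^ 2))

/-- `C` is a constant in the Poincaré–Wirtinger inequality `‖u - ū‖ ≤ C ‖∇u‖` on `Ω`. -/
def IsPoincareConst (S : Setting d) (C : ℝ) : Prop :=
  0 < C ∧ ∀ (u : S.L2) (G : S.L2Vec), S.HasGrad u G →
    eLpNorm (fun x => u x - S.mean u) 2 S.mu ≤ ENNReal.ofReal (C * ‖G‖)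

end Setting

/-! ### Nonlinearity and energy -/

/-- `F(x) = x⁴/4 - (ε + a) x²/2`. -/
def potential (ε a x : ℝ) : ℝ := x ^ 4 / 4 - (ε + a) / 2 * x ^ 2

/-- `f(x) = F'(x) = x³ - (ε + a) x`. -/
def reaction (ε a x : ℝ) : ℝ := x ^ 3 - (ε + a) * x

/-- The truncated nonlinearity: `f` on `[-M, M]`, continued affinely outside. -/
def truncReaction (ε a M x : ℝ) : ℝ :=
  if M < x then (3 * M ^ 2 - (ε + a)) * x - 2 * M ^ 3
  else if x < -M then (3 * M ^ 2 - (ε + a)) * x + 2 * M ^ 3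
  else x ^ 3 - (ε + a) * x

namespace Setting

variable {d : ℕ}

/-- The free energy `∫ ½ u (Δ + I)² u + (a/2) u² + F(u)`, for `u` in the domain of the Laplacian,
where the first term is `½ ‖(Δ + I) u‖²`. -/
def energy (S : Setting d) (ε a : ℝ) (u : S.L2) : ℝ :=
  1 / 2 * ‖S.lap u + u‖ ^ 2 + a / 2 * ‖u‖ ^ 2 + ∫ x, potential ε a (u x) ∂S.mu

/-- `M₁(v, Ω) = 2 (E(v) + |Ω|)^{1/2}`, the bound for `‖Δu‖`. -/
def boundLap (S : Setting d) (ε a : ℝ) (v : S.L2) : ℝ := 2 * √(S.energy ε a v + S.vol)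

/-- The `L²(Ω)` norm of the constant function `v̄`. -/
def meanNorm (S : Setting d) (v : S.L2) : ℝ := |S.mean v| * √S.vol

/-- `M₂(v, Ω)`, the bound for `‖u‖`. -/
def boundVal (S : Setting d) (Cp δ ε a : ℝ) (v : S.L2) : ℝ :=
  Cp / δ * S.boundLap ε a v + 2 * S.meanNorm v

/-- `M₃(v, Ω)`, the bound for `‖∇u‖`. -/
def boundGrad (S : Setting d) (Cp δ ε a : ℝ) (v : S.L2) : ℝ :=
  δ * S.meanNorm v + (Cp / 2 + 1 / (2 * δ)) * S.boundLap ε a v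

/-- `M(v, Ω) = C_Ω √(M₁² + M₂² + M₃²)`. -/
def boundSup (S : Setting d) (CΩ Cp δ ε a : ℝ) (v : S.L2) : ℝ :=
  CΩ * √(S.boundLap ε a v ^ 2 + S.boundVal Cp δ ε a v ^ 2 + S.boundGrad Cp δ ε a v ^ 2)

end Setting

/-! ### Butcher tables -/

/-- A pair of `s`-stage Butcher tables, diagonally implicit (`A, b, c`) and explicit
(`Ahat, bhat, chat`), without the padding zeros: row `i` of either matrix belongs to stage `i + 1`,
column `j` of `A` to stage `j + 1` and column `j` of `Ahat` to stage `j`. -/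
structure IMEXTable (s : ℕ) where
  A : Matrix (Fin s) (Fin s) ℝ
  Ahat : Matrix (Fin s) (Fin s) ℝ
  b : Fin s → ℝ
  bhat : Fin s → ℝ
  c : Fin s → ℝ
  chat : Fin s → ℝ
  A_lower : ∀ i j, i < j → A i j = 0
  Ahat_lower : ∀ i j, i < j → Ahat i j = 0
  A_row : ∀ i, ∑ j, A i j = c i
  Ahat_row : ∀ i, ∑ j, Ahat i j = chat i
  c_eq : c = chat
  b_eq : ∀ i : Fin s, (i : ℕ) + 1 = s → ∀ j, b j = A i j
  bhat_eq : ∀ i : Fin s, (i : ℕ) + 1 = s → ∀ j, bhat j = Ahat i j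
  Ahat_inv : IsUnit Ahat

/-- The symmetric part `½ (M + Mᵀ)`. -/
def symPart {s : ℕ} (M : Matrix (Fin s) (Fin s) ℝ) : Matrix (Fin s) (Fin s) ℝ :=
  (1 / 2 : ℝ) • (M + M.transpose)

/-- The smallest eigenvalue of a (symmetric) matrix. -/
def lambdaMin {s : ℕ} (M : Matrix (Fin s) (Fin s) ℝ) : ℝ := sInf (spectrum ℝ M)

/-- The matrix all of whose entries are `1`. -/
def onesMat (s : ℕ) : Matrix (Fin s) (Fin s) ℝ := Matrix.of fun _ _ => 1

/-- The matrix with `1` on and below the diagonal and `0` above it. -/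
def lowerOnes (s : ℕ) : Matrix (Fin s) (Fin s) ℝ := Matrix.of fun i j => if j ≤ i then 1 else 0

namespace IMEXTable

variable {s : ℕ}

def H0 (B : IMEXTable s) : Matrix (Fin s) (Fin s) ℝ := B.Ahat⁻¹ * lowerOnes s

def Q (B : IMEXTable s) : Matrix (Fin s) (Fin s) ℝ := (B.Ahat⁻¹ * B.A - 1) * lowerOnes s + 1

def H1 (B : IMEXTable s) (L β : ℝ) : Matrix (Fin s) (Fin s) ℝ :=
  β • B.Q - (L / 2) • (1 : Matrix (Fin s) (Fin s) ℝ)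

def H2 (B : IMEXTable s) (α : ℝ) : Matrix (Fin s) (Fin s) ℝ :=
  α • B.Q - (1 / 2 : ℝ) • onesMat s + B.Ahat⁻¹ * B.A * lowerOnes s

end IMEXTable

/-! ### The scheme -/

namespace Setting

variable {d : ℕ}

/-- The form `(P_a u, w)` of `P_a = (Δ + I)² + a I`, for `u, w` in the domain of the Laplacian. -/
def formP (S : Setting d) (a : ℝ) (u w : S.L2) : ℝ :=
  ⟪S.lap u + u, S.lap w + w⟫_ℝ + a * ⟪u, w⟫_ℝ

/-- The pairing `(𝓛u, v)` of `𝓛u = Δ((1 + α) P_a u + β u)` with a test function `v`, the outer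
Laplacian being moved to `v`. -/
def pairLin (S : Setting d) (a α β : ℝ) (u v : S.L2) : ℝ :=
  (1 + α) * S.formP a u (S.lap v) + β * ⟪u, S.lap v⟫_ℝ

/-- The pairing `(N(u), v)` of `N(u) = -Δ(-g(u) + α P_a u + β u)` with a test function `v`, the
outer Laplacian being moved to `v`. -/
def pairNonlin (S : Setting d) (a α β : ℝ) (g : ℝ → ℝ) (u v : S.L2) : ℝ :=
  -(-(∫ x, g (u x) * (S.lap v) x ∂S.mu) + α * S.formP a u (S.lap v) + β * ⟪u, S.lap v⟫_ℝ)

/-- `u n i`, `n < K`, `i = 0, …, s`, are the stage values of `K` steps of the IMEX Runge–Kutta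
scheme with nonlinearity `g`, step size `τ` and initial value `φ₀`: the stages lie in the domain of
the Laplacian and
`u n i = u n 0 + τ (∑_{1 ≤ j ≤ i} a_{ij} 𝓛 (u n j) + ∑_{1 ≤ j ≤ i} â_{ij} N (u n (j - 1)))`
holds weakly, that is, tested with all `v` such that `v` and `Δ v` lie in the domain of the
Laplacian; the last stage of a step is the initial value of the next one. -/
structure IsSolution (S : Setting d) {s : ℕ} (B : IMEXTable s) (a α β : ℝ) (g : ℝ → ℝ) (τ : ℝ)
    (φ₀ : S.L2) (K : ℕ) (u : Fin K → Fin (s + 1) → S.L2) : Prop where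
  inDom : ∀ n i, S.InDom (u n i)
  init : ∀ n : Fin K, (n : ℕ) = 0 → u n 0 = φ₀
  next : ∀ n m : Fin K, (m : ℕ) = (n : ℕ) + 1 → u m 0 = u n (Fin.last s)
  stage : ∀ (n : Fin K) (i : Fin s) (v : S.L2), S.InDom v → S.InDom (S.lap v) →
    ⟪u n i.succ, v⟫_ℝ = ⟪u n 0, v⟫_ℝ +
      τ * (∑ j ∈ Finset.Iic i, B.A i j * S.pairLin a α β (u n j.succ) v +
        ∑ j ∈ Finset.Iic i, B.Ahat i j * S.pairNonlin a α β g (u n j.castSucc) v)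

end Setting

end PFC

end

/-!
Every stage of the scheme dissipates the energy in which the potential `F` is replaced by the
primitive of the truncated nonlinearity. To see this, the stage equations are multiplied by `Â⁻¹`,
which expresses them in terms of the increments between consecutive stages
(`IMEXTable.stage_increments`), and are tested with `(-Δ)⁻¹` of the increments up to a given stage.
The time difference then becomes the quadratic form of `H0` in the gradients of the test functions,
which is nonnegative. The explicit terms are differences of the potential up to `L / 2` times the
squares of the increments, by the quadratic upper bound for functions with Lipschitz derivative
(`le_add_of_lipschitz_deriv`). The matrix `H2` completes the squares in the quadratic part of the
energy, and `H1` absorbs the remainder from the explicit terms (`Setting.truncEnergy_le`). Both are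
positive semidefinite because their symmetric parts are `(α + 1) Q̄ - I / 2` and `β Q̄ - (L / 2) I`
(`IMEXTable.symPart_H2`, `IMEXTable.symPart_H1`).

The energy bounds the solution in the supremum norm (`Setting.supNorm_le_boundSup`): it controls
`Δu`, and interpolation, the Poincaré inequality and the conservation of the mean value control the
rest. The lower bound of the potential on which this rests holds for the truncated potential too, as
soon as `M₀² ≥ 3`; that follows from the Sobolev inequality for constants
(`Setting.three_le_boundSup_sq`). The initial value obeys the bound `M₀` as well, so its truncated
energy is its energy. Hence the truncation is never active: the solution of the auxiliary scheme
solves the original scheme, and since the explicit terms cancel in a difference of solutions, the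
solutions of either scheme are unique.

Solvability of one stage is a statement about `R = (I - Δ)⁻¹`, which is `ι ι*` for the embedding `ι`
of `H¹` into `L²`. With `u = R w` and test functions `R² z` the stage equation becomes an equation
for `w` with a bounded form, given by a polynomial in `R`. It is coercive because `r²` and
`(1 - r) (1 - 2 r)` are coprime (`Setting.existsUnique_resolvent`).

There remains the existence of the Sobolev and Poincaré constants. The average of a weakly
differentiable function over a moving ball has a derivative that is bounded by an average of the
gradient (`hasDerivAt_ballAvg`). Moving balls along the axes of the cones in the cone condition, and
joining balls of fixed size by chains, one dominates the deviation of the function from a constant by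
a potential of its gradient (`ConeCondition.exists_pointwise_le`). Schur's test gives the Poincaré
inequality and a Faber–Krahn type inequality for functions on small sets. The latter, with a chain
rule for weak gradients (`IsWeakGrad.comp`), makes De Giorgi's iteration over level sets work for
`u - Δu = f` (`Setting.level_decay`, `eq_zero_of_level_decay`). No regularity theory up to the
boundary is needed. For periodic boundary conditions, weak derivatives are those of the periodic
extension (`Setting.weakGrad_periodic_iff`), because every smooth periodic function is the
periodization of a test function (`exists_perSum_eq`).
-/

noncomputable section

namespace PFC

open Filter Topology Metric

variable {d : ℕ}

/-! ### Weak gradients and their averages over moving balls -/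

/-- `G` is the weak gradient of `u` on the open set `D`, in the sense of distributions: the test
functions are smooth with compact support in `D`. -/
def IsWeakGrad (D : Set (Space d)) (u : Space d → ℝ) (G : Space d → Space d) : Prop :=
  ∀ ψ : Space d → ℝ, ContDiff ℝ ∞ ψ → HasCompactSupport ψ → tsupport ψ ⊆ D → ∀ i : Fin d,
    ∫ x in D, u x * fderiv ℝ ψ x (EuclideanSpace.single i 1) = -∫ x in D, (G x) i * ψ x

/-- A fixed smooth bump function on `ℝᵈ`, supported in the closed unit ball and of integral `1`. -/
def bump : Space d → ℝ :=
  ContDiffBump.normed (⟨1 / 2, 1, by norm_num, by norm_num⟩ : ContDiffBump (0 : Space d)) volume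

theorem bump_contDiff : ContDiff ℝ ∞ (bump (d := d)) := ContDiffBump.contDiff_normed _

theorem bump_nonneg (x : Space d) : 0 ≤ bump x := ContDiffBump.nonneg_normed _ _

theorem bump_integral : ∫ x : Space d, bump x = 1 := ContDiffBump.integral_normed _

theorem bump_tsupport : tsupport (bump (d := d)) = closedBall 0 1 :=
  ContDiffBump.tsupport_normed_eq _

theorem bump_hasCompactSupport : HasCompactSupport (bump (d := d)) :=
  ContDiffBump.hasCompactSupport_normed _

theorem bump_eq_zero {x : Space d} (h : 1 < ‖x‖) : bump x = 0 := by
  apply image_eq_zero_of_notMem_tsupport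
  rw [bump_tsupport]; simpa using h

theorem exists_bump_le (d : ℕ) : ∃ C : ℝ, 0 < C ∧ ∀ x : Space d, bump x ≤ C := by
  obtain ⟨C, hC⟩ := bump_contDiff.continuous.bounded_above_of_compact_support
    (bump_hasCompactSupport (d := d))
  exact ⟨max C 1, by positivity, fun x => (le_abs_self _).trans ((hC x).trans (le_max_left _ _))⟩

/-- A bound for `bump`. -/
def bumpBound (d : ℕ) : ℝ := (exists_bump_le d).choose

theorem bumpBound_pos (d : ℕ) : 0 < bumpBound d := (exists_bump_le d).choose_spec.1

theorem bump_le (x : Space d) : bump x ≤ bumpBound d := (exists_bump_le d).choose_spec.2 x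

/-- The bump function scaled to the ball of centre `c` and radius `ρ`, normalized in `L¹`. -/
def scaledBump (c : Space d) (ρ : ℝ) (z : Space d) : ℝ := (ρ ^ d)⁻¹ * bump (ρ⁻¹ • (z - c))

/-- The weighted average of `u` over the ball of centre `c` and radius `ρ`. -/
def ballAvg (D : Set (Space d)) (u : Space d → ℝ) (c : Space d) (ρ : ℝ) : ℝ :=
  ∫ z in D, u z * scaledBump c ρ z

theorem scaledBump_nonneg (c : Space d) {ρ : ℝ} (hρ : 0 < ρ) (z : Space d) :
    0 ≤ scaledBump c ρ z := mul_nonneg (by positivity) (bump_nonneg _)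

theorem scaledBump_le (c : Space d) {ρ : ℝ} (hρ : 0 < ρ) (z : Space d) :
    scaledBump c ρ z ≤ bumpBound d * (ρ ^ d)⁻¹ := by
  rw [scaledBump, mul_comm]
  exact mul_le_mul_of_nonneg_right (bump_le _) (by positivity)

theorem lt_norm_smul_sub {c z : Space d} {ρ : ℝ} (hρ : 0 < ρ) (hz : z ∉ closedBall c ρ) :
    1 < ‖ρ⁻¹ • (z - c)‖ := by
  rw [mem_closedBall, dist_eq_norm, not_le] at hz
  rw [norm_smul, norm_inv, Real.norm_of_nonneg hρ.le, inv_mul_eq_div, one_lt_div hρ]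
  exact hz

theorem scaledBump_eq_zero {c z : Space d} {ρ : ℝ} (hρ : 0 < ρ) (hz : z ∉ closedBall c ρ) :
    scaledBump c ρ z = 0 := by
  rw [scaledBump, bump_eq_zero (lt_norm_smul_sub hρ hz), mul_zero]

theorem scaledBump_contDiff (c : Space d) (ρ : ℝ) : ContDiff ℝ ∞ (scaledBump c ρ) := by
  unfold scaledBump
  exact contDiff_const.mul (bump_contDiff.comp ((contDiff_id.sub contDiff_const).const_smul ρ⁻¹))

/-- The derivative of an average over a ball moving with constant velocity `v` and growing at
constant rate `σ`: since the time derivative of the scaled bump is the divergence of a field with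
compact support, it is an average of the weak gradient over the same ball. -/
theorem hasDerivAt_ballAvg {D : Set (Space d)} {u : Space d → ℝ} {G : Space d → Space d}
    (hu : IntegrableOn u D) (hG : IntegrableOn G D) (h : IsWeakGrad D u G)
    (p v : Space d) (ρ₀ σ t : ℝ) (hρ : 0 < ρ₀ + t * σ)
    (hball : closedBall (p + t • v) (ρ₀ + t * σ) ⊆ D) :
    ∃ M' : ℝ, HasDerivAt (fun t => ballAvg D u (p + t • v) (ρ₀ + t * σ)) M' t ∧
      |M'| ≤ (‖v‖ + |σ|) * bumpBound d * ((ρ₀ + t * σ) ^ d)⁻¹ *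
        ∫ z in D ∩ closedBall (p + t • v) (ρ₀ + t * σ), ‖G z‖ := by
  set ρ : ℝ := ρ₀ + t * σ with hρdef
  set c : Space d := p + t • v with hcdef
  -- the profile of the time derivative
  let Φ : Space d → ℝ := fun y => d * σ * bump y + fderiv ℝ bump y (v + σ • y)
  have hbd : Differentiable ℝ (bump (d := d)) := bump_contDiff.differentiable (by simp)
  have hfc : Continuous (fderiv ℝ (bump (d := d))) := bump_contDiff.continuous_fderiv (by simp)
  have hΦc : Continuous Φ := by
    refine (continuous_const.mul bump_contDiff.continuous).add (hfc.clm_apply ?_)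
    fun_prop
  have hΦ0 : ∀ y : Space d, 1 < ‖y‖ → Φ y = 0 := by
    intro y hy
    have h0 : y ∉ tsupport (bump (d := d)) := by rw [bump_tsupport]; simpa using hy
    have h1 : fderiv ℝ (bump (d := d)) y = 0 :=
      image_eq_zero_of_notMem_tsupport fun h => h0 (tsupport_fderiv_subset ℝ h)
    simp [Φ, h1, bump_eq_zero hy]
  have hΦs : HasCompactSupport Φ := by
    refine HasCompactSupport.intro (isCompact_closedBall (0 : Space d) 1) fun y hy => hΦ0 y ?_
    simpa using hy
  obtain ⟨B, hB⟩ := hΦc.bounded_above_of_compact_support hΦs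
  -- the time derivative of the scaled bump
  have hK : ∀ s : ℝ, 0 < ρ₀ + s * σ → ∀ z : Space d,
      HasDerivAt (fun s => scaledBump (p + s • v) (ρ₀ + s * σ) z)
        (-((ρ₀ + s * σ) ^ (d + 1))⁻¹ * Φ ((ρ₀ + s * σ)⁻¹ • (z - (p + s • v)))) s := by
    intro s hs z
    have e1 : HasDerivAt (fun s : ℝ => ρ₀ + s * σ) σ s := by
      simpa using ((hasDerivAt_id s).mul_const σ).const_add ρ₀
    have e2 : HasDerivAt (fun s : ℝ => z - (p + s • v)) (-v) s := by
      simpa using (((hasDerivAt_id s).smul_const v).const_add p).const_sub z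
    have e3 := (e1.inv hs.ne').smul e2
    have e4 := (hbd _).hasFDerivAt.comp_hasDerivAt s e3
    have e5 := (e1.pow d).inv (pow_ne_zero d hs.ne')
    have e6 := e5.mul e4
    refine e6.congr_deriv ?_
    simp only [Φ, Pi.smul_apply', Pi.inv_apply, Pi.pow_apply, Function.comp_apply]
    set R := ρ₀ + s * σ
    set w := z - (p + s • v)
    have e7 : R⁻¹ • -v + (-σ / R ^ 2) • w = (-R⁻¹) • (v + σ • R⁻¹ • w) := by
      rw [smul_add, smul_neg, neg_smul, smul_smul, smul_smul]
      congr 2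
      field_simp
    rw [e7, map_smul, smul_eq_mul]
    rcases Nat.eq_zero_or_pos d with h0 | h0
    · simp [h0]
    · obtain ⟨k, rfl⟩ : ∃ k, d = k + 1 := ⟨d - 1, by omega⟩
      simp only [Nat.add_sub_cancel]
      field_simp
      ring
  -- the components of the flux
  let χ : Fin d → Space d → ℝ := fun i y => (v i + σ * y i) * bump y
  let ψ : Fin d → Space d → ℝ := fun i z => (ρ ^ d)⁻¹ * χ i (ρ⁻¹ • (z - c))
  have hχ : ∀ i, ContDiff ℝ ∞ (χ i) := fun i => by
    refine ContDiff.mul ?_ bump_contDiff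
    fun_prop
  have hψ : ∀ i, ContDiff ℝ ∞ (ψ i) := fun i =>
    contDiff_const.mul ((hχ i).comp ((contDiff_id.sub contDiff_const).const_smul ρ⁻¹))
  have hψ0 : ∀ i z, z ∉ closedBall c ρ → ψ i z = 0 := by
    intro i z hz
    simp [ψ, χ, bump_eq_zero (lt_norm_smul_sub hρ hz)]
  have hψs : ∀ i, tsupport (ψ i) ⊆ closedBall c ρ := fun i =>
    closure_minimal (fun z hz => by by_contra hh; exact hz (hψ0 i z hh)) isClosed_closedBall
  have hψc : ∀ i, HasCompactSupport (ψ i) := fun i =>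
    HasCompactSupport.intro (isCompact_closedBall c ρ) (hψ0 i)
  have hdiv : ∀ z, ∑ i, fderiv ℝ (ψ i) z (EuclideanSpace.single i 1) =
      (ρ ^ (d + 1))⁻¹ * Φ (ρ⁻¹ • (z - c)) := by
    intro z
    set y := ρ⁻¹ • (z - c) with hy
    have e : ∀ i, fderiv ℝ (ψ i) z (EuclideanSpace.single i 1) =
        (ρ ^ (d + 1))⁻¹ * (σ * bump y +
          (v i + σ * y i) * fderiv ℝ bump y (EuclideanSpace.single i 1)) := by
      intro i
      have f1 : HasFDerivAt (fun z : Space d => ρ⁻¹ • (z - c))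
          (ρ⁻¹ • ContinuousLinearMap.id ℝ (Space d)) z :=
        ((hasFDerivAt_id z).sub_const c).const_smul ρ⁻¹
      have f2 : HasFDerivAt (fun y : Space d => v i + σ * y i)
          (σ • (EuclideanSpace.proj i : Space d →L[ℝ] ℝ)) y :=
        (((EuclideanSpace.proj i : Space d →L[ℝ] ℝ).hasFDerivAt).const_mul σ).const_add (v i)
      have f3 := f2.mul (hbd y).hasFDerivAt
      have f4 := ((f3.comp z f1).const_mul (ρ ^ d)⁻¹).fderiv
      change fderiv ℝ (ψ i) z = _ at f4
      rw [f4]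
      simp
      field_simp
      ring
    rw [Finset.sum_congr rfl fun i _ => e i, ← Finset.mul_sum, Finset.sum_add_distrib]
    congr 1
    simp only [Finset.sum_const, Finset.card_univ, Fintype.card_fin, nsmul_eq_mul, Φ]
    rw [mul_assoc]
    congr 1
    have f5 : v + σ • y = ∑ i, (v i + σ * y i) • EuclideanSpace.single i (1 : ℝ) := by
      ext j
      simp [Finset.sum_apply, Pi.single_apply]
    conv_rhs => rw [f5]
    rw [map_sum]
    exact Finset.sum_congr rfl fun i _ => by rw [map_smul, smul_eq_mul]
  -- differentiation under the integral
  have hs : {s : ℝ | ρ / 2 < ρ₀ + s * σ} ∈ 𝓝 t := by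
    refine IsOpen.mem_nhds (isOpen_lt continuous_const (by fun_prop)) ?_
    change ρ / 2 < ρ₀ + t * σ
    rw [← hρdef]; linarith
  have hmeas : ∀ s : ℝ, AEStronglyMeasurable
      (fun z => u z * scaledBump (p + s • v) (ρ₀ + s * σ) z) (volume.restrict D) := fun s =>
    hu.aestronglyMeasurable.mul (scaledBump_contDiff _ _).continuous.aestronglyMeasurable
  have key := hasDerivAt_integral_of_dominated_loc_of_deriv_le
    (μ := volume.restrict D) (s := {s : ℝ | ρ / 2 < ρ₀ + s * σ}) (x₀ := t)
    (F := fun s z => u z * scaledBump (p + s • v) (ρ₀ + s * σ) z)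
    (F' := fun s z => u z *
      (-((ρ₀ + s * σ) ^ (d + 1))⁻¹ * Φ ((ρ₀ + s * σ)⁻¹ • (z - (p + s • v)))))
    (bound := fun z => ‖u z‖ * (((ρ / 2) ^ (d + 1))⁻¹ * B)) hs
    (Eventually.of_forall hmeas) ?_ ?_ ?_ ?_ ?_
  · refine ⟨_, key.2, ?_⟩
    have hint : ∀ i, IntegrableOn (fun z => u z * fderiv ℝ (ψ i) z (EuclideanSpace.single i 1)) D :=
      fun i => by
        have hc : Continuous fun z => fderiv ℝ (ψ i) z (EuclideanSpace.single i (1 : ℝ)) :=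
          ((hψ i).continuous_fderiv (by simp)).clm_apply continuous_const
        obtain ⟨b, hb⟩ := hc.bounded_above_of_compact_support ((hψc i).fderiv_apply (𝕜 := ℝ) _)
        exact hu.mul_bdd (c := b) hc.aestronglyMeasurable (Eventually.of_forall hb)
    have hGi : ∀ i, IntegrableOn (fun z => G z i) D := fun i =>
      (EuclideanSpace.proj i : Space d →L[ℝ] ℝ).integrable_comp hG
    have hint2 : ∀ i, IntegrableOn (fun z => G z i * ψ i z) D := fun i => by
      obtain ⟨b, hb⟩ := (hψ i).continuous.bounded_above_of_compact_support (hψc i)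
      exact (hGi i).mul_bdd (c := b) (hψ i).continuous.aestronglyMeasurable (Eventually.of_forall hb)
    have e1 : ∫ z in D, u z * (-(ρ ^ (d + 1))⁻¹ * Φ (ρ⁻¹ • (z - c))) =
        ∫ z in D, ∑ i, G z i * ψ i z := by
      have : ∀ z, u z * (-(ρ ^ (d + 1))⁻¹ * Φ (ρ⁻¹ • (z - c))) =
          -∑ i, u z * fderiv ℝ (ψ i) z (EuclideanSpace.single i 1) := by
        intro z
        rw [← Finset.mul_sum, hdiv z]; ring
      simp_rw [this]
      rw [integral_neg, integral_finsetSum _ fun i _ => hint i,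
        integral_finsetSum _ fun i _ => hint2 i, ← Finset.sum_neg_distrib]
      refine Finset.sum_congr rfl fun i _ => ?_
      rw [h (ψ i) (hψ i) (hψc i) ((hψs i).trans hball) i, neg_neg]
    change |∫ z in D, u z * (-(ρ ^ (d + 1))⁻¹ * Φ (ρ⁻¹ • (z - c)))| ≤ _
    rw [e1]
    have hpt : ∀ z, ‖∑ i, G z i * ψ i z‖ ≤
        (closedBall c ρ).indicator
          (fun z => (‖v‖ + |σ|) * bumpBound d * (ρ ^ d)⁻¹ * ‖G z‖) z := by
      intro z
      by_cases hz : z ∈ closedBall c ρ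
      · rw [indicator_of_mem hz]
        set y := ρ⁻¹ • (z - c) with hy
        have hy1 : ‖y‖ ≤ 1 := by
          rw [hy, norm_smul, norm_inv, Real.norm_of_nonneg hρ.le, inv_mul_eq_div, div_le_one hρ]
          rwa [mem_closedBall, dist_eq_norm] at hz
        have f1 : ∑ i, G z i * ψ i z = ((ρ ^ d)⁻¹ * bump y) * ⟪v + σ • y, G z⟫_ℝ := by
          rw [PiLp.inner_apply, Finset.mul_sum]
          refine Finset.sum_congr rfl fun i _ => ?_
          have f0 : ψ i z = (ρ ^ d)⁻¹ * ((v i + σ * y i) * bump y) := rfl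
          rw [f0]
          simp only [RCLike.inner_apply, conj_trivial, PiLp.add_apply, PiLp.smul_apply, smul_eq_mul]
          ring
        rw [f1, norm_mul, Real.norm_of_nonneg (mul_nonneg (by positivity) (bump_nonneg _))]
        have f2 : ‖⟪v + σ • y, G z⟫_ℝ‖ ≤ (‖v‖ + |σ|) * ‖G z‖ := by
          refine (norm_inner_le_norm _ _).trans (mul_le_mul_of_nonneg_right ?_ (norm_nonneg _))
          refine (norm_add_le _ _).trans (add_le_add le_rfl ?_)
          rw [norm_smul, Real.norm_eq_abs]
          exact mul_le_of_le_one_right (abs_nonneg _) hy1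
        calc (ρ ^ d)⁻¹ * bump y * ‖⟪v + σ • y, G z⟫_ℝ‖
            ≤ (ρ ^ d)⁻¹ * bumpBound d * ((‖v‖ + |σ|) * ‖G z‖) := by
              gcongr
              · exact mul_nonneg (by positivity) (bumpBound_pos d).le
              · exact bump_le y
          _ = _ := by ring
      · rw [indicator_of_notMem hz]
        simp [hψ0 _ z hz]
    have hGn : IntegrableOn (fun z => (‖v‖ + |σ|) * bumpBound d * (ρ ^ d)⁻¹ * ‖G z‖) D :=
      hG.norm.const_mul _
    calc |∫ z in D, ∑ i, G z i * ψ i z|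
        ≤ ∫ z in D, (closedBall c ρ).indicator
          (fun z => (‖v‖ + |σ|) * bumpBound d * (ρ ^ d)⁻¹ * ‖G z‖) z :=
          norm_integral_le_of_norm_le (hGn.indicator measurableSet_closedBall)
            (Eventually.of_forall hpt)
      _ = _ := by
          rw [integral_indicator measurableSet_closedBall,
            Measure.restrict_restrict measurableSet_closedBall, inter_comm, integral_const_mul]
  · have hb : ∀ z, ‖scaledBump c ρ z‖ ≤ bumpBound d * (ρ ^ d)⁻¹ := fun z => by
      rw [Real.norm_of_nonneg (scaledBump_nonneg _ hρ _)]; exact scaledBump_le _ hρ _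
    exact hu.mul_bdd (scaledBump_contDiff _ _).continuous.aestronglyMeasurable
      (Eventually.of_forall hb)
  · refine hu.aestronglyMeasurable.mul (Continuous.aestronglyMeasurable ?_)
    exact continuous_const.mul (hΦc.comp (by fun_prop))
  · refine Eventually.of_forall fun z s hs => ?_
    have hs' : ρ / 2 < ρ₀ + s * σ := hs
    have hs0 : 0 < ρ₀ + s * σ := by linarith
    rw [norm_mul, norm_mul, norm_neg, norm_inv, norm_pow, Real.norm_of_nonneg hs0.le]
    gcongr
    exact hB _
  · exact hu.norm.mul_const _
  · refine Eventually.of_forall fun z s hs => ?_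
    have hs' : ρ / 2 < ρ₀ + s * σ := hs
    exact (hK s (by linarith) z).const_mul (u z)

/-! ### Comparison of averages along chains of balls -/

theorem scaledBump_integral (c : Space d) {ρ : ℝ} (hρ : 0 < ρ) : ∫ z, scaledBump c ρ z = 1 := by
  unfold scaledBump
  rw [integral_const_mul, integral_sub_right_eq_self (fun z => bump (ρ⁻¹ • z)) c,
    Measure.integral_comp_inv_smul, bump_integral, finrank_euclideanSpace_fin,
    abs_of_nonneg (by positivity), smul_eq_mul, mul_one, inv_mul_cancel₀ (by positivity)]

theorem scaledBump_integrable (c : Space d) {ρ : ℝ} (hρ : 0 < ρ) :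
    Integrable (scaledBump c ρ) :=
  (scaledBump_contDiff c ρ).continuous.integrable_of_hasCompactSupport
    (HasCompactSupport.intro (isCompact_closedBall c ρ) fun _ h => scaledBump_eq_zero hρ h)

/-- An average differs from a constant by at most a multiple of the mean oscillation about it, which
tends to zero at Lebesgue points. -/
theorem abs_ballAvg_sub_const_le {D : Set (Space d)} (hD : MeasurableSet D) {u : Space d → ℝ}
    (hu : IntegrableOn u D) {c : Space d} {ρ : ℝ} (hρ : 0 < ρ) (a : ℝ) :
    |ballAvg D u c ρ - a| ≤ bumpBound d * volume.real (ball (0 : Space d) 1) *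
      ⨍ y in closedBall c ρ, ‖D.indicator u y - a‖ := by
  have hf : Integrable (D.indicator u) := hu.integrable_indicator hD
  have hK := scaledBump_integrable c hρ
  have hbK : ∀ z, ‖scaledBump c ρ z‖ ≤ bumpBound d * (ρ ^ d)⁻¹ := fun z => by
    rw [Real.norm_of_nonneg (scaledBump_nonneg _ hρ _)]; exact scaledBump_le _ hρ _
  have hfK : Integrable fun z => D.indicator u z * scaledBump c ρ z :=
    hf.mul_bdd hK.aestronglyMeasurable (Eventually.of_forall hbK)
  have e1 : ballAvg D u c ρ - a = ∫ z, (D.indicator u z - a) * scaledBump c ρ z := by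
    simp_rw [sub_mul]
    rw [integral_sub hfK (hK.const_mul a), integral_const_mul, scaledBump_integral c hρ, mul_one,
      ballAvg, ← integral_indicator hD]
    congr 1
    refine integral_congr_ae (Eventually.of_forall fun z => ?_)
    by_cases hz : z ∈ D <;> simp [hz]
  have hloc : IntegrableOn (fun z => ‖D.indicator u z - a‖) (closedBall c ρ) :=
    (hf.integrableOn.sub (integrableOn_const (measure_closedBall_lt_top.ne))).norm
  have e2 : |∫ z, (D.indicator u z - a) * scaledBump c ρ z| ≤
      ∫ z, (closedBall c ρ).indicator
        (fun z => ‖D.indicator u z - a‖ * (bumpBound d * (ρ ^ d)⁻¹)) z := by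
    rw [← Real.norm_eq_abs]
    refine norm_integral_le_of_norm_le
      ((integrable_indicator_iff measurableSet_closedBall).2 (hloc.mul_const _))
      (Eventually.of_forall fun z => ?_)
    by_cases hz : z ∈ closedBall c ρ
    · rw [indicator_of_mem hz, norm_mul]
      exact mul_le_mul_of_nonneg_left (hbK z) (norm_nonneg _)
    · rw [indicator_of_notMem hz, scaledBump_eq_zero hρ hz]; simp
  rw [e1]
  refine e2.trans_eq ?_
  rw [integral_indicator measurableSet_closedBall, integral_mul_const, setAverage_eq, smul_eq_mul,
    measureReal_def (s := closedBall c ρ), Measure.addHaar_closedBall _ _ hρ.le, finrank_euclideanSpace_fin,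
    ENNReal.toReal_mul, ENNReal.toReal_ofReal (by positivity), ← measureReal_def]
  have : 0 < volume.real (ball (0 : Space d) 1) :=
    ENNReal.toReal_pos (measure_ball_pos _ _ one_pos).ne' measure_ball_lt_top.ne
  field_simp

/-- Two balls that are joined inside `D` by a linear motion: the averages over them differ by at most
the `L¹` norm of the gradient, up to a constant that depends on a lower bound `m` of the radii. -/
theorem abs_ballAvg_sub_le {D : Set (Space d)} {u : Space d → ℝ} {G : Space d → Space d}
    (hu : IntegrableOn u D) (hG : IntegrableOn G D) (h : IsWeakGrad D u G)
    {p q : Space d} {ρ σ m : ℝ} (hm : 0 < m) (hmρ : m ≤ ρ) (hmσ : m ≤ σ)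
    (hball : ∀ t ∈ Icc (0 : ℝ) 1, closedBall (p + t • (q - p)) (ρ + t * (σ - ρ)) ⊆ D) :
    |ballAvg D u q σ - ballAvg D u p ρ| ≤
      (‖q - p‖ + |σ - ρ|) * bumpBound d * (m ^ d)⁻¹ * ∫ z in D, ‖G z‖ := by
  have hmt : ∀ t ∈ Icc (0 : ℝ) 1, m ≤ ρ + t * (σ - ρ) := fun t ht => by
    nlinarith [mul_nonneg ht.1 (sub_nonneg.2 hmσ), mul_nonneg (sub_nonneg.2 ht.2) (sub_nonneg.2 hmρ)]
  have key : ∀ t ∈ Icc (0 : ℝ) 1, ∃ M' : ℝ,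
      HasDerivAt (fun t => ballAvg D u (p + t • (q - p)) (ρ + t * (σ - ρ))) M' t ∧
      |M'| ≤ (‖q - p‖ + |σ - ρ|) * bumpBound d * (m ^ d)⁻¹ * ∫ z in D, ‖G z‖ := by
    intro t ht
    have hpos : 0 < ρ + t * (σ - ρ) := hm.trans_le (hmt t ht)
    obtain ⟨M', h1, h2⟩ := hasDerivAt_ballAvg hu hG h p (q - p) ρ (σ - ρ) t hpos (hball t ht)
    refine ⟨M', h1, h2.trans ?_⟩
    have hC := (bumpBound_pos d).le
    gcongr
    · exact hmt t ht
    · exact Eventually.of_forall fun _ => norm_nonneg _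
    · exact hG.norm
    · exact inter_subset_left
  choose! f' hf' using key
  have := norm_image_sub_le_of_norm_deriv_le_segment_01' (f := fun t =>
    ballAvg D u (p + t • (q - p)) (ρ + t * (σ - ρ))) (f' := f')
    (fun t ht => (hf' t ht).1.hasDerivWithinAt) (fun t ht => (hf' t ⟨ht.1, ht.2.le⟩).2)
  simpa using this

/-- Two points of `D` are linked if the averages over balls around them differ by at most a
constant times the `L¹` norm of the gradient. -/
def Linked (D : Set (Space d)) (p q : Space d) : Prop :=
  ∀ ρ σ : ℝ, 0 < ρ → closedBall p ρ ⊆ D → 0 < σ → closedBall q σ ⊆ D →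
    ∃ C : ℝ, 0 ≤ C ∧ ∀ (u : Space d → ℝ) (G : Space d → Space d), IntegrableOn u D →
      IntegrableOn G D → IsWeakGrad D u G →
        |ballAvg D u q σ - ballAvg D u p ρ| ≤ C * ∫ z in D, ‖G z‖

theorem Linked.symm {D : Set (Space d)} {p q : Space d} (h : Linked D p q) : Linked D q p := by
  intro ρ σ h1 h2 h3 h4
  obtain ⟨C, hC, hh⟩ := h σ ρ h3 h4 h1 h2
  exact ⟨C, hC, fun u G hu hG h => by rw [abs_sub_comm]; exact hh u G hu hG h⟩

theorem Linked.refl (D : Set (Space d)) (p : Space d) : Linked D p p := by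
  intro ρ σ h1 h2 h3 h4
  refine ⟨_, ?_, fun u G hu hG h =>
    abs_ballAvg_sub_le hu hG h (m := min ρ σ) (lt_min h1 h3) (min_le_left _ _) (min_le_right _ _) ?_⟩
  · have := (bumpBound_pos d).le
    have := (lt_min h1 h3).le
    positivity
  · intro t ht
    have e : ρ + t * (σ - ρ) ≤ max ρ σ := by
      have := mul_le_mul_of_nonneg_left (le_max_right ρ σ) ht.1
      have := mul_le_mul_of_nonneg_left (le_max_left ρ σ) (sub_nonneg.2 ht.2)
      linarith
    rw [sub_self, smul_zero, add_zero]
    refine (closedBall_subset_closedBall e).trans ?_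
    rcases max_choice ρ σ with h | h <;> rw [h] <;> assumption

theorem Linked.trans {D : Set (Space d)} (hD : IsOpen D) {p q r : Space d} (hq : q ∈ D)
    (h₁ : Linked D p q) (h₂ : Linked D q r) : Linked D p r := by
  intro ρ σ h1 h2 h3 h4
  obtain ⟨η, hη, hs⟩ := nhds_basis_closedBall.mem_iff.1 (hD.mem_nhds hq)
  obtain ⟨C₁, hC₁, hh₁⟩ := h₁ ρ η h1 h2 hη hs
  obtain ⟨C₂, hC₂, hh₂⟩ := h₂ η σ hη hs h3 h4
  refine ⟨C₁ + C₂, by positivity, fun u G hu hG h => ?_⟩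
  have e1 := hh₁ u G hu hG h
  have e2 := hh₂ u G hu hG h
  have := abs_sub_le (ballAvg D u r σ) (ballAvg D u q η) (ballAvg D u p ρ)
  rw [add_mul]; linarith

/-- Equal balls, whose centres are closer than their radius `ρ`, inside a ball of radius `2ρ`. -/
theorem abs_ballAvg_sub_le_of_near {D : Set (Space d)} {p q : Space d} {ρ : ℝ} (hρ : 0 < ρ)
    (hb : closedBall p (2 * ρ) ⊆ D) (hq : dist q p ≤ ρ) {u : Space d → ℝ}
    {G : Space d → Space d} (hu : IntegrableOn u D) (hG : IntegrableOn G D)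
    (h : IsWeakGrad D u G) :
    |ballAvg D u q ρ - ballAvg D u p ρ| ≤ ρ * bumpBound d * (ρ ^ d)⁻¹ * ∫ z in D, ‖G z‖ := by
  have h1 := abs_ballAvg_sub_le hu hG h (p := p) (q := q) (ρ := ρ) (σ := ρ) hρ le_rfl le_rfl ?_
  · refine h1.trans ?_
    have := (bumpBound_pos d).le
    rw [sub_self, abs_zero, add_zero, ← dist_eq_norm]
    have : 0 ≤ ∫ z in D, ‖G z‖ := integral_nonneg fun _ => norm_nonneg _
    gcongr
  · intro t ht
    refine (closedBall_subset_closedBall' ?_).trans hb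
    rw [dist_eq_norm, add_sub_cancel_left, norm_smul, Real.norm_of_nonneg ht.1, ← dist_eq_norm]
    have : t * dist q p ≤ 1 * ρ := mul_le_mul ht.2 hq dist_nonneg zero_le_one
    linarith

theorem linked_of_isPreconnected {D : Set (Space d)} (hD : IsOpen D) (hc : IsPreconnected D)
    {p q : Space d} (hp : p ∈ D) (hq : q ∈ D) : Linked D p q := by
  refine hc.induction₂ (Linked D) (fun x hx => ?_) (fun x y z _ hy _ h1 h2 => h1.trans hD hy h2)
    (fun x y _ _ h => h.symm) hp hq
  obtain ⟨η, hη, hs⟩ := nhds_basis_closedBall.mem_iff.1 (hD.mem_nhds hx)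
  have hη2 : 0 < η / 2 := by positivity
  refine mem_nhdsWithin_of_mem_nhds (mem_of_superset (closedBall_mem_nhds x hη2) fun y hy => ?_)
  intro ρ σ h1 h2 h3 h4
  have hb : closedBall x (2 * (η / 2)) ⊆ D := by rwa [mul_div_cancel₀ _ two_ne_zero]
  have hsx : closedBall x (η / 2) ⊆ D := (closedBall_subset_closedBall (by linarith)).trans hs
  have hsy : closedBall y (η / 2) ⊆ D :=
    (closedBall_subset_closedBall' (by have := mem_closedBall.1 hy; linarith)).trans hs
  obtain ⟨C₁, hC₁, hh₁⟩ := Linked.refl D x ρ (η / 2) h1 h2 hη2 hsx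
  obtain ⟨C₂, hC₂, hh₂⟩ := Linked.refl D y (η / 2) σ hη2 hsy h3 h4
  have hB := (bumpBound_pos d).le
  refine ⟨C₁ + C₂ + η / 2 * bumpBound d * ((η / 2) ^ d)⁻¹, by positivity, fun u G hu hG h => ?_⟩
  have e1 := abs_le.1 (hh₁ u G hu hG h)
  have e2 := abs_le.1 (hh₂ u G hu hG h)
  have e3 := abs_le.1 (abs_ballAvg_sub_le_of_near hη2 hb hy hu hG h)
  rw [add_mul, add_mul, abs_le]
  constructor <;> linarith [e1.1, e1.2, e2.1, e2.2, e3.1, e3.2]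

/-- On a bounded connected open set, all averages over balls of a given radius differ from a fixed
one by at most a constant times the `L¹` norm of the gradient. -/
theorem exists_abs_ballAvg_sub_le {D : Set (Space d)} (hD : IsOpen D) (hc : IsPreconnected D)
    (hbd : Bornology.IsBounded D) {p₀ : Space d} {ρ₀ : ℝ} (hρ₀ : 0 < ρ₀)
    (hb₀ : closedBall p₀ ρ₀ ⊆ D) {ρ : ℝ} (hρ : 0 < ρ) :
    ∃ C : ℝ, 0 ≤ C ∧ ∀ p : Space d, closedBall p ρ ⊆ D →
      ∀ (u : Space d → ℝ) (G : Space d → Space d), IntegrableOn u D → IntegrableOn G D →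
        IsWeakGrad D u G → |ballAvg D u p ρ - ballAvg D u p₀ ρ₀| ≤ C * ∫ z in D, ‖G z‖ := by
  -- the centres form a totally bounded set, and a finite `ρ / 2`-net of it is compared with `p₀` by a
  -- chain; the half radius keeps the balls that join a centre to its neighbour in the net inside `D`
  set ρ' := ρ / 2 with hρ'
  have hρ'0 : 0 < ρ' := by positivity
  have htb : TotallyBounded {p : Space d | closedBall p ρ ⊆ D} :=
    by
    have : {p : Space d | closedBall p ρ ⊆ D} ⊆ D := fun p hp => hp (mem_closedBall_self hρ.le)
    exact (hbd.subset this).isCompact_closure.totallyBounded.subset subset_closure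
  obtain ⟨t, htK, htf, ht⟩ := finite_approx_of_totallyBounded htb ρ' hρ'0
  have hsub : ∀ q ∈ t, closedBall q ρ' ⊆ D := fun q hq =>
    (closedBall_subset_closedBall (by rw [hρ']; linarith)).trans (htK hq)
  have hlink : ∀ q ∈ t, ∃ C : ℝ, 0 ≤ C ∧ ∀ (u : Space d → ℝ) (G : Space d → Space d),
      IntegrableOn u D → IntegrableOn G D → IsWeakGrad D u G →
        |ballAvg D u q ρ' - ballAvg D u p₀ ρ₀| ≤ C * ∫ z in D, ‖G z‖ := fun q hq =>
    linked_of_isPreconnected hD hc (hb₀ (mem_closedBall_self hρ₀.le))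
      (hsub q hq (mem_closedBall_self hρ'0.le)) ρ₀ ρ' hρ₀ hb₀ hρ'0 (hsub q hq)
  choose! C hC0 hC using hlink
  have hB := (bumpBound_pos d).le
  refine ⟨∑ q ∈ htf.toFinset, C q + ρ' * bumpBound d * (ρ' ^ d)⁻¹ +
    (ρ' * bumpBound d * (ρ' ^ d)⁻¹), ?_, ?_⟩
  · have : 0 ≤ ∑ q ∈ htf.toFinset, C q := Finset.sum_nonneg fun q hq => hC0 q (by simpa using hq)
    positivity
  intro p hp u G hu hG h
  obtain ⟨q, hq, hpq⟩ := mem_iUnion₂.1 (ht hp)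
  have hI : 0 ≤ ∫ z in D, ‖G z‖ := integral_nonneg fun _ => norm_nonneg _
  have hbq : closedBall q (2 * ρ') ⊆ D := by
    rw [hρ', mul_div_cancel₀ _ two_ne_zero]; exact htK hq
  have e1 := abs_le.1 (abs_ballAvg_sub_le_of_near hρ'0 hbq (mem_ball.1 hpq).le hu hG h)
  have e2 := abs_le.1 (hC q hq u G hu hG h)
  have e3 : |ballAvg D u p ρ - ballAvg D u p ρ'| ≤
      ρ' * bumpBound d * (ρ' ^ d)⁻¹ * ∫ z in D, ‖G z‖ := by
    have h1 := abs_ballAvg_sub_le hu hG h (p := p) (q := p) (ρ := ρ') (σ := ρ) hρ'0 le_rfl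
      (by rw [hρ']; linarith) ?_
    · refine h1.trans_eq ?_
      have : ρ - ρ' = ρ' := by rw [hρ']; ring
      rw [this, sub_self, norm_zero, zero_add, abs_of_pos hρ'0]
    · intro t ht
      rw [sub_self, smul_zero, add_zero]
      refine (closedBall_subset_closedBall ?_).trans hp
      have : t * (ρ - ρ') ≤ 1 * (ρ - ρ') :=
        mul_le_mul_of_nonneg_right ht.2 (by rw [hρ']; linarith)
      linarith
  have e3 := abs_le.1 e3
  have e4 : C q * ∫ z in D, ‖G z‖ ≤ (∑ q ∈ htf.toFinset, C q) * ∫ z in D, ‖G z‖ := by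
    refine mul_le_mul_of_nonneg_right ?_ hI
    exact Finset.single_le_sum (fun q hq => hC0 q (by simpa using hq)) (by simpa using hq)
  rw [add_mul, add_mul, abs_le]
  constructor <;> linarith [e1.1, e1.2, e2.1, e2.2, e3.1, e3.2]

/-! ### A pointwise estimate from the cone condition -/

/-- Closed balls along the axis of a cone, of radius proportional to the distance from the vertex,
lie in the cone. -/
theorem closedBall_subset_of_cone {D : Set (Space d)} {r κ η : ℝ} (hκ : 0 < κ) (hκ1 : κ < 1)
    (hη : η = (1 - κ) / 4) {x e : Space d} (he : ‖e‖ = 1)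
    (hcone : ∀ y : Space d, ‖y‖ < r → κ * ‖y‖ < ⟪e, y⟫_ℝ → x + y ∈ D) {t : ℝ} (ht : 0 < t)
    (htr : t ≤ r / 4) : closedBall (x + t • e) (t * η) ⊆ D := by
  intro w hw
  have h0 : x + (w - x) = w := by abel
  rw [mem_closedBall, dist_eq_norm] at hw
  set y := w - x with hy
  have h1 : ‖y - t • e‖ ≤ t * η := by
    have : y - t • e = w - (x + t • e) := by rw [hy]; abel
    rwa [this]
  have h2 : ‖y‖ ≤ t + t * η := by
    have : y = t • e + (y - t • e) := by abel
    rw [this]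
    refine (norm_add_le _ _).trans (add_le_add ?_ h1)
    rw [norm_smul, he, mul_one, Real.norm_of_nonneg ht.le]
  have h3 : t - t * η ≤ ⟪e, y⟫_ℝ := by
    have e1 : ⟪e, y⟫_ℝ = t + ⟪e, y - t • e⟫_ℝ := by
      rw [inner_sub_right e y, inner_smul_right, real_inner_self_eq_norm_sq, he]; ring
    have e2 := (abs_le.1 (abs_real_inner_le_norm e (y - t • e))).1
    rw [he, one_mul] at e2
    linarith
  rw [← h0]
  refine hcone y ?_ ?_
  · nlinarith
  · have : κ * ‖y‖ ≤ κ * (t + t * η) := mul_le_mul_of_nonneg_left h2 hκ.le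
    have e4 : κ * (t + t * η) < t - t * η := by
      have : 0 < t * (1 - κ) * (3 - κ) := mul_pos (mul_pos ht (by linarith)) (by linarith)
      rw [hη]; nlinarith
    linarith

/-- **Pointwise potential estimate** on a bounded connected domain with the cone condition: up to a
constant, a weakly differentiable function is dominated by a potential of its gradient. The
potential is written as an integral over radii, and the value at `x` is compared with an average
over a ball of fixed size by moving this ball into `x` along the axis of the cone at `x`. -/
theorem ConeCondition.exists_pointwise_le {D : Set (Space d)} (hD : IsOpen D)
    (hconn : IsConnected D) (hbd : Bornology.IsBounded D) (hcone : ConeCondition D) :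
    ∃ R C : ℝ, 0 < R ∧ 0 ≤ C ∧ ∀ (u : Space d → ℝ) (G : Space d → Space d),
      IntegrableOn u D → IntegrableOn G D → IsWeakGrad D u G → ∃ c : ℝ,
        ∀ᵐ x ∂(volume.restrict D), ‖u x - c‖ₑ ≤ ENNReal.ofReal C *
          ((∫⁻ z in D, ‖G z‖ₑ) + ∫⁻ t in Ioc 0 R, ENNReal.ofReal (t ^ d)⁻¹ *
            ∫⁻ z in D ∩ closedBall x (2 * t), ‖G z‖ₑ) := by
  obtain ⟨r, κ, hr, hκ, hκ1, hc⟩ := hcone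
  set η : ℝ := (1 - κ) / 4 with hη
  have hη0 : 0 < η := by rw [hη]; linarith
  have hη1 : η < 1 := by rw [hη]; linarith
  set R := r / 4 with hR
  have hR0 : 0 < R := by positivity
  obtain ⟨p₀, hp₀⟩ := hconn.nonempty
  obtain ⟨ρ₀, hρ₀, hb₀⟩ := nhds_basis_closedBall.mem_iff.1 (hD.mem_nhds hp₀)
  obtain ⟨C₁, hC₁, hC₁'⟩ := exists_abs_ballAvg_sub_le hD hconn.isPreconnected hbd hρ₀ hb₀
    (ρ := R * η) (by positivity)
  set C₂ : ℝ := (1 + η) * bumpBound d * (η ^ d)⁻¹ with hC₂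
  have hB := (bumpBound_pos d).le
  have hC₂0 : 0 ≤ C₂ := by positivity
  refine ⟨R, C₁ + C₂, hR0, by positivity, fun u G hu hG h => ⟨ballAvg D u p₀ ρ₀, ?_⟩⟩
  have hf : Integrable (D.indicator u) := hu.integrable_indicator hD.measurableSet
  -- Lebesgue's differentiation theorem for balls that are not centred at `x`: the balls `(w, δ)`
  -- only have to be so close to `x` that `x` lies in the ball `(w, η⁻¹ δ)`
  have hleb : ∀ᵐ x : Space d, ∀ {ι : Type} {l : Filter ι} (w : ι → Space d) (δ : ι → ℝ),
      Tendsto δ l (𝓝[>] 0) → (∀ᶠ j in l, x ∈ closedBall (w j) (η⁻¹ * δ j)) →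
      Tendsto (fun j => ⨍ y in closedBall (w j) (δ j), ‖D.indicator u y - D.indicator u x‖)
        l (𝓝 0) :=
    IsUnifLocDoublingMeasure.ae_tendsto_average_norm_sub volume hf.locallyIntegrable η⁻¹
  rw [ae_restrict_iff' hD.measurableSet]
  filter_upwards [hleb] with x hx hxD
  obtain ⟨e, he, hce⟩ := hc x hxD
  have hball : ∀ t : ℝ, 0 < t → t ≤ R → closedBall (x + t • e) (0 + t * η) ⊆ D :=
    fun t ht htR => by
      rw [zero_add]; exact closedBall_subset_of_cone hκ hκ1 hη he hce ht htR
  -- `M t` is the average over the ball at distance `t` along the axis of the cone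
  let M : ℝ → ℝ := fun t => ballAvg D u (x + t • e) (0 + t * η)
  let g : ℝ → ℝ := fun t => ∫ z in D ∩ closedBall x (2 * t), ‖G z‖
  have hGn : IntegrableOn (fun z => ‖G z‖) D := hG.norm
  have hgmono : Monotone g := fun s t hst =>
    setIntegral_mono_set (hGn.mono_set inter_subset_left)
      (Eventually.of_forall fun _ => norm_nonneg _)
      (inter_subset_inter_right _ (closedBall_subset_closedBall (by linarith))).eventuallyLE
  have hg0 : ∀ t, 0 ≤ g t := fun t => integral_nonneg fun _ => norm_nonneg _
  let φ : ℝ → ℝ := fun t => C₂ * ((t ^ d)⁻¹ * g t)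
  have hder : ∀ t, 0 < t → t ≤ R →
      HasDerivAt M (deriv M t) t ∧ |deriv M t| ≤ φ t := by
    intro t ht htR
    obtain ⟨M', h1, h2⟩ := hasDerivAt_ballAvg hu hG h x e 0 η t (by positivity) (hball t ht htR)
    have h1 : HasDerivAt M M' t := h1
    rw [h1.deriv]
    refine ⟨h1, h2.trans ?_⟩
    have h3 : ∫ z in D ∩ closedBall (x + t • e) (0 + t * η), ‖G z‖ ≤ g t := by
      refine setIntegral_mono_set (hGn.mono_set inter_subset_left)
        (Eventually.of_forall fun _ => norm_nonneg _) (LE.le.eventuallyLE ?_)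
      refine inter_subset_inter_right _ (closedBall_subset_closedBall' ?_)
      rw [dist_eq_norm, add_sub_cancel_left, norm_smul, he, mul_one, Real.norm_of_nonneg ht.le]
      nlinarith
    rw [he, abs_of_pos hη0]
    calc _ ≤ (1 + η) * bumpBound d * ((0 + t * η) ^ d)⁻¹ * g t := by gcongr
      _ = φ t := by simp only [φ, hC₂, zero_add, mul_pow, mul_inv]; ring
  -- `φ` need not be integrable up to `0`
  have hφint : ∀ a, 0 < a → IntegrableOn φ (Icc a R) := fun a ha => by
    refine Integrable.const_mul ?_ _
    refine IntegrableOn.continuousOn_mul ?_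
      ((hgmono.monotoneOn _).integrableOn_isCompact isCompact_Icc) isCompact_Icc
    exact ContinuousOn.inv₀ (by fun_prop) fun t ht => (pow_pos (ha.trans_le ht.1) d).ne'
  have hφ0 : ∀ t, 0 < t → 0 ≤ φ t := fun t ht =>
    mul_nonneg hC₂0 (mul_nonneg (inv_nonneg.2 (pow_nonneg ht.le d)) (hg0 t))
  set I : ℝ≥0∞ := ∫⁻ t in Ioc 0 R, ENNReal.ofReal (t ^ d)⁻¹ *
    ∫⁻ z in D ∩ closedBall x (2 * t), ‖G z‖ₑ with hI
  have hstep : ∀ a, 0 < a → a ≤ R → ENNReal.ofReal |M R - M a| ≤ ENNReal.ofReal C₂ * I := by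
    intro a ha haR
    have hcont : ContinuousOn M (Icc a R) := fun t ht =>
      (hder t (ha.trans_le ht.1) ht.2).1.continuousAt.continuousWithinAt
    have h1 := intervalIntegral.sub_le_integral_of_hasDeriv_right_of_le haR hcont
      (fun t ht => (hder t (ha.trans ht.1) ht.2.le).1.hasDerivWithinAt) (hφint a ha)
      (fun t ht => (le_abs_self _).trans (hder t (ha.trans ht.1) ht.2.le).2)
    have h2 := intervalIntegral.sub_le_integral_of_hasDeriv_right_of_le haR hcont.neg
      (fun t ht => (hder t (ha.trans ht.1) ht.2.le).1.neg.hasDerivWithinAt) (hφint a ha)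
      (fun t ht => (neg_le_abs _).trans (hder t (ha.trans ht.1) ht.2.le).2)
    have h3 : |M R - M a| ≤ ∫ t in a..R, φ t :=
      abs_le.2 ⟨by simp only [Pi.neg_apply] at h2; linarith, h1⟩
    refine (ENNReal.ofReal_le_ofReal h3).trans ?_
    rw [intervalIntegral.integral_of_le haR, ofReal_integral_eq_lintegral_ofReal
      ((hφint a ha).mono_set Ioc_subset_Icc_self)
      ((ae_restrict_iff' measurableSet_Ioc).2 (Eventually.of_forall fun t ht =>
        hφ0 t (ha.trans ht.1))), ← lintegral_const_mul' _ _ ENNReal.ofReal_ne_top]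
    refine (lintegral_mono_ae ?_).trans (lintegral_mono_set (Ioc_subset_Ioc_left ha.le))
    refine (ae_restrict_iff' measurableSet_Ioc).2 (Eventually.of_forall fun t ht => ?_)
    have ht0 : 0 < t := ha.trans ht.1
    have hgl : ENNReal.ofReal (g t) = ∫⁻ z in D ∩ closedBall x (2 * t), ‖G z‖ₑ :=
      ofReal_integral_norm_eq_lintegral_enorm (hG.mono_set inter_subset_left)
    simp only [φ]
    rw [ENNReal.ofReal_mul (p := C₂) hC₂0, ENNReal.ofReal_mul (p := (t ^ d)⁻¹) (by positivity), hgl]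
  -- at a Lebesgue point the averages converge to the value of `u` as the ball shrinks into `x`
  have hlim : Tendsto M (𝓝[>] 0) (𝓝 (u x)) := by
    rw [tendsto_iff_dist_tendsto_zero]
    have h1 := hx (l := 𝓝[>] (0 : ℝ)) (fun t => x + t • e) (fun t => 0 + t * η) ?_ ?_
    · have h2 := h1.const_mul (bumpBound d * volume.real (ball (0 : Space d) 1))
      rw [mul_zero] at h2
      refine squeeze_zero' (Eventually.of_forall fun _ => dist_nonneg) ?_ h2
      filter_upwards [self_mem_nhdsWithin] with t ht
      have := abs_ballAvg_sub_const_le hD.measurableSet hu (c := x + t • e) (ρ := 0 + t * η)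
        (by have : 0 < t := ht
            positivity) (u x)
      rw [indicator_of_mem hxD]
      exact this
    · refine tendsto_nhdsWithin_iff.2 ⟨?_, ?_⟩
      · have : Tendsto (fun t : ℝ => 0 + t * η) (𝓝 0) (𝓝 (0 + 0 * η)) := by
          apply Continuous.tendsto; fun_prop
        simpa using this.mono_left nhdsWithin_le_nhds
      · filter_upwards [self_mem_nhdsWithin] with t ht
        have : 0 < t := ht
        rw [mem_Ioi]; positivity
    · filter_upwards [self_mem_nhdsWithin] with t ht
      have ht : 0 < t := ht
      rw [mem_closedBall, dist_comm, dist_eq_norm, add_sub_cancel_left, norm_smul, he, mul_one,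
        Real.norm_of_nonneg ht.le, zero_add, mul_comm t, inv_mul_cancel_left₀ hη0.ne']
  have hfin : ENNReal.ofReal |M R - u x| ≤ ENNReal.ofReal C₂ * I := by
    have h1 : Tendsto (fun a => ENNReal.ofReal |M R - M a|) (𝓝[>] 0)
        (𝓝 (ENNReal.ofReal |M R - u x|)) :=
      (ENNReal.continuous_ofReal.tendsto _).comp (hlim.const_sub (M R)).abs
    refine le_of_tendsto h1 ?_
    filter_upwards [Ioc_mem_nhdsGT hR0] with a ha using hstep a ha.1 ha.2
  have hC₁'' : ENNReal.ofReal |M R - ballAvg D u p₀ ρ₀| ≤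
      ENNReal.ofReal C₁ * ∫⁻ z in D, ‖G z‖ₑ := by
    have h1 : |M R - ballAvg D u p₀ ρ₀| ≤ C₁ * ∫ z in D, ‖G z‖ := by
      have hb := hball R hR0 le_rfl
      simp only [M]
      rw [zero_add] at hb ⊢
      exact hC₁' _ hb u G hu hG h
    refine (ENNReal.ofReal_le_ofReal h1).trans_eq ?_
    rw [ENNReal.ofReal_mul hC₁, ofReal_integral_norm_eq_lintegral_enorm hG]
  have htri : ‖u x - ballAvg D u p₀ ρ₀‖ₑ ≤
      ENNReal.ofReal |M R - ballAvg D u p₀ ρ₀| + ENNReal.ofReal |M R - u x| := by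
    rw [← ENNReal.ofReal_add (abs_nonneg _) (abs_nonneg _), ← ofReal_norm,
      Real.norm_eq_abs, abs_sub_comm (M R) (u x), add_comm]
    exact ENNReal.ofReal_le_ofReal (abs_sub_le _ _ _)
  refine htri.trans ((add_le_add hC₁'' hfin).trans ?_)
  rw [mul_add, ENNReal.ofReal_add hC₁ hC₂0]
  gcongr
  · exact le_self_add
  · exact le_add_self

/-! ### Potential estimates in `L²` -/

theorem eLpNorm_two_sq {α E : Type*} [MeasurableSpace α] [NormedAddCommGroup E] (μ : Measure α)
    (f : α → E) : eLpNorm f 2 μ ^ 2 = ∫⁻ x, ‖f x‖ₑ ^ 2 ∂μ := by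
  have := eLpNorm_nnreal_pow_eq_lintegral (μ := μ) (f := f) (p := 2) two_ne_zero
  simp only [NNReal.coe_ofNat, ENNReal.coe_ofNat, ENNReal.rpow_two] at this
  exact this

/-- The Cauchy–Schwarz inequality with the weight `k`. -/
theorem sq_lintegral_mul_le {α : Type*} [MeasurableSpace α] (μ : Measure α) {k g : α → ℝ≥0∞}
    (hk : Measurable k) (hg : Measurable g) :
    (∫⁻ x, k x * g x ∂μ) ^ 2 ≤ (∫⁻ x, k x ∂μ) * ∫⁻ x, k x * g x ^ 2 ∂μ := by
  have h := ENNReal.lintegral_mul_le_Lp_mul_Lq μ (p := 2) (q := 2)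
    (Real.HolderConjugate.two_two) (f := fun x => k x ^ (1 / 2 : ℝ))
    (g := fun x => k x ^ (1 / 2 : ℝ) * g x) (hk.pow_const _).aemeasurable
    ((hk.pow_const _).mul hg).aemeasurable
  have e1 : ∀ x, (k x ^ (1 / 2 : ℝ)) * (k x ^ (1 / 2 : ℝ)) = k x := fun x => by
    rw [← ENNReal.rpow_add_of_nonneg _ _ (by norm_num) (by norm_num)]; norm_num
  have e2 : ∀ x, (k x ^ (1 / 2 : ℝ)) ^ (2 : ℝ) = k x := fun x => by
    rw [← ENNReal.rpow_mul]; norm_num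
  simp only [Pi.mul_apply, ← mul_assoc, e1, ENNReal.mul_rpow_of_nonneg _ _ zero_le_two, e2,
    ENNReal.rpow_two] at h
  calc (∫⁻ x, k x * g x ∂μ) ^ 2
      ≤ ((∫⁻ x, k x ∂μ) ^ (1 / 2 : ℝ) * (∫⁻ x, k x * g x ^ 2 ∂μ) ^ (1 / 2 : ℝ)) ^ 2 := by gcongr
    _ = _ := by
      rw [mul_pow, ← ENNReal.rpow_natCast, ← ENNReal.rpow_natCast, ← ENNReal.rpow_mul,
        ← ENNReal.rpow_mul]
      norm_num

/-- **Schur's test** for a symmetric kernel. -/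
theorem lintegral_sq_lintegral_le {α : Type*} [MeasurableSpace α] (μ : Measure α) [SFinite μ]
    {k : α → α → ℝ≥0∞} (hk : Measurable (Function.uncurry k)) (hsymm : ∀ x y, k x y = k y x)
    {g : α → ℝ≥0∞} (hg : Measurable g) {S : ℝ≥0∞} (hS : ∀ x, ∫⁻ z, k x z ∂μ ≤ S) :
    ∫⁻ x, (∫⁻ z, k x z * g z ∂μ) ^ 2 ∂μ ≤ S ^ 2 * ∫⁻ z, g z ^ 2 ∂μ := by
  have hkx : ∀ x, Measurable (k x) := fun x => hk.comp measurable_prodMk_left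
  calc ∫⁻ x, (∫⁻ z, k x z * g z ∂μ) ^ 2 ∂μ
      ≤ ∫⁻ x, S * ∫⁻ z, k x z * g z ^ 2 ∂μ ∂μ :=
        lintegral_mono fun x => (sq_lintegral_mul_le μ (hkx x) hg).trans
          (mul_le_mul_left (hS x) _)
    _ = S * ∫⁻ z, ∫⁻ x, k x z * g z ^ 2 ∂μ ∂μ := by
        have hm : Measurable (Function.uncurry fun x z => k x z * g z ^ 2) :=
          hk.mul ((hg.comp measurable_snd).pow_const 2)
        have hm' : Measurable fun x => ∫⁻ z, k x z * g z ^ 2 ∂μ := hm.lintegral_prod_right'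
        rw [lintegral_const_mul _ hm', lintegral_lintegral_swap hm.aemeasurable]
    _ ≤ S * ∫⁻ z, S * g z ^ 2 ∂μ := by
        gcongr with z
        have hkz : Measurable fun x => k x z := hk.comp measurable_prodMk_right
        rw [lintegral_mul_const _ hkz]
        gcongr
        simp_rw [hsymm _ z]
        exact hS z
    _ = _ := by rw [lintegral_const_mul _ (hg.pow_const 2)]; ring

/-- The kernel of the potential that dominates a weakly differentiable function; it is comparable
to `|x - z|^{1 - d}` near the diagonal. -/
def potentialKernel (R : ℝ) (x z : Space d) : ℝ≥0∞ :=
  1 + ∫⁻ t in Ioc 0 R, ENNReal.ofReal (t ^ d)⁻¹ * {w : Space d | dist w x ≤ 2 * t}.indicator (fun _ => 1) z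

theorem measurable_potentialKernel_aux : Measurable fun q : (Space d × Space d) × ℝ =>
    ENNReal.ofReal (q.2 ^ d)⁻¹ * {w : Space d | dist w q.1.1 ≤ 2 * q.2}.indicator (fun _ => 1) q.1.2 := by
  refine Measurable.mul (by fun_prop) ?_
  have : MeasurableSet {q : (Space d × Space d) × ℝ | dist q.1.2 q.1.1 ≤ 2 * q.2} :=
    (isClosed_le (by fun_prop) (by fun_prop)).measurableSet
  exact (measurable_const (a := (1 : ℝ≥0∞))).indicator this

theorem measurable_potentialKernel (R : ℝ) :
    Measurable (Function.uncurry (potentialKernel (d := d) R)) := by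
  have := measurable_potentialKernel_aux (d := d).lintegral_prod_right'
    (ν := volume.restrict (Ioc 0 R))
  exact (measurable_const (a := (1 : ℝ≥0∞))).add this

theorem potentialKernel_comm (R : ℝ) (x z : Space d) :
    potentialKernel R x z = potentialKernel R z x := by
  simp only [potentialKernel, indicator, mem_ofPred_eq, dist_comm x z]

/-- The potential of a function `g` on `A`, with the order of integration exchanged. -/
theorem lintegral_potentialKernel (R : ℝ) (x : Space d) {A : Set (Space d)}
    {g : Space d → ℝ≥0∞} (hg : Measurable g) :
    ∫⁻ z in A, potentialKernel R x z * g z =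
      (∫⁻ z in A, g z) + ∫⁻ t in Ioc 0 R, ENNReal.ofReal (t ^ d)⁻¹ *
        ∫⁻ z in A ∩ closedBall x (2 * t), g z := by
  simp only [potentialKernel, add_mul, one_mul]
  rw [lintegral_add_left hg]
  congr 1
  have hm : Measurable (Function.uncurry fun (z : Space d) (t : ℝ) =>
      ENNReal.ofReal (t ^ d)⁻¹ * {w : Space d | dist w x ≤ 2 * t}.indicator (fun _ => 1) z) :=
    measurable_potentialKernel_aux.comp
      (f := fun q : Space d × ℝ => ((x, q.1), q.2)) (by fun_prop)
  have e1 : ∀ z, (∫⁻ t in Ioc 0 R, ENNReal.ofReal (t ^ d)⁻¹ *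
      {w : Space d | dist w x ≤ 2 * t}.indicator (fun _ => 1) z) * g z =
      ∫⁻ t in Ioc 0 R, ENNReal.ofReal (t ^ d)⁻¹ *
        {w : Space d | dist w x ≤ 2 * t}.indicator (fun _ => 1) z * g z := fun z =>
    (lintegral_mul_const _ (hm.comp measurable_prodMk_left)).symm
  simp_rw [e1]
  have hm2 : Measurable (Function.uncurry fun (z : Space d) (t : ℝ) =>
      ENNReal.ofReal (t ^ d)⁻¹ * {w : Space d | dist w x ≤ 2 * t}.indicator (fun _ => 1) z * g z) :=
    hm.mul (hg.comp measurable_fst)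
  rw [lintegral_lintegral_swap hm2.aemeasurable]
  refine lintegral_congr fun t => ?_
  simp_rw [mul_assoc]
  rw [lintegral_const_mul' _ _ ENNReal.ofReal_ne_top]
  congr 1
  rw [inter_comm, ← Measure.restrict_restrict measurableSet_closedBall,
    ← lintegral_indicator measurableSet_closedBall]
  refine lintegral_congr fun z => ?_
  by_cases hz : dist z x ≤ 2 * t
  · rw [indicator_of_mem (show z ∈ {w : Space d | dist w x ≤ 2 * t} from hz),
      indicator_of_mem (mem_closedBall.2 hz), one_mul]
  · rw [indicator_of_notMem (show z ∉ {w : Space d | dist w x ≤ 2 * t} from hz),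
      indicator_of_notMem (mt mem_closedBall.1 hz), zero_mul]

/-- The kernel has small mass on small sets: its mass on `A` is at most a constant times
`|A|^{3/10}`. The exponent leaves room on both sides: it has to be less than `1/d` for the mass to
be finite, and more than `1/4` for the iteration over level sets to converge. -/
theorem exists_lintegral_potentialKernel_le (hd : d = 2 ∨ d = 3) (R : ℝ) {D : Set (Space d)}
    (hD : volume D ≠ ⊤) :
    ∃ C : ℝ≥0∞, C ≠ ⊤ ∧ ∀ A ⊆ D, ∀ x : Space d,
      ∫⁻ z in A, potentialKernel R x z ≤ C * volume A ^ (3 / 10 : ℝ) := by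
  have hdR : (3 / 10 : ℝ) * d < 1 := by rcases hd with h | h <;> rw [h] <;> norm_num
  set V : ℝ≥0∞ := volume (ball (0 : Space d) 1) with hV
  have hVtop : V ≠ ⊤ := measure_ball_lt_top.ne
  set J : ℝ≥0∞ := ∫⁻ t in Ioc 0 R, ENNReal.ofReal (t ^ (-(3 / 10 * d) : ℝ)) with hJ
  have hJtop : J ≠ ⊤ := by
    have h1 : IntegrableOn (fun t : ℝ => t ^ (-(3 / 10 * d) : ℝ)) (Ioc 0 R) :=
      (intervalIntegral.intervalIntegrable_rpow' (a := 0) (b := R) (by linarith)).1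
    have h2 := h1.2
    refine ne_of_lt (lt_of_le_of_lt (lintegral_mono fun t => ?_) h2)
    exact Real.ofReal_le_enorm _
  set B : ℝ≥0∞ := (ENNReal.ofReal (2 ^ d) * V) ^ (7 / 10 : ℝ) with hB
  have hBtop : B ≠ ⊤ :=
    ENNReal.rpow_ne_top_of_nonneg (by norm_num) (ENNReal.mul_ne_top ENNReal.ofReal_ne_top hVtop)
  refine ⟨volume D ^ (7 / 10 : ℝ) + J * B, ENNReal.add_ne_top.2
    ⟨ENNReal.rpow_ne_top_of_nonneg (by norm_num) hD, ENNReal.mul_ne_top hJtop hBtop⟩, ?_⟩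
  intro A hA x
  -- in `|A ∩ B| = |A ∩ B|^{7/10} |A ∩ B|^{3/10}` the first factor is bounded by the volume of the
  -- ball `B`, the second one by `|A|^{3/10}`
  have hsplit : ∀ v : ℝ≥0∞, v = v ^ (7 / 10 : ℝ) * v ^ (3 / 10 : ℝ) := fun v => by
    rw [← ENNReal.rpow_add_of_nonneg _ _ (by norm_num) (by norm_num)]; norm_num
  have e := lintegral_potentialKernel R x (A := A) (g := fun _ => 1) measurable_const
  simp only [mul_one, lintegral_one, Measure.restrict_apply_univ] at e
  rw [e, add_mul]
  refine add_le_add ?_ ?_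
  · conv_lhs => rw [hsplit (volume A)]
    gcongr
  · have hpt : ∀ t ∈ Ioc 0 R, ENNReal.ofReal (t ^ d)⁻¹ * volume (A ∩ closedBall x (2 * t)) ≤
        ENNReal.ofReal (t ^ (-(3 / 10 * d) : ℝ)) * (B * volume A ^ (3 / 10 : ℝ)) := by
      intro t ht
      have ht0 : 0 < t := ht.1
      have h1 : volume (A ∩ closedBall x (2 * t)) ≤ ENNReal.ofReal (t ^ d) *
          (ENNReal.ofReal (2 ^ d) * V) := by
        refine (measure_mono inter_subset_right).trans_eq ?_
        rw [Measure.addHaar_closedBall _ _ (by positivity), finrank_euclideanSpace_fin, mul_pow,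
          mul_comm (2 ^ d : ℝ), ENNReal.ofReal_mul (by positivity), mul_assoc]
      calc ENNReal.ofReal (t ^ d)⁻¹ * volume (A ∩ closedBall x (2 * t))
          ≤ ENNReal.ofReal (t ^ d)⁻¹ * ((ENNReal.ofReal (t ^ d) * (ENNReal.ofReal (2 ^ d) * V)) ^
              (7 / 10 : ℝ) * volume A ^ (3 / 10 : ℝ)) := by
            rw [hsplit (volume (A ∩ closedBall x (2 * t)))]
            gcongr
            exact inter_subset_left
        _ = (ENNReal.ofReal (t ^ d)⁻¹ * ENNReal.ofReal (t ^ d) ^ (7 / 10 : ℝ)) *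
              (B * volume A ^ (3 / 10 : ℝ)) := by
            rw [ENNReal.mul_rpow_of_nonneg _ _ (by norm_num)]; ring
        _ = _ := by
            congr 1
            rw [ENNReal.ofReal_rpow_of_pos (by positivity), ← ENNReal.ofReal_mul (by positivity)]
            congr 1
            rw [← Real.rpow_natCast, ← Real.rpow_neg ht0.le, ← Real.rpow_mul ht0.le,
              ← Real.rpow_add ht0]
            congr 1; ring
    refine (setLIntegral_mono' measurableSet_Ioc hpt).trans_eq ?_
    rw [lintegral_mul_const _ (by fun_prop), mul_assoc]

/-- An `L²` estimate for the deviation from a constant, on sets off which the gradient vanishes. The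
constant `c` depends on the function only, not on the set `A`. -/
theorem ConeCondition.exists_eLpNorm_sub_const_le (hd : d = 2 ∨ d = 3) {D : Set (Space d)}
    (hD : IsOpen D) (hconn : IsConnected D) (hbd : Bornology.IsBounded D) (hcone : ConeCondition D) :
    ∃ C : ℝ≥0∞, C ≠ ⊤ ∧ ∀ (u : Space d → ℝ) (G : Space d → Space d),
      IntegrableOn u D → IntegrableOn G D → IsWeakGrad D u G → ∃ c : ℝ,
        ∀ A ⊆ D, MeasurableSet A → (∀ᵐ x ∂(volume.restrict D), x ∉ A → G x = 0) →
          eLpNorm (fun x => u x - c) 2 (volume.restrict A) ≤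
            C * volume A ^ (3 / 10 : ℝ) * eLpNorm G 2 (volume.restrict D) := by
  obtain ⟨R, C₁, hR, hC₁, hpt⟩ := hcone.exists_pointwise_le hD hconn hbd
  obtain ⟨C₂, hC₂, hmass⟩ := exists_lintegral_potentialKernel_le hd R hbd.measure_lt_top.ne
  refine ⟨ENNReal.ofReal C₁ * C₂, ENNReal.mul_ne_top ENNReal.ofReal_ne_top hC₂,
    fun u G hu hG h => ?_⟩
  obtain ⟨c, hc⟩ := hpt u G hu hG h
  refine ⟨c, fun A hA hAm hGA => ?_⟩
  obtain ⟨g, hgm, hg⟩ : AEMeasurable (fun x => ‖G x‖ₑ) (volume.restrict D) :=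
    hG.aestronglyMeasurable.enorm
  have hz : ∀ᵐ x ∂(volume.restrict D), ‖G x‖ₑ = A.indicator g x := by
    filter_upwards [hGA, hg] with x h1 h2
    by_cases hx : x ∈ A
    · rw [indicator_of_mem hx, h2]
    · rw [indicator_of_notMem hx, h1 hx, enorm_zero]
  have hcx : ∀ᵐ x ∂(volume.restrict A), ‖u x - c‖ₑ ≤
      ENNReal.ofReal C₁ * ∫⁻ z in A, potentialKernel R x z * g z := by
    filter_upwards [ae_restrict_of_ae_restrict_of_subset hA hc] with x hx
    refine hx.trans_eq ?_
    rw [lintegral_potentialKernel R x hgm]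
    have e1 : ∀ E : Set (Space d), MeasurableSet E →
        ∫⁻ z in D ∩ E, ‖G z‖ₑ = ∫⁻ z in A ∩ E, g z := fun E hE => by
      have hz' := ae_restrict_of_ae_restrict_of_subset (inter_subset_left (s := D) (t := E)) hz
      rw [lintegral_congr_ae hz', lintegral_indicator hAm, Measure.restrict_restrict hAm,
        ← inter_assoc, inter_eq_left.2 hA]
    congr 2
    · have := e1 univ MeasurableSet.univ
      simpa using this
    · exact lintegral_congr fun t => by rw [e1 _ measurableSet_closedBall]
  have hsq : eLpNorm (fun x => u x - c) 2 (volume.restrict A) ^ 2 ≤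
      (ENNReal.ofReal C₁ * C₂ * volume A ^ (3 / 10 : ℝ) * eLpNorm G 2 (volume.restrict D)) ^ 2 := by
    rw [eLpNorm_two_sq]
    calc ∫⁻ x in A, ‖u x - c‖ₑ ^ 2
        ≤ ∫⁻ x in A, (ENNReal.ofReal C₁) ^ 2 * (∫⁻ z in A, potentialKernel R x z * g z) ^ 2 := by
          refine lintegral_mono_ae ?_
          filter_upwards [hcx] with x hx
          rw [← mul_pow]
          gcongr
      _ ≤ (ENNReal.ofReal C₁) ^ 2 * ((C₂ * volume A ^ (3 / 10 : ℝ)) ^ 2 * ∫⁻ z in A, g z ^ 2) := by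
          rw [lintegral_const_mul' _ _ (ENNReal.pow_ne_top ENNReal.ofReal_ne_top)]
          gcongr
          exact lintegral_sq_lintegral_le _ (measurable_potentialKernel R)
            (potentialKernel_comm R) hgm (hmass A hA)
      _ ≤ _ := by
          have e2 : ∫⁻ z in A, g z ^ 2 ≤ eLpNorm G 2 (volume.restrict D) ^ 2 := by
            rw [eLpNorm_two_sq]
            refine (lintegral_mono_set hA).trans_eq (lintegral_congr_ae ?_)
            filter_upwards [hg] with x hx
            rw [← hx]
          rw [mul_pow, mul_pow, mul_pow, mul_pow, mul_assoc, mul_assoc, mul_assoc]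
          gcongr
  exact (ENNReal.pow_le_pow_left_iff two_ne_zero).1 hsq

/-! ### Faber–Krahn and Poincaré inequalities -/

/-- A Faber–Krahn type inequality: functions that live on a small set have a small `L²` norm in
comparison with their `H¹` norm. -/
theorem ConeCondition.exists_eLpNorm_le_of_vanish (hd : d = 2 ∨ d = 3) {D : Set (Space d)}
    (hD : IsOpen D) (hconn : IsConnected D) (hbd : Bornology.IsBounded D) (hcone : ConeCondition D) :
    ∃ C : ℝ≥0∞, C ≠ ⊤ ∧ ∀ (u : Space d → ℝ) (G : Space d → Space d),
      MemLp u 2 (volume.restrict D) → MemLp G 2 (volume.restrict D) → IsWeakGrad D u G →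
        ∀ A ⊆ D, MeasurableSet A → (∀ᵐ x ∂(volume.restrict D), x ∉ A → u x = 0) →
          (∀ᵐ x ∂(volume.restrict D), x ∉ A → G x = 0) →
          eLpNorm u 2 (volume.restrict D) ≤ C * volume A ^ (3 / 10 : ℝ) *
            (eLpNorm u 2 (volume.restrict D) + eLpNorm G 2 (volume.restrict D)) := by
  obtain ⟨C, hC, hmain⟩ := hcone.exists_eLpNorm_sub_const_le hd hD hconn hbd
  have hDtop : volume D ≠ ⊤ := hbd.measure_lt_top.ne
  have hD0 : volume D ≠ 0 := (hD.measure_pos _ hconn.nonempty).ne'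
  have : IsFiniteMeasure (volume.restrict D) := ⟨by simpa using hDtop.lt_top⟩
  refine ⟨C + volume D ^ (-(3 / 10) : ℝ) * (1 + C * volume D ^ (3 / 10 : ℝ)), ?_, ?_⟩
  · refine ENNReal.add_ne_top.2 ⟨hC, ENNReal.mul_ne_top ?_ (ENNReal.add_ne_top.2
      ⟨ENNReal.one_ne_top, ENNReal.mul_ne_top hC ?_⟩)⟩
    · exact ENNReal.rpow_ne_top_of_ne_zero hD0 hDtop
    · exact ENNReal.rpow_ne_top_of_ne_zero hD0 hDtop
  intro u G hu hG h A hA hAm huA hGA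
  obtain ⟨c, hc⟩ := hmain u G (hu.integrable one_le_two) (hG.integrable one_le_two) h
  set U := eLpNorm u 2 (volume.restrict D) with hU
  set N := eLpNorm G 2 (volume.restrict D) with hN
  have hcA := hc A hA hAm hGA
  have hcD := hc D le_rfl hD.measurableSet (by
    filter_upwards [ae_restrict_mem hD.measurableSet] with x hx h using absurd hx h)
  have eA : U = eLpNorm u 2 (volume.restrict A) := by
    have : u =ᵐ[volume.restrict D] A.indicator u := by
      filter_upwards [huA] with x hx
      by_cases hxA : x ∈ A
      · rw [indicator_of_mem hxA]
      · rw [indicator_of_notMem hxA, hx hxA]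
    rw [hU, eLpNorm_congr_ae this, eLpNorm_indicator_eq_eLpNorm_restrict hAm,
      Measure.restrict_restrict hAm, inter_eq_left.2 hA]
  have econst : ∀ E : Set (Space d), eLpNorm (fun _ => c) 2 (volume.restrict E) =
      ‖c‖ₑ * volume E ^ (1 / 2 : ℝ) := fun E => by
    rw [eLpNorm_const' _ two_ne_zero (by norm_num)]
    simp
  have hmeas : ∀ E ⊆ D, AEStronglyMeasurable u (volume.restrict E) := fun E hE =>
    hu.aestronglyMeasurable.mono_measure (Measure.restrict_mono hE le_rfl)
  -- the constant `c` is eliminated by using the estimate twice: on `A` it bounds the function by its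
  -- gradient and by `c`, and on `D` it bounds `c` by the norms of the function and of its gradient
  have h1 : U ≤ C * volume A ^ (3 / 10 : ℝ) * N + ‖c‖ₑ * volume A ^ (1 / 2 : ℝ) := by
    rw [eA, ← econst A]
    have := eLpNorm_add_le (p := 2) (((hmeas A hA).sub aestronglyMeasurable_const) :
      AEStronglyMeasurable (fun x => u x - c) (volume.restrict A))
      (aestronglyMeasurable_const (b := c)) one_le_two
    rw [sub_add_cancel] at this
    exact this.trans (by gcongr; exact hcA)
  have h2 : ‖c‖ₑ * volume D ^ (1 / 2 : ℝ) ≤ U + C * volume D ^ (3 / 10 : ℝ) * N := by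
    rw [← econst D]
    have := eLpNorm_sub_le (p := 2) (hmeas D le_rfl) (((hmeas D le_rfl).sub
      aestronglyMeasurable_const) : AEStronglyMeasurable (fun x => u x - c) (volume.restrict D))
      one_le_two
    rw [sub_sub_cancel] at this
    exact this.trans (by gcongr; exact hcD)
  have h3 : volume A ^ (1 / 2 : ℝ) ≤
      volume D ^ (1 / 2 : ℝ) * volume D ^ (-(3 / 10) : ℝ) * volume A ^ (3 / 10 : ℝ) := by
    have e1 : volume A ^ (1 / 2 : ℝ) = volume A ^ (1 / 5 : ℝ) * volume A ^ (3 / 10 : ℝ) := by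
      rw [← ENNReal.rpow_add_of_nonneg _ _ (by norm_num) (by norm_num)]; norm_num
    have e2 : volume D ^ (1 / 2 : ℝ) * volume D ^ (-(3 / 10) : ℝ) = volume D ^ (1 / 5 : ℝ) := by
      rw [← ENNReal.rpow_add _ _ hD0 hDtop]; norm_num
    rw [e1, e2]
    gcongr
  calc U ≤ C * volume A ^ (3 / 10 : ℝ) * N + ‖c‖ₑ * volume A ^ (1 / 2 : ℝ) := h1
    _ ≤ C * volume A ^ (3 / 10 : ℝ) * N + ‖c‖ₑ * (volume D ^ (1 / 2 : ℝ) *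
          volume D ^ (-(3 / 10) : ℝ) * volume A ^ (3 / 10 : ℝ)) := by gcongr
    _ = C * volume A ^ (3 / 10 : ℝ) * N + (‖c‖ₑ * volume D ^ (1 / 2 : ℝ)) *
          (volume D ^ (-(3 / 10) : ℝ) * volume A ^ (3 / 10 : ℝ)) := by ring
    _ ≤ C * volume A ^ (3 / 10 : ℝ) * N + (U + C * volume D ^ (3 / 10 : ℝ) * N) *
          (volume D ^ (-(3 / 10) : ℝ) * volume A ^ (3 / 10 : ℝ)) := by gcongr
    _ ≤ C * volume A ^ (3 / 10 : ℝ) * (U + N) +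
          ((U + N) + C * volume D ^ (3 / 10 : ℝ) * (U + N)) *
          (volume D ^ (-(3 / 10) : ℝ) * volume A ^ (3 / 10 : ℝ)) := by
        gcongr
        · exact le_add_self
        · exact le_self_add
        · exact le_add_self
    _ = _ := by ring

/-- A Poincaré inequality, with some constant in place of the mean value. -/
theorem ConeCondition.exists_poincare (hd : d = 2 ∨ d = 3) {D : Set (Space d)}
    (hD : IsOpen D) (hconn : IsConnected D) (hbd : Bornology.IsBounded D) (hcone : ConeCondition D) :
    ∃ C : ℝ≥0∞, C ≠ ⊤ ∧ ∀ (u : Space d → ℝ) (G : Space d → Space d),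
      MemLp u 2 (volume.restrict D) → MemLp G 2 (volume.restrict D) → IsWeakGrad D u G →
        ∃ c : ℝ, eLpNorm (fun x => u x - c) 2 (volume.restrict D) ≤
          C * eLpNorm G 2 (volume.restrict D) := by
  obtain ⟨C, hC, hmain⟩ := hcone.exists_eLpNorm_sub_const_le hd hD hconn hbd
  have hDtop : volume D ≠ ⊤ := hbd.measure_lt_top.ne
  have : IsFiniteMeasure (volume.restrict D) := ⟨by simpa using hDtop.lt_top⟩
  refine ⟨C * volume D ^ (3 / 10 : ℝ),
    ENNReal.mul_ne_top hC (ENNReal.rpow_ne_top_of_nonneg (by norm_num) hDtop),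
    fun u G hu hG h => ?_⟩
  obtain ⟨c, hc⟩ := hmain u G (hu.integrable one_le_two) (hG.integrable one_le_two) h
  refine ⟨c, hc D le_rfl hD.measurableSet ?_⟩
  filter_upwards [ae_restrict_mem hD.measurableSet] with x hx h using absurd hx h

/-! ### Mollification and the chain rule for weak gradients -/

/-- The bump functions behind the mollifiers. The ratio of the outer to the inner radius is bounded,
which makes mollifications converge almost everywhere. -/
def mollBump (d n : ℕ) : ContDiffBump (0 : Space d) :=
  ⟨1 / (2 * (n + 1)), 1 / (n + 1), by positivity, by
    rw [one_div_lt_one_div (by positivity) (by positivity)]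
    have : (0 : ℝ) ≤ n := n.cast_nonneg
    linarith⟩

/-- The standard mollifier of radius `1 / (n + 1)`. -/
def moll (n : ℕ) : Space d → ℝ := (mollBump d n).normed volume

/-- Mollification: the convolution with `moll n`. -/
def mollify (n : ℕ) (f : Space d → ℝ) : Space d → ℝ :=
  convolution (moll n) f (ContinuousLinearMap.lsmul ℝ ℝ) volume

theorem moll_contDiff (n : ℕ) : ContDiff ℝ ∞ (moll (d := d) n) := ContDiffBump.contDiff_normed _

theorem moll_hasCompactSupport (n : ℕ) : HasCompactSupport (moll (d := d) n) :=
  ContDiffBump.hasCompactSupport_normed _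

theorem moll_integrable (n : ℕ) : Integrable (moll (d := d) n) :=
  (moll_contDiff n).continuous.integrable_of_hasCompactSupport (moll_hasCompactSupport n)

theorem moll_tsupport (n : ℕ) : tsupport (moll (d := d) n) = closedBall 0 (1 / (n + 1)) :=
  ContDiffBump.tsupport_normed_eq _

theorem mollify_contDiff (n : ℕ) {f : Space d → ℝ} (hf : Integrable f) :
    ContDiff ℝ ∞ (mollify n f) :=
  (moll_hasCompactSupport n).contDiff_convolution_left _ (moll_contDiff n) hf.locallyIntegrable

theorem mollify_integrable (n : ℕ) {f : Space d → ℝ} (hf : Integrable f) :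
    Integrable (mollify n f) := (moll_integrable n).integrable_convolution _ hf

theorem mollify_sub_integrable (n : ℕ) {f : Space d → ℝ} (hf : Integrable f) :
    Integrable fun x => mollify n f x - f x := (mollify_integrable n hf).sub hf

theorem integral_mollify (n : ℕ) {f : Space d → ℝ} (hf : Integrable f) :
    ∫ x, mollify n f x = ∫ x, f x := by
  unfold mollify
  rw [integral_convolution _ (moll_integrable n) hf, moll, ContDiffBump.integral_normed]
  simp

theorem ae_tendsto_mollify {f : Space d → ℝ} (hf : Integrable f) :
    ∀ᵐ x, Tendsto (fun n => mollify n f x) atTop (𝓝 (f x)) := by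
  refine ContDiffBump.ae_convolution_tendsto_right_of_locallyIntegrable (K := 2) ?_ ?_
    hf.locallyIntegrable
  · exact tendsto_one_div_add_atTop_nhds_zero_nat
  · refine Eventually.of_forall fun n => ?_
    change (1 : ℝ) / (n + 1) ≤ 2 * (1 / (2 * (n + 1)))
    have : (0 : ℝ) < n + 1 := by positivity
    exact le_of_eq (by field_simp)

theorem mollify_sub (n : ℕ) {f g : Space d → ℝ} (hf : Integrable f) (hg : Integrable g) :
    mollify n (f - g) = mollify n f - mollify n g := by
  have hex : ∀ h : Space d → ℝ, Integrable h →
      ConvolutionExists (moll n) h (ContinuousLinearMap.lsmul ℝ ℝ) volume := fun h hh =>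
    (moll_hasCompactSupport n).convolutionExists_left _ (moll_contDiff n).continuous
      hh.locallyIntegrable
  have h1 := (hex _ (hf.sub hg)).distrib_add (hex g hg)
  rw [sub_add_cancel] at h1
  unfold mollify
  rw [h1, add_sub_cancel_right]

/-- Mollifications of a nonnegative function converge in `L¹`, by Scheffé's argument: they converge
almost everywhere and the integrals agree. -/
theorem tendsto_integral_mollify_sub_of_nonneg {f : Space d → ℝ} (hf : Integrable f)
    (h0 : 0 ≤ f) : Tendsto (fun n => ∫ x, |mollify n f x - f x|) atTop (𝓝 0) := by
  have hm0 : ∀ n x, 0 ≤ mollify n f x := fun n x =>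
    integral_nonneg fun t => mul_nonneg (ContDiffBump.nonneg_normed _ _) (h0 _)
  have hpos : ∀ n, Integrable fun x => max (f x - mollify n f x) 0 := fun n =>
    (hf.sub (mollify_integrable n hf)).pos_part
  have e : ∀ n, ∫ x, |mollify n f x - f x| = 2 * ∫ x, max (f x - mollify n f x) 0 := fun n => by
    have h1 : ∀ x, |mollify n f x - f x| =
        (mollify n f x - f x) + 2 * max (f x - mollify n f x) 0 := fun x => by
      rcases le_total (mollify n f x) (f x) with h | h
      · rw [abs_of_nonpos (by linarith), max_eq_left (by linarith)]; ring
      · rw [abs_of_nonneg (by linarith), max_eq_right (by linarith)]; ring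
    simp_rw [h1]
    rw [integral_add (mollify_sub_integrable n hf) ((hpos n).const_mul 2),
      integral_sub (mollify_integrable n hf) hf, integral_mollify n hf, sub_self, zero_add,
      integral_const_mul]
  simp_rw [e]
  have hlim : Tendsto (fun n => ∫ x, max (f x - mollify n f x) 0) atTop
      (𝓝 (∫ _ : Space d, (0 : ℝ))) := by
    refine tendsto_integral_of_dominated_convergence f (fun n => (hpos n).aestronglyMeasurable) hf
      (fun n => Eventually.of_forall fun x => ?_) ?_
    · rw [Real.norm_of_nonneg (le_max_right _ _)]
      exact max_le (by linarith [hm0 n x]) (h0 x)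
    · filter_upwards [ae_tendsto_mollify hf] with x hx
      have := (hx.const_sub (f x)).max (tendsto_const_nhds (x := (0 : ℝ)))
      simpa using this
  simpa using hlim.const_mul 2

theorem tendsto_integral_mollify_sub {f : Space d → ℝ} (hf : Integrable f) :
    Tendsto (fun n => ∫ x, |mollify n f x - f x|) atTop (𝓝 0) := by
  set p : Space d → ℝ := fun x => max (f x) 0 with hp
  set q : Space d → ℝ := fun x => max (-f x) 0 with hq
  have hpi : Integrable p := hf.pos_part
  have hqi : Integrable q := hf.neg.pos_part
  have hfpq : f = p - q := by
    ext x
    simp only [hp, hq, Pi.sub_apply]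
    rcases le_total (f x) 0 with h | h
    · rw [max_eq_right h, max_eq_left (by linarith)]; ring
    · rw [max_eq_left h, max_eq_right (by linarith)]; ring
  have h1 := (tendsto_integral_mollify_sub_of_nonneg hpi fun x => le_max_right _ _).add
    (tendsto_integral_mollify_sub_of_nonneg hqi fun x => le_max_right _ _)
  rw [add_zero] at h1
  refine squeeze_zero (fun n => integral_nonneg fun x => abs_nonneg _) (fun n => ?_) h1
  have ip := (mollify_sub_integrable n hpi).abs
  have iq := (mollify_sub_integrable n hqi).abs
  rw [← integral_add ip iq]
  refine integral_mono ((mollify_integrable n hf).sub hf).abs (ip.add iq) fun x => ?_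
  have e1 : mollify n f x = mollify n p x - mollify n q x := by
    rw [hfpq, mollify_sub n hpi hqi]; rfl
  have e2 : f x = p x - q x := congrFun hfpq x
  simp only [e1, e2]
  calc |mollify n p x - mollify n q x - (p x - q x)|
      = |(mollify n p x - p x) - (mollify n q x - q x)| := by congr 1; ring
    _ ≤ _ := abs_sub _ _

/-- If a product with bounded factors involves an `L¹` convergent sequence, integrals converge. -/
theorem tendsto_integral_mul_of_tendsto_L1 {f : Space d → ℝ} (hf : Integrable f)
    {w : ℕ → Space d → ℝ} {B : ℝ} (hw : ∀ n, AEStronglyMeasurable (w n)) (hB : ∀ n x, |w n x| ≤ B)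
    {v : Space d → ℝ} (hlim : ∀ᵐ x, Tendsto (fun n => w n x) atTop (𝓝 (v x))) :
    Tendsto (fun n => ∫ x, mollify n f x * w n x) atTop (𝓝 (∫ x, f x * v x)) := by
  have i1 : ∀ n, Integrable fun x => f x * w n x := fun n =>
    hf.mul_bdd (c := B) (hw n) (Eventually.of_forall (hB n))
  have i2 : ∀ n, Integrable fun x => (mollify n f x - f x) * w n x := fun n =>
    ((mollify_integrable n hf).sub hf).mul_bdd (c := B) (hw n) (Eventually.of_forall (hB n))
  have h1 : Tendsto (fun n => ∫ x, f x * w n x) atTop (𝓝 (∫ x, f x * v x)) := by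
    refine tendsto_integral_of_dominated_convergence (fun x => |f x| * B)
      (fun n => (i1 n).aestronglyMeasurable) (hf.abs.mul_const B) (fun n => ?_) ?_
    · refine Eventually.of_forall fun x => ?_
      rw [norm_mul]
      exact mul_le_mul_of_nonneg_left (hB n x) (abs_nonneg _)
    · filter_upwards [hlim] with x hx using hx.const_mul _
  have h2 : Tendsto (fun n => ∫ x, (mollify n f x - f x) * w n x) atTop (𝓝 0) := by
    have h3 := (tendsto_integral_mollify_sub hf).mul_const B
    rw [zero_mul] at h3
    refine squeeze_zero_norm (fun n => ?_) h3
    rw [← integral_mul_const]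
    refine norm_integral_le_of_norm_le (((mollify_integrable n hf).sub hf).abs.mul_const B)
      (Eventually.of_forall fun x => ?_)
    rw [norm_mul]
    exact mul_le_mul_of_nonneg_left (hB n x) (abs_nonneg _)
  have h4 := h1.add h2
  rw [add_zero] at h4
  refine h4.congr fun n => ?_
  rw [← integral_add (i1 n) (i2 n)]
  exact integral_congr_ae (Eventually.of_forall fun x => by ring)

/-- Away from the boundary, the gradient of the mollification is the mollified weak gradient. -/
theorem fderiv_mollify {D : Set (Space d)} (hD : MeasurableSet D) {u : Space d → ℝ}
    {G : Space d → Space d} (hu : IntegrableOn u D) (h : IsWeakGrad D u G) {n : ℕ} {x : Space d}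
    (hx : closedBall x (1 / (n + 1)) ⊆ D) (i : Fin d) :
    fderiv ℝ (mollify n (D.indicator u)) x (EuclideanSpace.single i 1) =
      mollify n (D.indicator fun y => G y i) x := by
  have hf : Integrable (D.indicator u) := hu.integrable_indicator hD
  have h1 := ((moll_hasCompactSupport (d := d) n).hasFDerivAt_convolution_left
    (ContinuousLinearMap.lsmul ℝ ℝ) ((moll_contDiff n).of_le (by simp)) hf.locallyIntegrable x).fderiv
  change fderiv ℝ (mollify n (D.indicator u)) x = _ at h1
  rw [h1]
  set ψ : Space d → ℝ := fun z => moll n (x - z) with hψ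
  have hψd : ContDiff ℝ ∞ ψ := (moll_contDiff n).comp (contDiff_const.sub contDiff_id)
  have hψ0 : ∀ z, z ∉ closedBall x (1 / (n + 1)) → ψ z = 0 := fun z hz => by
    refine image_eq_zero_of_notMem_tsupport (f := moll n) fun hh => hz ?_
    rw [moll_tsupport, mem_closedBall_zero_iff] at hh
    rwa [mem_closedBall, dist_comm, dist_eq_norm]
  have hψc : HasCompactSupport ψ := HasCompactSupport.intro (isCompact_closedBall _ _) hψ0
  have hψs : tsupport ψ ⊆ closedBall x (1 / (n + 1)) :=
    closure_minimal (fun z hz => by by_contra hh; exact hz (hψ0 z hh)) isClosed_closedBall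
  have hfd : ∀ z, fderiv ℝ ψ z = -fderiv ℝ (moll n) (x - z) := fun z => by
    have e1 : HasFDerivAt (fun z : Space d => x - z) (-ContinuousLinearMap.id ℝ (Space d)) z :=
      (hasFDerivAt_id z).const_sub x
    have e2 := (((moll_contDiff n).differentiable (by simp) (x - z)).hasFDerivAt.comp z e1).fderiv
    change fderiv ℝ ψ z = _ at e2
    rw [e2]; ext; simp
  have hcont : Continuous (fderiv ℝ (moll (d := d) n)) :=
    (moll_contDiff n).continuous_fderiv (by simp)
  have hconv : ConvolutionExistsAt (fderiv ℝ (moll n)) (D.indicator u) x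
      (ContinuousLinearMap.precompL (Space d) (ContinuousLinearMap.lsmul ℝ ℝ)) volume :=
    ((moll_hasCompactSupport n).fderiv (𝕜 := ℝ)).convolutionExists_left _ hcont
      hf.locallyIntegrable x
  rw [convolution_def, ContinuousLinearMap.integral_apply hconv]
  have e3 := h ψ hψd hψc (hψs.trans hx) i
  simp only [hfd] at e3
  rw [← integral_sub_left_eq_self _ volume x]
  have e4 : ∀ t : Space d, ((ContinuousLinearMap.precompL (Space d)
      (ContinuousLinearMap.lsmul ℝ ℝ : ℝ →L[ℝ] ℝ →L[ℝ] ℝ)) (fderiv ℝ (moll n) (x - t)))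
      (D.indicator u (x - (x - t))) (EuclideanSpace.single i 1) =
      D.indicator (fun t => u t * fderiv ℝ (moll n) (x - t) (EuclideanSpace.single i 1)) t := by
    intro t
    rw [sub_sub_cancel, ContinuousLinearMap.precompL_apply]
    by_cases ht : t ∈ D
    · simp [ht, mul_comm]
    · simp [ht]
  simp_rw [e4]
  rw [integral_indicator hD, mollify, convolution_def, ← integral_sub_left_eq_self _ volume x]
  have e5 : ∀ t : Space d, (ContinuousLinearMap.lsmul ℝ ℝ : ℝ →L[ℝ] ℝ →L[ℝ] ℝ) (moll n (x - t))
      (D.indicator (fun y => G y i) (x - (x - t))) = D.indicator (fun y => G y i * ψ y) t := by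
    intro t
    rw [sub_sub_cancel]
    by_cases ht : t ∈ D
    · simp [ht, hψ, mul_comm]
    · simp [ht]
  simp_rw [e5]
  rw [integral_indicator hD]
  simp only [neg_apply, mul_neg, integral_neg] at e3
  linarith

theorem setIntegral_eq_of_support {D D' : Set (Space d)} (hDD : D' ⊆ D) {F : Space d → ℝ}
    (hF : ∀ x, x ∉ D' → F x = 0) : ∫ x in D, F x = ∫ x in D', F x := by
  rw [setIntegral_eq_integral_of_forall_compl_eq_zero hF,
    setIntegral_eq_integral_of_forall_compl_eq_zero fun x hx => hF x fun h => hx (hDD h)]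

theorem fderiv_apply_eq_zero {ψ : Space d → ℝ} {x : Space d} (hx : x ∉ tsupport ψ) (v : Space d) :
    fderiv ℝ ψ x v = 0 := by
  rw [image_eq_zero_of_notMem_tsupport fun h => hx (tsupport_fderiv_subset ℝ h)]
  rfl

theorem IsWeakGrad.mono {D D' : Set (Space d)} (hDD : D' ⊆ D) {u : Space d → ℝ}
    {G : Space d → Space d} (h : IsWeakGrad D u G) : IsWeakGrad D' u G := by
  intro ψ hψ hc hs i
  have h1 := h ψ hψ hc (hs.trans hDD) i
  rwa [setIntegral_eq_of_support hDD fun x hx => by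
      rw [fderiv_apply_eq_zero fun h => hx (hs h), mul_zero],
    setIntegral_eq_of_support hDD fun x hx => by
      rw [image_eq_zero_of_notMem_tsupport fun h => hx (hs h), mul_zero]] at h1

/-- The **chain rule** for weak gradients. It is proved by mollification on a neighbourhood of the
support of the test function, so that local integrability suffices. -/
theorem IsWeakGrad.comp {D : Set (Space d)} (hD : IsOpen D) {u : Space d → ℝ}
    {G : Space d → Space d} (hu : LocallyIntegrableOn u D) (hG : LocallyIntegrableOn G D)
    (h : IsWeakGrad D u G) {φ φ' : ℝ → ℝ} (hφ : ∀ t, HasDerivAt φ (φ' t) t)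
    (hφc : Continuous φ') (hφ1 : ∀ t, |φ' t| ≤ 1) (hφ0 : φ 0 = 0) :
    IsWeakGrad D (fun x => φ (u x)) (fun x => φ' (u x) • G x) := by
  intro ψ hψ hc hs i
  have hT : IsCompact (tsupport ψ) := hc
  obtain ⟨δ, hδ, hsub⟩ := hT.exists_cthickening_subset_open hD hs
  set D' := thickening δ (tsupport ψ) with hD'
  have hD'o : IsOpen D' := isOpen_thickening
  have hD'c : D' ⊆ cthickening δ (tsupport ψ) := thickening_subset_cthickening _ _
  have hTD' : tsupport ψ ⊆ D' := self_subset_thickening hδ _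
  have hcomp : IsCompact (cthickening δ (tsupport ψ)) := hT.cthickening
  have hu' : IntegrableOn u D' := (hu.integrableOn_compact_subset hsub hcomp).mono_set hD'c
  have hG' : IntegrableOn G D' := (hG.integrableOn_compact_subset hsub hcomp).mono_set hD'c
  have h' : IsWeakGrad D' u G := h.mono (hD'c.trans hsub)
  have hGi : IntegrableOn (fun x => G x i) D' :=
    (EuclideanSpace.proj i : Space d →L[ℝ] ℝ).integrable_comp hG'
  set f := D'.indicator u with hf
  set g := D'.indicator fun x => G x i with hg
  have hfi : Integrable f := hu'.integrable_indicator hD'o.measurableSet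
  have hgi : Integrable g := hGi.integrable_indicator hD'o.measurableSet
  set w : Space d → ℝ := fun x => fderiv ℝ ψ x (EuclideanSpace.single i 1) with hw
  have hwc : Continuous w := (hψ.continuous_fderiv (by simp)).clm_apply continuous_const
  have hws : HasCompactSupport w := hc.fderiv_apply (𝕜 := ℝ) _
  obtain ⟨B, hB⟩ := hwc.bounded_above_of_compact_support hws
  obtain ⟨B', hB'⟩ := hψ.continuous.bounded_above_of_compact_support hc
  have hφd : Differentiable ℝ φ := fun t => (hφ t).differentiableAt
  have hlip : ∀ s t, |φ s - φ t| ≤ |s - t| := fun s t => by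
    have := Convex.norm_image_sub_le_of_norm_hasDerivWithin_le (s := univ) (C := 1)
      (fun t _ => (hφ t).hasDerivWithinAt) (fun t _ => hφ1 t) convex_univ (mem_univ t) (mem_univ s)
    simpa using this
  have hφm : Measurable φ := hφd.continuous.measurable
  -- the two sides for the mollified functions
  have hstep : ∀ᶠ n : ℕ in atTop, ∫ x, φ (mollify n f x) * w x =
      -∫ x, mollify n g x * (φ' (mollify n f x) * ψ x) := by
    have hev : ∀ᶠ n : ℕ in atTop, (1 : ℝ) / (n + 1) < δ :=
      (tendsto_order.1 tendsto_one_div_add_atTop_nhds_zero_nat).2 δ hδ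
    filter_upwards [hev] with n hn
    have hm := mollify_contDiff n hfi
    have hF : ∀ x, HasFDerivAt (fun x => φ (mollify n f x))
        (φ' (mollify n f x) • fderiv ℝ (mollify n f) x) x := fun x =>
      (hφ _).comp_hasFDerivAt x (hm.differentiable (by simp) x).hasFDerivAt
    have hfd : ∀ x, fderiv ℝ (fun x => φ (mollify n f x)) x (EuclideanSpace.single i 1) =
        φ' (mollify n f x) * fderiv ℝ (mollify n f) x (EuclideanSpace.single i 1) := fun x => by
      rw [(hF x).fderiv]; rfl
    have hcφ : Continuous fun x => φ (mollify n f x) := hφd.continuous.comp hm.continuous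
    have hcd : Continuous fun x =>
        fderiv ℝ (fun x => φ (mollify n f x)) x (EuclideanSpace.single i 1) := by
      simp_rw [hfd]
      exact (hφc.comp hm.continuous).mul
        ((hm.continuous_fderiv (by simp)).clm_apply continuous_const)
    rw [hw, integral_mul_fderiv_eq_neg_fderiv_mul_of_integrable]
    · congr 1
      refine integral_congr_ae (Eventually.of_forall fun x => ?_)
      simp only
      by_cases hx : x ∈ tsupport ψ
      · rw [hfd, fderiv_mollify hD'o.measurableSet hu' h' ?_ i]
        · ring
        · intro y hy
          exact mem_thickening_iff.2 ⟨x, hx, (mem_closedBall.1 hy).trans_lt hn⟩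
      · rw [image_eq_zero_of_notMem_tsupport hx]; ring
    · exact (hcd.mul hψ.continuous).integrable_of_hasCompactSupport hc.mul_left
    · exact (hcφ.mul hwc).integrable_of_hasCompactSupport hws.mul_left
    · exact (hcφ.mul hψ.continuous).integrable_of_hasCompactSupport hc.mul_left
    · exact fun x _ => (hF x).differentiableAt
    · exact fun x _ => hψ.differentiable (by simp) x
  -- passage to the limit
  have hae := ae_tendsto_mollify hfi
  have hlim2 : Tendsto (fun n => ∫ x, mollify n g x * (φ' (mollify n f x) * ψ x)) atTop
      (𝓝 (∫ x, g x * (φ' (f x) * ψ x))) := by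
    refine tendsto_integral_mul_of_tendsto_L1 hgi (B := B') (fun n => ?_) (fun n x => ?_) ?_
    · exact ((hφc.comp (mollify_contDiff n hfi).continuous).mul hψ.continuous).aestronglyMeasurable
    · rw [abs_mul]
      calc |φ' (mollify n f x)| * |ψ x| ≤ 1 * B' :=
            mul_le_mul (hφ1 _) (hB' x) (abs_nonneg _) zero_le_one
        _ = B' := one_mul _
    · filter_upwards [hae] with x hx
      exact ((hφc.tendsto _).comp hx).mul_const _
  have hφi : ∀ k : Space d → ℝ, Integrable k → Integrable fun x => φ (k x) * w x := fun k hk => by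
    refine Integrable.mul_bdd (c := B) ?_ hwc.aestronglyMeasurable (Eventually.of_forall hB)
    refine hk.mono (hφm.comp_aemeasurable hk.aestronglyMeasurable.aemeasurable).aestronglyMeasurable
      (Eventually.of_forall fun x => ?_)
    have := hlip (k x) 0
    rwa [hφ0, sub_zero, sub_zero] at this
  have hlim1 : Tendsto (fun n => ∫ x, φ (mollify n f x) * w x) atTop
      (𝓝 (∫ x, φ (f x) * w x)) := by
    rw [tendsto_iff_norm_sub_tendsto_zero]
    have h3 := (tendsto_integral_mollify_sub hfi).mul_const B
    rw [zero_mul] at h3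
    refine squeeze_zero (fun n => norm_nonneg _) (fun n => ?_) h3
    rw [← integral_sub (hφi _ (mollify_integrable n hfi)) (hφi _ hfi), ← integral_mul_const]
    refine norm_integral_le_of_norm_le ((mollify_sub_integrable n hfi).abs.mul_const B)
      (Eventually.of_forall fun x => ?_)
    rw [← sub_mul, norm_mul]
    exact mul_le_mul (hlip _ _) (hB x) (norm_nonneg _) (abs_nonneg _)
  have hlim := tendsto_nhds_unique (hlim1.congr' hstep) hlim2.neg
  -- back to integrals over the domain
  have e1 : ∫ x in D, φ (u x) * w x = ∫ x, φ (f x) * w x := by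
    rw [← setIntegral_eq_integral_of_forall_compl_eq_zero (s := D)
      (f := fun x => φ (f x) * w x)]
    · refine setIntegral_congr_fun hD.measurableSet fun x _ => ?_
      by_cases hx : x ∈ D'
      · simp [hf, hx]
      · have : w x = 0 := fderiv_apply_eq_zero (fun hh => hx (hTD' hh)) _
        simp [this]
    · intro x hx
      have : w x = 0 := fderiv_apply_eq_zero (fun hh => hx (hs hh)) _
      rw [this, mul_zero]
  have e2 : ∫ x in D, (φ' (u x) • G x) i * ψ x = ∫ x, g x * (φ' (f x) * ψ x) := by
    rw [← setIntegral_eq_integral_of_forall_compl_eq_zero (s := D)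
      (f := fun x => g x * (φ' (f x) * ψ x))]
    · refine setIntegral_congr_fun hD.measurableSet fun x _ => ?_
      by_cases hx : x ∈ D'
      · simp only [hf, hg, hx, indicator_of_mem, PiLp.smul_apply, smul_eq_mul]; ring
      · have : ψ x = 0 := image_eq_zero_of_notMem_tsupport fun hh => hx (hTD' hh)
        simp [this]
    · intro x hx
      have : ψ x = 0 := image_eq_zero_of_notMem_tsupport fun hh => hx (hs hh)
      rw [this, mul_zero, mul_zero]
  change ∫ x in D, φ (u x) * w x = _
  rw [e1, e2, hlim]

/-! ### Periodization -/

/-- The lattice spanned by a basis. -/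
abbrev lattice (b : Module.Basis (Fin d) ℝ (Space d)) : Submodule ℤ (Space d) :=
  Submodule.span ℤ (range b)

/-- The periodization of a function with compact support. -/
def perSum (b : Module.Basis (Fin d) ℝ (Space d)) (η : Space d → ℝ) (x : Space d) : ℝ :=
  ∑' g : lattice b, η (g + x)

/-- The periodic extension of a function given on the fundamental domain. -/
def perExt (b : Module.Basis (Fin d) ℝ (Space d)) {E : Type*} (w : Space d → E) (x : Space d) : E :=
  w (ZSpan.fract b x)

/-- Only finitely many translates of a function with compact support meet a given ball. -/
theorem exists_finset_notMem_tsupport (b : Module.Basis (Fin d) ℝ (Space d)) {η : Space d → ℝ}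
    (hη : HasCompactSupport η) (R : ℝ) :
    ∃ t : Finset (lattice b), ∀ x ∈ ball (0 : Space d) R, ∀ g ∉ t, (g : Space d) + x ∉ tsupport η := by
  obtain ⟨M, hM⟩ := (isBounded_iff_subset_closedBall (0 : Space d)).1
    (IsCompact.isBounded (s := tsupport η) hη)
  have hfin := ZSpan.setFinite_inter b (isBounded_closedBall (x := (0 : Space d)) (r := M + R))
  have hfin2 : {g : lattice b | (g : Space d) ∈ closedBall (0 : Space d) (M + R)}.Finite := by
    refine Set.Finite.of_finite_image (f := ((↑) : lattice b → Space d)) (hfin.subset ?_)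
      Subtype.val_injective.injOn
    rintro _ ⟨g, hg, rfl⟩
    exact ⟨hg, g.2⟩
  refine ⟨hfin2.toFinset, fun x hx g hg hgx => hg ?_⟩
  rw [Set.Finite.mem_toFinset]
  have h1 := mem_closedBall_zero_iff.1 (hM hgx)
  have h2 := mem_ball_zero_iff.1 hx
  change (g : Space d) ∈ closedBall (0 : Space d) (M + R)
  rw [mem_closedBall_zero_iff]
  calc ‖(g : Space d)‖ = ‖((g : Space d) + x) - x‖ := by rw [add_sub_cancel_right]
    _ ≤ ‖(g : Space d) + x‖ + ‖x‖ := norm_sub_le _ _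
    _ ≤ M + R := by linarith

theorem perSum_eq_sum (b : Module.Basis (Fin d) ℝ (Space d)) {η : Space d → ℝ} {x : Space d}
    {t : Finset (lattice b)} (ht : ∀ g ∉ t, (g : Space d) + x ∉ tsupport η) :
    perSum b η x = ∑ g ∈ t, η (g + x) :=
  tsum_eq_sum fun g hg => image_eq_zero_of_notMem_tsupport (ht g hg)

theorem perSum_contDiff (b : Module.Basis (Fin d) ℝ (Space d)) {η : Space d → ℝ}
    (hη : ContDiff ℝ ∞ η) (hc : HasCompactSupport η) : ContDiff ℝ ∞ (perSum b η) := by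
  rw [contDiff_iff_contDiffAt]
  intro x
  obtain ⟨t, ht⟩ := exists_finset_notMem_tsupport b hc (‖x‖ + 1)
  have hx : ball (0 : Space d) (‖x‖ + 1) ∈ 𝓝 x :=
    isOpen_ball.mem_nhds (by simp)
  have hs : ContDiff ℝ ∞ fun x => ∑ g ∈ t, η (g + x) :=
    ContDiff.sum fun g _ => hη.comp (contDiff_const.add contDiff_id)
  refine hs.contDiffAt.congr_of_eventuallyEq ?_
  filter_upwards [hx] with y hy using perSum_eq_sum b (ht y hy)

theorem fderiv_perSum (b : Module.Basis (Fin d) ℝ (Space d)) {η : Space d → ℝ}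
    (hη : ContDiff ℝ ∞ η) (hc : HasCompactSupport η) (x v : Space d) :
    fderiv ℝ (perSum b η) x v = perSum b (fun y => fderiv ℝ η y v) x := by
  obtain ⟨t, ht⟩ := exists_finset_notMem_tsupport b hc (‖x‖ + 1)
  have hx : x ∈ ball (0 : Space d) (‖x‖ + 1) := by simp
  have heq : perSum b η =ᶠ[𝓝 x] fun x => ∑ g ∈ t, η (g + x) := by
    filter_upwards [isOpen_ball.mem_nhds hx] with y hy using perSum_eq_sum b (ht y hy)
  have hd : HasFDerivAt (fun x => ∑ g ∈ t, η (g + x)) (∑ g ∈ t, fderiv ℝ η (g + x)) x := by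
    refine HasFDerivAt.fun_sum fun g _ => ?_
    have h1 := (hη.differentiable (by simp) ((g : Space d) + x)).hasFDerivAt
    have h2 := h1.comp x ((hasFDerivAt_id x).const_add (g : Space d))
    simpa [Function.comp_def] using h2
  rw [heq.fderiv_eq, hd.fderiv, perSum_eq_sum b (t := t), sum_apply]
  intro g hg hh
  refine ht x hx g hg (closure_minimal ?_ (isClosed_tsupport η) hh)
  intro y hy
  by_contra h0
  exact hy (fderiv_apply_eq_zero h0 v)

theorem perSum_add (b : Module.Basis (Fin d) ℝ (Space d)) (η : Space d → ℝ) (g : lattice b)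
    (x : Space d) : perSum b η (g + x) = perSum b η x := by
  unfold perSum
  rw [← (Equiv.addRight g).tsum_eq fun h : lattice b => η (h + x)]
  exact tsum_congr fun h => by simp [add_assoc]

theorem perExt_vadd (b : Module.Basis (Fin d) ℝ (Space d)) {E : Type*} (w : Space d → E)
    (g : lattice b) (x : Space d) : perExt b w (g + x) = perExt b w x := by
  rw [perExt, ZSpan.fract_zSpan_add b x g.2, perExt]

theorem perExt_eq (b : Module.Basis (Fin d) ℝ (Space d)) {E : Type*} (w : Space d → E)
    {x : Space d} (hx : x ∈ ZSpan.fundamentalDomain b) : perExt b w x = w x := by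
  rw [perExt, ZSpan.fract_eq_self.2 hx]

open scoped Pointwise in
theorem perExt_locallyIntegrable (b : Module.Basis (Fin d) ℝ (Space d)) {E : Type*}
    [NormedAddCommGroup E] {w : Space d → E} (hw : IntegrableOn w (ZSpan.fundamentalDomain b)) :
    LocallyIntegrable (perExt b w) := by
  rw [locallyIntegrable_iff]
  intro K hK
  set F := ZSpan.fundamentalDomain b
  have hbd : Bornology.IsBounded (K - F) := hK.isBounded.sub (ZSpan.fundamentalDomain_isBounded b)
  have hfin := ZSpan.setFinite_inter b hbd
  have hsub : K ⊆ ⋃ g ∈ (K - F) ∩ (lattice b : Set (Space d)), (fun x => g + x) '' F := by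
    intro x hx
    refine mem_iUnion₂.2 ⟨(ZSpan.floor b x : Space d), ⟨⟨x, hx, ZSpan.fract b x,
      ZSpan.fract_mem_fundamentalDomain b x, ?_⟩, (ZSpan.floor b x).2⟩, ZSpan.fract b x,
      ZSpan.fract_mem_fundamentalDomain b x, ?_⟩
    · rw [ZSpan.fract_apply]; exact sub_sub_cancel _ _
    · rw [ZSpan.fract_apply]; exact add_sub_cancel _ _
  refine IntegrableOn.mono_set ?_ hsub
  rw [integrableOn_finite_biUnion hfin]
  intro g hg
  have hmp : MeasurePreserving (fun x : Space d => g + x) volume volume :=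
    measurePreserving_add_left volume g
  rw [hmp.integrableOn_image (measurableEmbedding_addLeft g)]
  refine hw.congr_fun (fun x hx => ?_) (ZSpan.fundamentalDomain_measurableSet b)
  simp only [Function.comp_apply]
  rw [perExt_vadd b w ⟨g, hg.2⟩ x, perExt_eq b w hx]

/-- Unfolding: the integral of a periodic function against a function with compact support. -/
theorem integral_perExt_mul (b : Module.Basis (Fin d) ℝ (Space d)) {w : Space d → ℝ}
    (hw : IntegrableOn w (ZSpan.fundamentalDomain b)) {η : Space d → ℝ} (hη : Continuous η)
    (hc : HasCompactSupport η) :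
    ∫ x, perExt b w x * η x = ∫ x in ZSpan.fundamentalDomain b, w x * perSum b η x := by
  set F := ZSpan.fundamentalDomain b with hF
  have hFm : MeasurableSet F := ZSpan.fundamentalDomain_measurableSet b
  obtain ⟨R, hR⟩ := (isBounded_iff_subset_ball (0 : Space d)).1 (ZSpan.fundamentalDomain_isBounded b)
  obtain ⟨t, ht⟩ := exists_finset_notMem_tsupport b hc R
  obtain ⟨B, hB⟩ := hη.bounded_above_of_compact_support hc
  have hint : Integrable fun x => perExt b w x * η x := by
    have h1 := (perExt_locallyIntegrable b hw).integrable_smul_right_of_hasCompactSupport hη hc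
    simpa [mul_comm] using h1
  have hinv : VAddInvariantMeasure (lattice b) (Space d) volume :=
    ⟨fun c s _ => measure_preimage_add volume (c : Space d) s⟩
  rw [(ZSpan.isAddFundamentalDomain b volume).integral_eq_tsum'' _ hint]
  have e1 : ∀ g : lattice b, ∫ x in F, perExt b w (g +ᵥ x) * η (g +ᵥ x) =
      ∫ x in F, w x * η (g + x) := fun g =>
    setIntegral_congr_fun hFm fun x hx => by
      simp only [Submodule.vadd_def, vadd_eq_add]
      rw [perExt_vadd, perExt_eq b w hx]
  rw [tsum_congr e1, tsum_eq_sum (s := t), ← integral_finsetSum]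
  · refine setIntegral_congr_fun hFm fun x hx => ?_
    rw [perSum_eq_sum b (ht x (hR hx)), Finset.mul_sum]
  · intro g _
    exact hw.mul_bdd (c := B) (hη.comp (by fun_prop)).aestronglyMeasurable
      (Eventually.of_forall fun x => hB _)
  · intro g hg
    rw [setIntegral_congr_fun hFm (g := fun _ => (0 : ℝ)) fun x hx => ?_]
    · simp
    · simp only
      rw [image_eq_zero_of_notMem_tsupport (ht x (hR hx) g hg), mul_zero]

/-- Every smooth periodic function is the periodization of a test function. -/
theorem exists_perSum_eq (b : Module.Basis (Fin d) ℝ (Space d)) {ψ : Space d → ℝ}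
    (hψ : ContDiff ℝ ∞ ψ) (hper : ∀ (g : lattice b) (x : Space d), ψ (g + x) = ψ x) :
    ∃ η : Space d → ℝ, ContDiff ℝ ∞ η ∧ HasCompactSupport η ∧ perSum b η = ψ := by
  -- a cutoff that is `1` on the fundamental domain has a periodization without zeros, by which it
  -- can be normalized to a periodic partition of unity
  obtain ⟨R, hR⟩ := (isBounded_iff_subset_closedBall (0 : Space d)).1
    (ZSpan.fundamentalDomain_isBounded b)
  set ζ : ContDiffBump (0 : Space d) := ⟨max R 1, max R 1 + 1, by positivity, by linarith⟩ with hζ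
  have hζd : ContDiff ℝ ∞ ζ := ζ.contDiff
  have hζc : HasCompactSupport ζ := ζ.hasCompactSupport
  set P := perSum b ζ with hP
  have hPd : ContDiff ℝ ∞ P := perSum_contDiff b hζd hζc
  have hPpos : ∀ x, P x ≠ 0 := by
    intro x
    obtain ⟨t, ht⟩ := exists_finset_notMem_tsupport b hζc (‖x‖ + 1)
    have hsum : P x = ∑ g ∈ t, ζ (g + x) := perSum_eq_sum b (ht x (by simp))
    have hg : (((-ZSpan.floor b x : lattice b) : Space d) + x) ∈ closedBall (0 : Space d) ζ.rIn := by
      have h1 := hR (ZSpan.fract_mem_fundamentalDomain b x)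
      rw [ZSpan.fract_apply, sub_eq_neg_add] at h1
      refine closedBall_subset_closedBall (le_max_left R 1) ?_
      simpa using h1
    have h1 : ζ (((-ZSpan.floor b x : lattice b) : Space d) + x) = 1 := ζ.one_of_mem_closedBall hg
    have hmem : (-ZSpan.floor b x : lattice b) ∈ t := by
      by_contra hh
      have := image_eq_zero_of_notMem_tsupport (ht x (by simp) _ hh)
      rw [h1] at this
      exact one_ne_zero this
    have h2 := Finset.single_le_sum (f := fun g : lattice b => ζ ((g : Space d) + x))
      (fun g _ => ζ.nonneg) hmem
    rw [← hsum] at h2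
    simp only [h1] at h2
    linarith
  refine ⟨fun x => ζ x * (ψ x / P x), hζd.mul (hψ.div hPd hPpos), hζc.mul_right, ?_⟩
  ext x
  have e : ∀ g : lattice b, ζ ((g : Space d) + x) * (ψ (g + x) / P (g + x)) =
      ζ ((g : Space d) + x) * (ψ x / P x) := fun g => by
    rw [hper, hP, perSum_add]
  unfold perSum
  rw [tsum_congr e, tsum_mul_right]
  change P x * (ψ x / P x) = ψ x
  rw [mul_div_cancel₀ _ (hPpos x)]

/-! ### Boxes -/

theorem box_isOpen (l : Fin d → ℝ) (pos : ∀ i, 0 < l i) : IsOpen (box l) :=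
  Setting.isOpen_domain (Setting.periodic l pos)

theorem box_isBounded (l : Fin d → ℝ) : Bornology.IsBounded (box l) := by
  rw [isBounded_iff_forall_norm_le]
  refine ⟨√(∑ i, l i ^ 2), fun x hx => ?_⟩
  rw [EuclideanSpace.norm_eq]
  refine Real.sqrt_le_sqrt (Finset.sum_le_sum fun i _ => ?_)
  rw [Real.norm_eq_abs, sq_abs]
  exact pow_le_pow_left₀ (hx i).1.le (hx i).2.le 2

theorem box_isConnected (l : Fin d → ℝ) (pos : ∀ i, 0 < l i) : IsConnected (box l) := by
  refine ⟨⟨WithLp.toLp 2 fun i => l i / 2, fun i => ?_⟩, Convex.isPreconnected ?_⟩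
  · have := pos i
    constructor <;> simp <;> linarith
  · intro x hx y hy a b ha hb hab i
    have h1 := hx i
    have h2 := hy i
    simp only [PiLp.add_apply, PiLp.smul_apply, smul_eq_mul]
    rcases ha.eq_or_lt with h | h
    · obtain rfl : b = 1 := by linarith
      rw [← h]
      constructor <;> nlinarith
    · constructor
      · nlinarith [mul_pos h h1.1, mul_nonneg hb h2.1.le]
      · have e1 : a * x i < a * l i := mul_lt_mul_of_pos_left h1.2 h
        have e2 : b * y i ≤ b * l i := mul_le_mul_of_nonneg_left h2.2.le hb
        have e3 : a * l i + b * l i = l i := by rw [← add_mul, hab, one_mul]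
        linarith

/-- In a box the axes of the cones point along the diagonals, away from the nearest corner. -/
theorem box_coneCondition (hd : 0 < d) (l : Fin d → ℝ) (pos : ∀ i, 0 < l i) :
    ConeCondition (box l) := by
  have : Nonempty (Fin d) := ⟨⟨0, hd⟩⟩
  obtain ⟨i₀, hi₀⟩ := Finite.exists_min l
  have hd1 : (1 : ℝ) ≤ d := by exact_mod_cast hd
  have hdpos : (0 : ℝ) < d := by linarith
  -- the cone is so narrow that its elements have coordinates of the same signs as the axis
  refine ⟨l i₀ / 2, 1 - 1 / (2 * d), by have := pos i₀; positivity, ?_, ?_, fun x hx => ?_⟩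
  · have : 1 / (2 * (d : ℝ)) ≤ 1 / 2 := one_div_le_one_div_of_le (by norm_num) (by linarith)
    linarith
  · have : 0 < 1 / (2 * (d : ℝ)) := by positivity
    linarith
  let s : Fin d → ℝ := fun i => if x i ≤ l i / 2 then 1 else -1
  have hs : ∀ i, s i ^ 2 = 1 := fun i => by
    simp only [s]; split_ifs <;> norm_num
  set c : ℝ := (√d)⁻¹ with hc
  have hc0 : 0 < c := by positivity
  have hc2 : c ^ 2 = 1 / d := by rw [hc, inv_pow, Real.sq_sqrt hdpos.le, one_div]
  set e : Space d := WithLp.toLp 2 fun i => s i * c with he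
  have hen : ‖e‖ = 1 := by
    rw [EuclideanSpace.norm_eq]
    have : ∀ i, ‖e i‖ ^ 2 = 1 / d := fun i => by
      rw [Real.norm_eq_abs, sq_abs, he]
      simp only
      rw [mul_pow, hs, hc2, one_mul]
    simp_rw [this]
    simp [hdpos.ne']
  refine ⟨e, hen, fun y hy hcone i => ?_⟩
  have hyi : |y i| < l i / 2 := by
    have h1 : ‖y i‖ ≤ ‖y‖ := PiLp.norm_apply_le y i
    have h2 := hi₀ i
    rw [Real.norm_eq_abs] at h1
    linarith
  have hy0 : 0 < ‖y‖ := by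
    rcases (norm_nonneg y).eq_or_lt with h | h
    · rw [norm_eq_zero.1 h.symm] at hcone
      simp at hcone
    · exact h
  have hsy : 0 < s i * y i := by
    by_contra hneg
    push Not at hneg
    have h1 : ‖y - ‖y‖ • e‖ ^ 2 < ‖y‖ ^ 2 * c ^ 2 := by
      rw [norm_sub_sq_real, norm_smul, hen, norm_norm, inner_smul_right, real_inner_comm, hc2]
      have : ‖y‖ * ((1 - 1 / (2 * d)) * ‖y‖) < ‖y‖ * ⟪e, y⟫_ℝ :=
        mul_lt_mul_of_pos_left hcone hy0
      have e1 : ‖y‖ ^ 2 * (1 / (d : ℝ)) = 2 * (‖y‖ * (1 / (2 * d) * ‖y‖)) := by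
        field_simp
      nlinarith
    have h2 : |(y - ‖y‖ • e) i| ≤ ‖y - ‖y‖ • e‖ := PiLp.norm_apply_le (y - ‖y‖ • e) i
    have h3 : ((y - ‖y‖ • e) i) ^ 2 ≤ ‖y - ‖y‖ • e‖ ^ 2 := by
      rw [← sq_abs]; exact pow_le_pow_left₀ (abs_nonneg _) h2 2
    have h4 : (y - ‖y‖ • e) i = y i - ‖y‖ * (s i * c) := by simp [he]
    rw [h4] at h3
    have h5 : (y i - ‖y‖ * (s i * c)) ^ 2 =
        y i ^ 2 - 2 * (‖y‖ * c) * (s i * y i) + ‖y‖ ^ 2 * c ^ 2 * s i ^ 2 := by ring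
    rw [h5, hs] at h3
    nlinarith [mul_nonneg (mul_pos hy0 hc0).le (neg_nonneg.2 hneg), sq_nonneg (y i)]
  have hxi := hx i
  rw [abs_lt] at hyi
  simp only [PiLp.add_apply]
  simp only [s] at hsy
  split_ifs at hsy with h
  · constructor <;> linarith
  · constructor <;> linarith

/-- The basis of the period lattice of a box. -/
def boxBasis (l : Fin d → ℝ) (pos : ∀ i, 0 < l i) : Module.Basis (Fin d) ℝ (Space d) :=
  (EuclideanSpace.basisFun (Fin d) ℝ).toBasis.isUnitSMul (w := l)
    fun i => IsUnit.mk0 _ (pos i).ne'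

theorem boxBasis_apply (l : Fin d → ℝ) (pos : ∀ i, 0 < l i) (i : Fin d) :
    boxBasis l pos i = l i • EuclideanSpace.single i (1 : ℝ) := by
  simp [boxBasis, Module.Basis.isUnitSMul_apply]

theorem boxBasis_repr (l : Fin d → ℝ) (pos : ∀ i, 0 < l i) (x : Space d) (i : Fin d) :
    (boxBasis l pos).repr x i = (l i)⁻¹ * x i := by
  rw [boxBasis, Module.Basis.repr_isUnitSMul]
  simp [Units.smul_def]

theorem mem_fundamentalDomain_boxBasis (l : Fin d → ℝ) (pos : ∀ i, 0 < l i) (x : Space d) :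
    x ∈ ZSpan.fundamentalDomain (boxBasis l pos) ↔ ∀ i, 0 ≤ x i ∧ x i < l i := by
  rw [ZSpan.mem_fundamentalDomain]
  refine forall_congr' fun i => ?_
  rw [boxBasis_repr, mem_Ico, inv_mul_eq_div, div_lt_one (pos i)]
  refine and_congr_left fun _ => ⟨fun h => ?_, fun h => div_nonneg h (pos i).le⟩
  by_contra hh
  exact absurd h (not_le.2 (div_neg_of_neg_of_pos (not_le.1 hh) (pos i)))

theorem box_subset_fundamentalDomain (l : Fin d → ℝ) (pos : ∀ i, 0 < l i) :
    box l ⊆ ZSpan.fundamentalDomain (boxBasis l pos) := fun x hx =>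
  (mem_fundamentalDomain_boxBasis l pos x).2 fun i => ⟨(hx i).1.le, (hx i).2⟩

/-- The half-open fundamental domain differs from the open box by a null set. -/
theorem restrict_fundamentalDomain (l : Fin d → ℝ) (pos : ∀ i, 0 < l i) :
    (volume : Measure (Space d)).restrict (ZSpan.fundamentalDomain (boxBasis l pos)) =
      volume.restrict (box l) := by
  refine (Measure.restrict_congr_set ?_).symm
  refine (LE.le.eventuallyLE (box_subset_fundamentalDomain l pos)).antisymm ?_
  have hnull : ∀ i : Fin d, volume {x : Space d | x i = 0} = 0 := fun i => by
    have h1 := Measure.addHaar_submodule (volume : Measure (Space d))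
      (EuclideanSpace.proj i : Space d →L[ℝ] ℝ).ker (fun h => by
        have : EuclideanSpace.single i (1 : ℝ) ∈ (EuclideanSpace.proj i : Space d →L[ℝ] ℝ).ker := by
          rw [h]; trivial
        simp at this)
    exact h1
  have hall : ∀ᵐ x : Space d, ∀ i, x i ≠ 0 := ae_all_iff.2 fun i => by
    rw [ae_iff]
    simpa using hnull i
  filter_upwards [hall] with x hx hxF
  intro i
  have := (mem_fundamentalDomain_boxBasis l pos x).1 hxF i
  exact ⟨lt_of_le_of_ne this.1 (hx i).symm, this.2⟩

/-- Periodicity with respect to the edges of the box is invariance under the period lattice. -/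
theorem periodic_iff (l : Fin d → ℝ) (pos : ∀ i, 0 < l i) (ψ : Space d → ℝ) :
    (∀ (x : Space d) (i : Fin d), ψ (x + l i • EuclideanSpace.single i (1 : ℝ)) = ψ x) ↔
      ∀ (g : lattice (boxBasis l pos)) (x : Space d), ψ (g + x) = ψ x := by
  constructor
  · intro h g
    have hg : (g : Space d) ∈ AddSubgroup.closure (range (boxBasis l pos)) := by
      rw [← Submodule.span_int_eq_addSubgroupClosure]; exact g.2
    refine AddSubgroup.closure_induction (p := fun g _ => ∀ x, ψ (g + x) = ψ x) ?_ ?_ ?_ ?_ hg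
    · rintro _ ⟨i, rfl⟩ x
      rw [boxBasis_apply, add_comm, h]
    · intro x; rw [zero_add]
    · intro g g' _ _ h1 h2 x
      rw [add_assoc, h1, h2]
    · intro g _ h1 x
      rw [← h1 (-g + x), add_neg_cancel_left]
  · intro h x i
    rw [← boxBasis_apply l pos, add_comm]
    exact h ⟨boxBasis l pos i, Submodule.subset_span ⟨i, rfl⟩⟩ x

/-! ### Weak gradients for the two boundary conditions -/

namespace Setting

/-- `HasGrad` for functions instead of classes of functions. -/
def WeakGrad (S : Setting d) (u : Space d → ℝ) (G : Space d → Space d) : Prop :=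
  ∀ ψ ∈ S.tests, ∀ i : Fin d,
    ∫ x, u x * fderiv ℝ ψ x (EuclideanSpace.single i 1) ∂S.mu = -∫ x, (G x) i * ψ x ∂S.mu

/-- In the periodic case, weak differentiability means weak differentiability of the periodic
extension on the whole space. -/
theorem weakGrad_periodic_iff (l : Fin d → ℝ) (pos : ∀ i, 0 < l i) {u : Space d → ℝ}
    {G : Space d → Space d} (hu : IntegrableOn u (box l)) (hG : IntegrableOn G (box l)) :
    (periodic l pos).WeakGrad u G ↔
      IsWeakGrad univ (perExt (boxBasis l pos) u) (perExt (boxBasis l pos) G) := by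
  set b := boxBasis l pos with hb
  have hF := restrict_fundamentalDomain l pos
  have hu' : IntegrableOn u (ZSpan.fundamentalDomain b) := by
    rw [IntegrableOn, hF]; exact hu
  have hGi : ∀ i, IntegrableOn (fun x => G x i) (ZSpan.fundamentalDomain b) := fun i => by
    rw [IntegrableOn, hF]; exact (EuclideanSpace.proj i : Space d →L[ℝ] ℝ).integrable_comp hG
  have key : ∀ η : Space d → ℝ, ContDiff ℝ ∞ η → HasCompactSupport η → ∀ i : Fin d,
      (∫ x in univ, perExt b u x * fderiv ℝ η x (EuclideanSpace.single i 1) =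
        ∫ x in box l, u x * fderiv ℝ (perSum b η) x (EuclideanSpace.single i 1)) ∧
      (∫ x in univ, (perExt b G x) i * η x = ∫ x in box l, (G x) i * perSum b η x) := by
    intro η hη hc i
    have hc' : HasCompactSupport fun x => fderiv ℝ η x (EuclideanSpace.single i (1 : ℝ)) :=
      hc.fderiv_apply (𝕜 := ℝ) _
    have hcont : Continuous fun x => fderiv ℝ η x (EuclideanSpace.single i (1 : ℝ)) :=
      (hη.continuous_fderiv (by simp)).clm_apply continuous_const
    simp only [Measure.restrict_univ]
    constructor
    · rw [integral_perExt_mul b hu' hcont hc', hF]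
      simp_rw [fderiv_perSum b hη hc]
    · have := integral_perExt_mul b (hGi i) hη.continuous hc
      rw [hF] at this
      exact this
  constructor
  · intro h η hη hc _ i
    have hmem : perSum b η ∈ (periodic l pos).tests :=
      ⟨perSum_contDiff b hη hc, (periodic_iff l pos _).2 (perSum_add b η)⟩
    rw [(key η hη hc i).1, (key η hη hc i).2]
    exact h _ hmem i
  · rintro h ψ ⟨hψ, hper⟩ i
    obtain ⟨η, hη, hc, rfl⟩ := exists_perSum_eq b hψ ((periodic_iff l pos ψ).1 hper)
    have := h η hη hc (subset_univ _) i
    rwa [(key η hη hc i).1, (key η hη hc i).2] at this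

theorem isBounded_domain (S : Setting d) : Bornology.IsBounded S.domain := by
  cases S with
  | periodic l pos => exact box_isBounded l
  | neumann Ω _ _ h _ => exact h

theorem isConnected_domain (S : Setting d) : IsConnected S.domain := by
  cases S with
  | periodic l pos => exact box_isConnected l pos
  | neumann Ω _ h _ _ => exact h

theorem coneCondition_domain (hd : 0 < d) (S : Setting d) : ConeCondition S.domain := by
  cases S with
  | periodic l pos => exact box_coneCondition hd l pos
  | neumann Ω _ _ _ h => exact h

instance (S : Setting d) : IsFiniteMeasure S.mu :=
  ⟨by simpa using S.isBounded_domain.measure_lt_top⟩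

theorem vol_pos (S : Setting d) : 0 < S.vol :=
  ENNReal.toReal_pos (S.isOpen_domain.measure_pos _ S.isConnected_domain.nonempty).ne'
    S.isBounded_domain.measure_lt_top.ne

/-- With either boundary condition, weak gradients are distributional gradients in the interior. -/
theorem WeakGrad.isWeakGrad {S : Setting d} {u : Space d → ℝ} {G : Space d → Space d}
    (hu : Integrable u S.mu) (hG : Integrable G S.mu) (h : S.WeakGrad u G) :
    IsWeakGrad S.domain u G := by
  cases S with
  | periodic l pos =>
    have h1 := ((weakGrad_periodic_iff l pos hu hG).1 h).mono (subset_univ (box l))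
    intro ψ hψ hc hs i
    have h2 := h1 ψ hψ hc hs i
    have hm : MeasurableSet (box l) := (box_isOpen l pos).measurableSet
    have hsub := box_subset_fundamentalDomain l pos
    have e1 : ∫ x in box l, perExt (boxBasis l pos) u x * fderiv ℝ ψ x (EuclideanSpace.single i 1) =
        ∫ x in box l, u x * fderiv ℝ ψ x (EuclideanSpace.single i 1) :=
      setIntegral_congr_fun hm fun x hx => by simp only [perExt_eq _ u (hsub hx)]
    have e2 : ∫ x in box l, (perExt (boxBasis l pos) G x) i * ψ x =
        ∫ x in box l, (G x) i * ψ x :=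
      setIntegral_congr_fun hm fun x hx => by simp only [perExt_eq _ G (hsub hx)]
    rw [e1, e2] at h2
    exact h2
  | neumann Ω _ _ _ _ => exact fun ψ hψ hc hs i => h ψ ⟨hψ, hc, hs⟩ i

/-- The chain rule respects the boundary condition: in the periodic case it is applied to the periodic
extension. -/
theorem WeakGrad.comp {S : Setting d} {u : Space d → ℝ} {G : Space d → Space d}
    (hu : Integrable u S.mu) (hG : Integrable G S.mu) (h : S.WeakGrad u G) {φ φ' : ℝ → ℝ}
    (hφ : ∀ t, HasDerivAt φ (φ' t) t) (hφc : Continuous φ') (hφ1 : ∀ t, |φ' t| ≤ 1)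
    (hφ0 : φ 0 = 0) (hu' : Integrable (fun x => φ (u x)) S.mu)
    (hG' : Integrable (fun x => φ' (u x) • G x) S.mu) :
    S.WeakGrad (fun x => φ (u x)) (fun x => φ' (u x) • G x) := by
  cases S with
  | periodic l pos =>
    have hF := restrict_fundamentalDomain l pos
    rw [weakGrad_periodic_iff l pos hu' hG']
    have h1 : LocallyIntegrable (perExt (boxBasis l pos) u) :=
      perExt_locallyIntegrable _ (by rw [IntegrableOn, hF]; exact hu)
    have h2 : LocallyIntegrable (perExt (boxBasis l pos) G) :=
      perExt_locallyIntegrable _ (by rw [IntegrableOn, hF]; exact hG)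
    exact ((weakGrad_periodic_iff l pos hu hG).1 h).comp isOpen_univ (h1.locallyIntegrableOn _)
      (h2.locallyIntegrableOn _) hφ hφc hφ1 hφ0
  | neumann Ω hΩ _ _ _ =>
    have h1 : IsWeakGrad Ω u G := fun ψ hψ hc hs i => h ψ ⟨hψ, hc, hs⟩ i
    have h2 := h1.comp hΩ (IntegrableOn.locallyIntegrableOn hu)
      (IntegrableOn.locallyIntegrableOn hG) hφ hφc hφ1 hφ0
    exact fun ψ hψ i => h2 ψ hψ.1 hψ.2.1 hψ.2.2 i

/-- Constants have weak gradient zero. -/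
theorem weakGrad_const (S : Setting d) (c : ℝ) : S.WeakGrad (fun _ => c) (fun _ => 0) := by
  have hc0 : ∀ (η : Space d → ℝ), ContDiff ℝ ∞ η → HasCompactSupport η → ∀ v : Space d,
      ∫ x, c * fderiv ℝ η x v = 0 := by
    intro η hη hc v
    have hcont : Continuous fun x => fderiv ℝ η x v :=
      (hη.continuous_fderiv (by simp)).clm_apply continuous_const
    have := integral_mul_fderiv_eq_neg_fderiv_mul_of_integrable (μ := volume)
      (f := fun _ : Space d => c) (g := η) (v := v) (by simp)
      ((continuous_const.mul hcont).integrable_of_hasCompactSupport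
        (hc.fderiv_apply (𝕜 := ℝ) v).mul_left)
      ((continuous_const.mul hη.continuous).integrable_of_hasCompactSupport hc.mul_left)
      (fun x _ => differentiableAt_const c) (fun x _ => hη.differentiable (by simp) x)
    simpa using this
  cases S with
  | periodic l pos =>
    rw [weakGrad_periodic_iff l pos (integrableOn_const (box_isBounded l).measure_lt_top.ne)
      (integrableOn_const (box_isBounded l).measure_lt_top.ne)]
    intro η hη hc _ i
    simpa [perExt] using hc0 η hη hc (EuclideanSpace.single i 1)
  | neumann Ω _ _ _ _ =>
    rintro ψ ⟨hψ, hc, hs⟩ i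
    have h1 := hc0 ψ hψ hc (EuclideanSpace.single i 1)
    rw [← setIntegral_eq_integral_of_forall_compl_eq_zero (s := Ω) fun x hx => by
      rw [fderiv_apply_eq_zero fun hh => hx (hs hh), mul_zero]] at h1
    simp only [PiLp.zero_apply, zero_mul, integral_zero, neg_zero]
    exact h1

end Setting

/-! ### Boundedness by iteration over level sets -/

/-- De Giorgi's iteration: a quantity that decays along the levels faster than linearly vanishes
at a finite level. -/
theorem eq_zero_of_level_decay {a : ℝ → ℝ} (ha : Antitone a) (ha0 : ∀ k, 0 ≤ a k) {V B K : ℝ}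
    (hV : 0 < V) (hB : 0 ≤ B) (haV : a 0 ≤ V) (hK : 0 < K)
    (hdec : ∀ k h, 0 ≤ k → k < h → (h - k) ^ 2 * a h ≤ B * a k ^ (6 / 5 : ℝ))
    (hBK : B * V ^ (1 / 5 : ℝ) * 4 ^ 6 ≤ K ^ 2) : a K = 0 := by
  -- from one level to the next `a ^ (6 / 5)` gains the factor `4⁻⁶`, of which `4⁻¹` is spent on the
  -- square of the increment of the level
  have key : ∀ n : ℕ, a (K * (1 - (1 / 2) ^ n)) ≤ V * ((1 / 4) ^ 5) ^ n := by
    intro n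
    induction n with
    | zero => simpa using haV
    | succ n ih =>
      have hp : (0 : ℝ) < (1 / 2) ^ n := by positivity
      have hp1 : ((1 : ℝ) / 2) ^ n ≤ 1 := pow_le_one₀ (by norm_num) (by norm_num)
      have e1 : K * (1 - (1 / 2) ^ (n + 1)) - K * (1 - (1 / 2) ^ n) = K * (1 / 2) ^ (n + 1) := by
        rw [pow_succ]; ring
      have h1 := hdec (K * (1 - (1 / 2) ^ n)) (K * (1 - (1 / 2) ^ (n + 1)))
        (mul_nonneg hK.le (by linarith)) (by
          have : 0 < K * (1 / 2) ^ (n + 1) := by positivity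
          linarith)
      rw [e1] at h1
      have h2 : a (K * (1 - (1 / 2) ^ n)) ^ (6 / 5 : ℝ) ≤
          V * V ^ (1 / 5 : ℝ) * ((1 / 4) ^ 6) ^ n := by
        refine (Real.rpow_le_rpow (ha0 _) ih (by norm_num)).trans_eq ?_
        rw [Real.mul_rpow hV.le (by positivity)]
        have e2 : V ^ (6 / 5 : ℝ) = V * V ^ (1 / 5 : ℝ) := by
          conv_rhs => rw [← Real.rpow_one V, ← Real.rpow_mul hV.le]
          rw [← Real.rpow_add hV]; norm_num
        have e3 : (((1 / 4 : ℝ) ^ 5) ^ n) ^ (6 / 5 : ℝ) = ((1 / 4) ^ 6) ^ n := by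
          rw [← pow_mul, ← pow_mul, ← Real.rpow_natCast, ← Real.rpow_natCast,
            ← Real.rpow_mul (by norm_num)]
          congr 1; push_cast; ring
        rw [e2, e3]
      have h3 : (K * (1 / 2) ^ (n + 1)) ^ 2 * a (K * (1 - (1 / 2) ^ (n + 1))) ≤
          (K * (1 / 2) ^ (n + 1)) ^ 2 * (V * ((1 / 4) ^ 5) ^ (n + 1)) := by
        refine h1.trans ((mul_le_mul_of_nonneg_left h2 hB).trans ?_)
        have e4 : ((1 / 2 : ℝ) ^ (n + 1)) ^ 2 = (1 / 4) ^ (n + 1) := by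
          rw [← pow_mul, mul_comm, pow_mul]; norm_num
        have e5 : ((1 / 4 : ℝ) ^ 6) ^ n = 4 ^ 6 * ((1 / 4) ^ (n + 1) * ((1 / 4) ^ 5) ^ (n + 1)) := by
          rw [← mul_pow, ← pow_succ', pow_succ _ n]
          norm_num
          ring
        rw [mul_pow, e4, e5]
        have : 0 ≤ V * ((1 / 4 : ℝ) ^ (n + 1) * ((1 / 4) ^ 5) ^ (n + 1)) := by positivity
        calc _ = (B * V ^ (1 / 5 : ℝ) * 4 ^ 6) *
              (V * ((1 / 4 : ℝ) ^ (n + 1) * ((1 / 4) ^ 5) ^ (n + 1))) := by ring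
          _ ≤ K ^ 2 * (V * ((1 / 4 : ℝ) ^ (n + 1) * ((1 / 4) ^ 5) ^ (n + 1))) := by gcongr
          _ = _ := by ring
      exact le_of_mul_le_mul_left h3 (by positivity)
  have hlim : Tendsto (fun n : ℕ => V * ((1 / 4 : ℝ) ^ 5) ^ n) atTop (𝓝 (V * 0)) :=
    (tendsto_pow_atTop_nhds_zero_of_lt_one (by norm_num) (by norm_num)).const_mul V
  rw [mul_zero] at hlim
  refine le_antisymm (ge_of_tendsto' hlim fun n => (ha ?_).trans (key n)) (ha0 K)
  have : (0 : ℝ) < (1 / 2) ^ n := by positivity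
  nlinarith

/-- The derivative of the smooth truncation `smoothCut`. -/
def cutSlope (k h t : ℝ) : ℝ := max 0 (min 1 ((t - k) / (h - k)))

/-- A continuously differentiable substitute for `max (t - k) 0`: it vanishes for `t ≤ k`, and has
slope `1` for `t ≥ h`. -/
def smoothCut (k h t : ℝ) : ℝ := ∫ s in k..t, cutSlope k h s

theorem cutSlope_continuous (k h : ℝ) : Continuous (cutSlope k h) := by
  unfold cutSlope; fun_prop

theorem cutSlope_nonneg (k h t : ℝ) : 0 ≤ cutSlope k h t := le_max_left _ _

theorem cutSlope_le_one (k h t : ℝ) : cutSlope k h t ≤ 1 := max_le zero_le_one (min_le_left _ _)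

theorem cutSlope_eq_zero {k h t : ℝ} (hkh : k < h) (ht : t ≤ k) : cutSlope k h t = 0 :=
  max_eq_left ((min_le_right _ _).trans
    (div_nonpos_of_nonpos_of_nonneg (by linarith) (by linarith)))

theorem smoothCut_hasDerivAt (k h t : ℝ) : HasDerivAt (smoothCut k h) (cutSlope k h t) t :=
  intervalIntegral.integral_hasDerivAt_right ((cutSlope_continuous k h).intervalIntegrable _ _)
    ((cutSlope_continuous k h).stronglyMeasurableAtFilter _ _) (cutSlope_continuous k h).continuousAt

theorem smoothCut_eq_zero {k h t : ℝ} (hkh : k < h) (ht : t ≤ k) : smoothCut k h t = 0 := by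
  rw [smoothCut, intervalIntegral.integral_symm, intervalIntegral.integral_congr
    (g := fun _ => 0) fun s hs => ?_]
  · simp
  · rw [uIcc_of_le ht] at hs
    exact cutSlope_eq_zero hkh hs.2

theorem smoothCut_nonneg {k h : ℝ} (hkh : k < h) (t : ℝ) : 0 ≤ smoothCut k h t := by
  rcases le_total t k with ht | ht
  · rw [smoothCut_eq_zero hkh ht]
  · exact intervalIntegral.integral_nonneg ht fun s _ => cutSlope_nonneg k h s

theorem smoothCut_le {k h t : ℝ} (ht : k ≤ t) : smoothCut k h t ≤ t - k := by
  have : ∫ s in k..t, cutSlope k h s ≤ ∫ _ in k..t, (1 : ℝ) :=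
    intervalIntegral.integral_mono_on ht ((cutSlope_continuous k h).intervalIntegrable k t)
    (continuous_const.intervalIntegrable k t) fun s _ => cutSlope_le_one k h s
  simpa [smoothCut] using this

theorem le_smoothCut {k h t : ℝ} (hkh : k < h) (ht : h ≤ t) : (h - k) / 2 ≤ smoothCut k h t := by
  have e1 : smoothCut k h t = smoothCut k h h + ∫ s in h..t, cutSlope k h s :=
    (intervalIntegral.integral_add_adjacent_intervals
      ((cutSlope_continuous k h).intervalIntegrable _ _)
      ((cutSlope_continuous k h).intervalIntegrable _ _)).symm
  have e2 : 0 ≤ ∫ s in h..t, cutSlope k h s :=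
    intervalIntegral.integral_nonneg ht fun s _ => cutSlope_nonneg k h s
  have hd : 0 < h - k := by linarith
  have e3 : ∫ s in k..h, (s - k) / (h - k) = (h - k) / 2 := by
    rw [intervalIntegral.integral_div, intervalIntegral.integral_sub (f := fun s => s) (g := fun _ => k)
      (continuous_id.intervalIntegrable _ _) (continuous_const.intervalIntegrable _ _)]
    simp only [integral_id, intervalIntegral.integral_const, smul_eq_mul]
    field_simp; ring
  have e4 : ∫ s in k..h, (s - k) / (h - k) ≤ smoothCut k h h := by
    refine intervalIntegral.integral_mono_on hkh.le
      ((by fun_prop : Continuous fun s : ℝ => (s - k) / (h - k)).intervalIntegrable _ _)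
      ((cutSlope_continuous k h).intervalIntegrable _ _) fun s hs => ?_
    refine le_trans (le_of_eq (min_eq_right ?_).symm) (le_max_right _ _)
    rw [div_le_one hd]; linarith [hs.2]
  linarith

namespace Setting

variable {S : Setting d}

theorem WeakGrad.hasGrad {w : Space d → ℝ} {H : Space d → Space d} (hw : MemLp w 2 S.mu)
    (hH : MemLp H 2 S.mu) (h : S.WeakGrad w H) : S.HasGrad (hw.toLp w) (hH.toLp H) := by
  intro ψ hψ i
  have e1 : ∫ x, (hw.toLp w) x * fderiv ℝ ψ x (EuclideanSpace.single i 1) ∂S.mu =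
      ∫ x, w x * fderiv ℝ ψ x (EuclideanSpace.single i 1) ∂S.mu :=
    integral_congr_ae (by filter_upwards [hw.coeFn_toLp] with x hx; rw [hx])
  have e2 : ∫ x, (hH.toLp H x) i * ψ x ∂S.mu = ∫ x, (H x) i * ψ x ∂S.mu :=
    integral_congr_ae (by filter_upwards [hH.coeFn_toLp] with x hx; rw [hx])
  rw [e1, e2]
  exact h ψ hψ i

theorem hasGrad_isWeakGrad {u : S.L2} {G : S.L2Vec} (h : S.HasGrad u G) :
    IsWeakGrad S.domain u G :=
  WeakGrad.isWeakGrad ((Lp.memLp u).integrable one_le_two) ((Lp.memLp G).integrable one_le_two) h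

/-- The Faber–Krahn type inequality in terms of norms in `L²(Ω)`. -/
theorem exists_norm_le_of_vanish (hd : d = 2 ∨ d = 3) (S : Setting d) :
    ∃ C : ℝ, 0 < C ∧ ∀ (w : S.L2) (H : S.L2Vec), S.HasGrad w H →
      ∀ A : Set (Space d), MeasurableSet A → (∀ᵐ x ∂S.mu, x ∉ A → w x = 0) →
        (∀ᵐ x ∂S.mu, x ∉ A → H x = 0) →
          ‖w‖ ≤ C * S.mu.real A ^ (3 / 10 : ℝ) * (‖w‖ + ‖H‖) := by
  obtain ⟨C, hC, hmain⟩ := (S.coneCondition_domain (by omega)).exists_eLpNorm_le_of_vanish hd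
    S.isOpen_domain S.isConnected_domain S.isBounded_domain
  refine ⟨C.toReal + 1, by positivity, fun w H h A hA hw hH => ?_⟩
  have hDm := S.isOpen_domain.measurableSet
  have hAD : MeasurableSet (A ∩ S.domain) := hA.inter hDm
  have hvan : ∀ {E : Type} [Zero E] (f : Space d → E), (∀ᵐ x ∂S.mu, x ∉ A → f x = 0) →
      ∀ᵐ x ∂S.mu, x ∉ A ∩ S.domain → f x = 0 := fun f hf => by
    filter_upwards [hf, ae_restrict_mem hDm] with x h1 h2 h3
    exact h1 fun h4 => h3 ⟨h4, h2⟩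
  have h1 := hmain w H (Lp.memLp w) (Lp.memLp H) (hasGrad_isWeakGrad h) (A ∩ S.domain)
    inter_subset_right hAD (hvan _ hw) (hvan _ hH)
  rw [← Measure.restrict_apply hA] at h1
  have hAtop : S.mu A ≠ ⊤ := measure_ne_top _ _
  have h2 := ENNReal.toReal_mono (ENNReal.mul_ne_top (ENNReal.mul_ne_top hC
    (ENNReal.rpow_ne_top_of_nonneg (by norm_num) hAtop))
    (ENNReal.add_ne_top.2 ⟨(Lp.memLp w).2.ne, (Lp.memLp H).2.ne⟩)) h1
  rw [ENNReal.toReal_mul, ENNReal.toReal_mul, ENNReal.toReal_add (Lp.memLp w).2.ne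
    (Lp.memLp H).2.ne, ← ENNReal.toReal_rpow, ← Lp.norm_def, ← Lp.norm_def] at h2
  refine h2.trans ?_
  gcongr
  · linarith
  · exact le_rfl

/-- The energy estimate on the set where a weak solution of `u - Δu = f` exceeds a level. The test
function is `smoothCut k h` of `u` rather than the positive part of `u - k`, as the chain rule is
available for continuously differentiable functions only. -/
theorem level_decay {C : ℝ} (hC : 0 < C) (hFK : ∀ (w : S.L2) (H : S.L2Vec), S.HasGrad w H →
      ∀ A : Set (Space d), MeasurableSet A → (∀ᵐ x ∂S.mu, x ∉ A → w x = 0) →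
        (∀ᵐ x ∂S.mu, x ∉ A → H x = 0) → ‖w‖ ≤ C * S.mu.real A ^ (3 / 10 : ℝ) * (‖w‖ + ‖H‖))
    {u f : S.L2} {G : S.L2Vec} (hG : S.HasGrad u G)
    (hsol : ∀ (v : S.L2) (H : S.L2Vec), S.HasGrad v H → ⟪G, H⟫_ℝ + ⟪u, v⟫_ℝ = ⟪f, v⟫_ℝ) {F : ℝ}
    (hF : ‖f‖ ≤ F) {k h : ℝ} (hk : 0 ≤ k) (hkh : k < h) :
    (h - k) ^ 2 * S.mu.real {x | h < u x} ≤
      (16 * C ^ 4 * F ^ 2) * S.mu.real {x | k < u x} ^ (6 / 5 : ℝ) := by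
  have hF0 : 0 ≤ F := (norm_nonneg _).trans hF
  have hum : Measurable u := (Lp.stronglyMeasurable u).measurable
  have hsc : Continuous (smoothCut k h) := continuous_iff_continuousAt.2 fun t =>
    (smoothCut_hasDerivAt k h t).continuousAt
  have hle : ∀ t, smoothCut k h t ≤ |t| := fun t => by
    rcases le_total t k with ht | ht
    · rw [smoothCut_eq_zero hkh ht]; exact abs_nonneg _
    · exact (smoothCut_le ht).trans (by linarith [le_abs_self t])
  have hw : MemLp (fun x => smoothCut k h (u x)) 2 S.mu := by
    refine (Lp.memLp u).of_le (hsc.measurable.comp hum).aestronglyMeasurable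
      (Eventually.of_forall fun x => ?_)
    rw [Real.norm_of_nonneg (smoothCut_nonneg hkh _)]
    exact hle _
  have hH : MemLp (fun x => cutSlope k h (u x) • G x) 2 S.mu := by
    refine (Lp.memLp G).of_le (((cutSlope_continuous k h).measurable.comp
      hum).aestronglyMeasurable.smul (Lp.aestronglyMeasurable G)) (Eventually.of_forall fun x => ?_)
    rw [norm_smul, Real.norm_of_nonneg (cutSlope_nonneg _ _ _)]
    exact mul_le_of_le_one_left (norm_nonneg _) (cutSlope_le_one _ _ _)
  have hwg : S.WeakGrad (fun x => smoothCut k h (u x)) (fun x => cutSlope k h (u x) • G x) :=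
    WeakGrad.comp ((Lp.memLp u).integrable one_le_two) ((Lp.memLp G).integrable one_le_two) hG
      (smoothCut_hasDerivAt k h) (cutSlope_continuous k h)
      (fun t => by rw [abs_of_nonneg (cutSlope_nonneg _ _ _)]; exact cutSlope_le_one _ _ _)
      (smoothCut_eq_zero hkh hk) (hw.integrable one_le_two) (hH.integrable one_le_two)
  set w : S.L2 := hw.toLp _ with hwdef
  set H : S.L2Vec := hH.toLp _ with hHdef
  have hgr : S.HasGrad w H := hwg.hasGrad hw hH
  have hwx : w =ᵐ[S.mu] fun x => smoothCut k h (u x) := hw.coeFn_toLp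
  have hHx : H =ᵐ[S.mu] fun x => cutSlope k h (u x) • G x := hH.coeFn_toLp
  have h1 : ‖H‖ ^ 2 ≤ ⟪G, H⟫_ℝ := by
    rw [← real_inner_self_eq_norm_sq, L2.inner_def, L2.inner_def]
    refine integral_mono_ae (L2.integrable_inner H H) (L2.integrable_inner G H) ?_
    filter_upwards [hHx] with x hx
    simp only [hx, inner_smul_left, inner_smul_right, conj_trivial, real_inner_self_eq_norm_sq]
    exact mul_le_of_le_one_left (mul_nonneg (cutSlope_nonneg _ _ _) (sq_nonneg _))
      (cutSlope_le_one _ _ _)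
  have h2 : ‖w‖ ^ 2 ≤ ⟪u, w⟫_ℝ := by
    rw [← real_inner_self_eq_norm_sq, L2.inner_def, L2.inner_def]
    refine integral_mono_ae (L2.integrable_inner w w) (L2.integrable_inner u w) ?_
    filter_upwards [hwx] with x hx
    simp only [hx, RCLike.inner_apply, conj_trivial]
    rcases le_total (u x) k with ht | ht
    · simp [smoothCut_eq_zero hkh ht]
    · have e1 := smoothCut_le (h := h) ht
      have e2 := smoothCut_nonneg hkh (u x)
      exact mul_le_mul_of_nonneg_left (by linarith) e2
  have h3 : ‖H‖ ^ 2 + ‖w‖ ^ 2 ≤ F * ‖w‖ := by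
    have := hsol w H hgr
    have h4 := real_inner_le_norm f w
    have h5 := mul_le_mul_of_nonneg_right hF (norm_nonneg w)
    linarith
  set m : ℝ := S.mu.real {x | k < u x} with hm
  have hm0 : 0 ≤ m := measureReal_nonneg
  have h4 : ‖w‖ ≤ C * m ^ (3 / 10 : ℝ) * (‖w‖ + ‖H‖) := by
    refine hFK w H hgr {x | k < u x} (measurableSet_lt measurable_const hum) ?_ ?_
    · filter_upwards [hwx] with x hx hxA
      rw [hx]
      exact smoothCut_eq_zero hkh (not_lt.1 hxA)
    · filter_upwards [hHx] with x hx hxA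
      rw [hx]
      simp only [cutSlope_eq_zero hkh (not_lt.1 hxA), zero_smul]
  set q : ℝ := m ^ (3 / 10 : ℝ) with hq
  have hq0 : 0 ≤ q := Real.rpow_nonneg hm0 _
  have h5 : ‖w‖ + ‖H‖ ≤ 2 * F * C * q := by
    set N := ‖w‖ + ‖H‖ with hN
    have hN0 : 0 ≤ N := by positivity
    have e1 : N ^ 2 ≤ 2 * F * (C * q * N) := by
      have : N ^ 2 ≤ 2 * (F * ‖w‖) := by nlinarith [sq_nonneg (‖w‖ - ‖H‖)]
      nlinarith [mul_le_mul_of_nonneg_left h4 hF0]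
    rcases hN0.eq_or_lt with h | h
    · rw [← h]; positivity
    · refine le_of_mul_le_mul_right ?_ h
      nlinarith
  have h6 : ‖w‖ ≤ 2 * F * C ^ 2 * q ^ 2 := by
    calc ‖w‖ ≤ C * q * (‖w‖ + ‖H‖) := h4
      _ ≤ C * q * (2 * F * C * q) := by gcongr
      _ = _ := by ring
  -- Chebyshev's inequality
  have h7 : ((h - k) / 2) ^ 2 * S.mu.real {x | h < u x} ≤ ‖w‖ ^ 2 := by
    have e1 : ‖w‖ ^ 2 = ∫ x, (smoothCut k h (u x)) ^ 2 ∂S.mu := by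
      rw [← real_inner_self_eq_norm_sq, L2.inner_def]
      refine integral_congr_ae ?_
      filter_upwards [hwx] with x hx
      rw [hx, real_inner_self_eq_norm_sq, Real.norm_eq_abs, sq_abs]
    rw [e1]
    have e2 := mul_meas_ge_le_integral_of_nonneg (μ := S.mu)
      (f := fun x => (smoothCut k h (u x)) ^ 2) (Eventually.of_forall fun x => sq_nonneg _)
      hw.integrable_sq (((h - k) / 2) ^ 2)
    refine le_trans (mul_le_mul_of_nonneg_left (measureReal_mono ?_) (sq_nonneg _)) e2
    intro x hx
    have hx' : h < u x := hx
    exact pow_le_pow_left₀ (by linarith) (le_smoothCut hkh hx'.le) 2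
  have h8 : q ^ 4 = m ^ (6 / 5 : ℝ) := by
    rw [hq, ← Real.rpow_natCast, ← Real.rpow_mul hm0]; norm_num
  have h9 : ‖w‖ ^ 2 ≤ (2 * F * C ^ 2 * q ^ 2) ^ 2 := pow_le_pow_left₀ (norm_nonneg _) h6 2
  rw [← h8]
  nlinarith

/-- Weak solutions of `u - Δu = f` are bounded, in terms of the `L²` norm of `f`. -/
theorem exists_le_of_weak_solution (hd : d = 2 ∨ d = 3) (S : Setting d) :
    ∃ K : ℝ, 0 < K ∧ ∀ (u f : S.L2) (G : S.L2Vec), S.HasGrad u G →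
      (∀ (v : S.L2) (H : S.L2Vec), S.HasGrad v H → ⟪G, H⟫_ℝ + ⟪u, v⟫_ℝ = ⟪f, v⟫_ℝ) →
      ∀ F : ℝ, 0 < F → ‖f‖ ≤ F → ∀ᵐ x ∂S.mu, u x ≤ K * F := by
  obtain ⟨C, hC, hFK⟩ := exists_norm_le_of_vanish hd S
  set V : ℝ := S.mu.real univ + 1 with hV
  have hV0 : 0 < V := by positivity
  refine ⟨√(16 * C ^ 4 * V ^ (1 / 5 : ℝ) * 4 ^ 6), by positivity, fun u f G hG hsol F hF hfF => ?_⟩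
  set K := √(16 * C ^ 4 * V ^ (1 / 5 : ℝ) * 4 ^ 6) with hK
  have hK0 : 0 < K := by positivity
  have hz := eq_zero_of_level_decay (a := fun k => S.mu.real {x | k < u x}) (V := V)
    (B := 16 * C ^ 4 * F ^ 2) (K := K * F)
    (fun a b hab => measureReal_mono fun x (hx : b < u x) => lt_of_le_of_lt hab hx)
    (fun k => measureReal_nonneg) hV0 (by positivity)
    ((measureReal_mono (subset_univ _)).trans (by linarith)) (by positivity)
    (fun k h hk hkh => level_decay hC hFK hG hsol hfF hk hkh) (by
      rw [mul_pow, hK, Real.sq_sqrt (by positivity)]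
      exact le_of_eq (by ring))
  have hz' : S.mu {x | K * F < u x} = 0 := (measureReal_eq_zero_iff (measure_ne_top _ _)).1 hz
  rw [ae_iff]
  simpa using hz'

/-- The bound for weak solutions is applied to `±u`, as `u` solves `u - Δu = f` with `f = u - g`. -/
theorem exists_isSobolevConst (hd : d = 2 ∨ d = 3) (S : Setting d) :
    ∃ C : ℝ, S.IsSobolevConst C := by
  obtain ⟨K, hK, hmain⟩ := exists_le_of_weak_solution hd S
  refine ⟨2 * K, by positivity, fun u G g hG hg => ?_⟩
  set N := √(‖u‖ ^ 2 + ‖G‖ ^ 2 + ‖g‖ ^ 2) with hN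
  have hN0 : 0 ≤ N := Real.sqrt_nonneg _
  have hN2 : N ^ 2 = ‖u‖ ^ 2 + ‖G‖ ^ 2 + ‖g‖ ^ 2 := Real.sq_sqrt (by positivity)
  have huN : ‖u‖ ≤ N := abs_le_of_sq_le_sq' (by nlinarith [sq_nonneg ‖G‖, sq_nonneg ‖g‖]) hN0 |>.2
  have hgN : ‖g‖ ≤ N := abs_le_of_sq_le_sq' (by nlinarith [sq_nonneg ‖G‖, sq_nonneg ‖u‖]) hN0 |>.2
  rcases hN0.eq_or_lt with h | h
  · have hu0 : u = 0 := norm_le_zero_iff.1 (huN.trans_eq h.symm)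
    have : S.supNorm u = 0 := by
      rw [supNorm, hu0, eLpNorm_congr_ae (Lp.coeFn_zero ℝ 2 S.mu)]
      exact eLpNorm_zero
    rw [this]; exact zero_le
  · have hf : ‖u - g‖ ≤ 2 * N := (norm_sub_le _ _).trans (by linarith)
    have hsol : ∀ (v : S.L2) (H : S.L2Vec), S.HasGrad v H →
        ⟪G, H⟫_ℝ + ⟪u, v⟫_ℝ = ⟪u - g, v⟫_ℝ := fun v H hv => by
      rw [hg.2 G v H hG hv, inner_sub_left]; ring
    have h1 := hmain u (u - g) G hG hsol (2 * N) (by positivity) hf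
    have hneg : S.HasGrad (-u) (-G) := fun ψ hψ i => by
      have e1 : ∫ x, (-u : S.L2) x * fderiv ℝ ψ x (EuclideanSpace.single i 1) ∂S.mu =
          -∫ x, u x * fderiv ℝ ψ x (EuclideanSpace.single i 1) ∂S.mu := by
        rw [← integral_neg]
        refine integral_congr_ae ?_
        filter_upwards [Lp.coeFn_neg u] with x hx
        rw [hx, Pi.neg_apply, neg_mul]
      have e2 : ∫ x, ((-G : S.L2Vec) x) i * ψ x ∂S.mu = -∫ x, (G x) i * ψ x ∂S.mu := by
        rw [← integral_neg]
        refine integral_congr_ae ?_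
        filter_upwards [Lp.coeFn_neg G] with x hx
        rw [hx, Pi.neg_apply, PiLp.neg_apply, neg_mul]
      rw [e1, e2, hG ψ hψ i]
    have h2 := hmain (-u) (-(u - g)) (-G) hneg (fun v H hv => by
      rw [inner_neg_left, inner_neg_left, inner_neg_left, ← hsol v H hv]; ring) (2 * N)
      (by positivity) (by rwa [norm_neg])
    rw [supNorm, eLpNorm_exponent_top]
    refine eLpNormEssSup_le_of_ae_enorm_bound ?_
    filter_upwards [h1, h2, Lp.coeFn_neg u] with x e1 e2 e3
    rw [e3, Pi.neg_apply] at e2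
    rw [← ofReal_norm]
    refine ENNReal.ofReal_le_ofReal ?_
    rw [Real.norm_eq_abs, abs_le]
    constructor <;> linarith

/-- The mean value is almost the best constant: replacing an arbitrary constant by it at most doubles
the distance. -/
theorem exists_isPoincareConst (hd : d = 2 ∨ d = 3) (S : Setting d) :
    ∃ C : ℝ, S.IsPoincareConst C := by
  obtain ⟨C, hC, hmain⟩ := (S.coneCondition_domain (by omega)).exists_poincare hd
    S.isOpen_domain S.isConnected_domain S.isBounded_domain
  refine ⟨2 * C.toReal + 1, by positivity, fun u G hG => ?_⟩
  obtain ⟨c, hc⟩ := hmain u G (Lp.memLp u) (Lp.memLp G) (hasGrad_isWeakGrad hG)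
  have hui : Integrable u S.mu := (Lp.memLp u).integrable one_le_two
  have hvol : S.mu univ = ENNReal.ofReal S.vol := by
    rw [vol, ENNReal.ofReal_toReal S.isBounded_domain.measure_lt_top.ne]; simp
  have hv := S.vol_pos
  set w : Space d → ℝ := fun x => u x - c with hw
  have hwm : AEStronglyMeasurable w S.mu := (Lp.aestronglyMeasurable u).sub aestronglyMeasurable_const
  have hwi : Integrable w S.mu := hui.sub (integrable_const c)
  have hmean : S.mean u - c = (∫ x, w x ∂S.mu) / S.vol := by
    have : S.mu.real univ = S.vol := by
      rw [measureReal_def, hvol, ENNReal.toReal_ofReal hv.le]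
    rw [hw, integral_sub hui (integrable_const c), integral_const, this, mean, smul_eq_mul]
    field_simp
  have hconst : eLpNorm (fun _ : Space d => S.mean u - c) 2 S.mu ≤ eLpNorm w 2 S.mu := by
    have h1 : ‖∫ x, w x ∂S.mu‖ₑ ≤ eLpNorm w 2 S.mu * ENNReal.ofReal S.vol ^ (1 / 2 : ℝ) := by
      refine (enorm_integral_le_lintegral_enorm _).trans ?_
      rw [← eLpNorm_one_eq_lintegral_enorm]
      have := eLpNorm_le_eLpNorm_mul_rpow_measure_univ (p := 1) (q := 2) one_le_two hwm
      rw [hvol] at this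
      have e : 1 / (1 : ℝ≥0∞).toReal - 1 / (2 : ℝ≥0∞).toReal = (1 / 2 : ℝ) := by norm_num
      rwa [e] at this
    rw [eLpNorm_const' _ two_ne_zero (by norm_num), hvol, hmean, div_eq_mul_inv, enorm_mul]
    have e1 : ‖S.vol⁻¹‖ₑ = (ENNReal.ofReal S.vol)⁻¹ := by
      rw [← ENNReal.ofReal_inv_of_pos hv, ← ofReal_norm, Real.norm_of_nonneg (inv_pos.2 hv).le]
    have e2 : ENNReal.ofReal S.vol ^ (1 / 2 : ℝ) * ENNReal.ofReal S.vol ^ (1 / 2 : ℝ) =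
        ENNReal.ofReal S.vol := by
      rw [← ENNReal.rpow_add_of_nonneg _ _ (by norm_num) (by norm_num)]; norm_num
    rw [e1]
    rw [ENNReal.toReal_ofNat]
    calc ‖∫ x, w x ∂S.mu‖ₑ * (ENNReal.ofReal S.vol)⁻¹ * ENNReal.ofReal S.vol ^ (1 / 2 : ℝ)
        ≤ (eLpNorm w 2 S.mu * ENNReal.ofReal S.vol ^ (1 / 2 : ℝ)) * (ENNReal.ofReal S.vol)⁻¹ *
          ENNReal.ofReal S.vol ^ (1 / 2 : ℝ) := by
          gcongr
      _ = eLpNorm w 2 S.mu * ((ENNReal.ofReal S.vol ^ (1 / 2 : ℝ) *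
          ENNReal.ofReal S.vol ^ (1 / 2 : ℝ)) * (ENNReal.ofReal S.vol)⁻¹) := by ring
      _ = eLpNorm w 2 S.mu := by
          rw [e2, ENNReal.mul_inv_cancel (by simpa using hv) ENNReal.ofReal_ne_top, mul_one]
  have hsplit : (fun x => u x - S.mean u) = w - fun _ => S.mean u - c := by
    ext x; simp [hw]
  rw [hsplit]
  calc eLpNorm (w - fun _ => S.mean u - c) 2 S.mu
      ≤ eLpNorm w 2 S.mu + eLpNorm (fun _ : Space d => S.mean u - c) 2 S.mu :=
        eLpNorm_sub_le hwm aestronglyMeasurable_const one_le_two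
    _ ≤ eLpNorm w 2 S.mu + eLpNorm w 2 S.mu := by gcongr
    _ ≤ C * eLpNorm G 2 S.mu + C * eLpNorm G 2 S.mu := add_le_add hc hc
    _ = ENNReal.ofReal (2 * C.toReal * ‖G‖) := by
        rw [Lp.norm_def, ENNReal.ofReal_mul (by positivity), ENNReal.ofReal_mul (by norm_num),
          ENNReal.ofReal_toReal hC, ENNReal.ofReal_toReal (Lp.memLp G).2.ne]
        rw [ENNReal.ofReal_ofNat]; ring
    _ ≤ _ := by
        refine ENNReal.ofReal_le_ofReal ?_
        gcongr
        linarith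

end Setting

/-! ### The Sobolev space and the resolvent of the Laplacian -/

namespace Setting

variable {S : Setting d}

theorem memLp_of_continuous (S : Setting d) {E : Type*} [NormedAddCommGroup E]
    [SecondCountableTopology E] {f : Space d → E} (hf : Continuous f) : MemLp f 2 S.mu := by
  obtain ⟨C, hC⟩ := S.isBounded_domain.isCompact_closure.exists_bound_of_continuousOn
    hf.continuousOn
  refine MemLp.of_bound hf.aestronglyMeasurable C ?_
  filter_upwards [ae_restrict_mem S.isOpen_domain.measurableSet] with x hx
  exact hC x (subset_closure hx)

theorem inner_toLp (u : S.L2) {f : Space d → ℝ} (hf : MemLp f 2 S.mu) :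
    ⟪hf.toLp f, u⟫_ℝ = ∫ x, u x * f x ∂S.mu := by
  rw [L2.inner_def]
  refine integral_congr_ae ?_
  filter_upwards [hf.coeFn_toLp] with x hx
  rw [hx]; simp

/-- Weak differentiability as a family of continuous linear equations. -/
theorem exists_hasGrad_iff (S : Setting d) : ∃ D : Set (S.L2 × S.L2Vec), ∀ (u : S.L2) (G : S.L2Vec),
    S.HasGrad u G ↔ ∀ p ∈ D, ⟪p.1, u⟫_ℝ = -⟪p.2, G⟫_ℝ := by
  have hc1 : ∀ ψ ∈ S.tests, ∀ i : Fin d,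
      Continuous fun x => fderiv ℝ ψ x (EuclideanSpace.single i (1 : ℝ)) := fun ψ hψ i =>
    ((S.tests_contDiff hψ).continuous_fderiv (by simp)).clm_apply continuous_const
  have hc2 : ∀ ψ ∈ S.tests, ∀ i : Fin d,
      Continuous fun x => ψ x • (EuclideanSpace.single i (1 : ℝ) : Space d) := fun ψ hψ i =>
    (S.tests_contDiff hψ).continuous.smul continuous_const
  refine ⟨{p | ∃ (ψ : Space d → ℝ) (hψ : ψ ∈ S.tests) (i : Fin d),
    p = ((S.memLp_of_continuous (hc1 ψ hψ i)).toLp _, (S.memLp_of_continuous (hc2 ψ hψ i)).toLp _)},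
    fun u G => ?_⟩
  have key : ∀ ψ (hψ : ψ ∈ S.tests) (i : Fin d),
      ⟪(S.memLp_of_continuous (hc2 ψ hψ i)).toLp _, G⟫_ℝ = ∫ x, (G x) i * ψ x ∂S.mu := by
    intro ψ hψ i
    rw [L2.inner_def]
    refine integral_congr_ae ?_
    filter_upwards [(S.memLp_of_continuous (hc2 ψ hψ i)).coeFn_toLp] with x hx
    rw [hx, inner_smul_left, EuclideanSpace.inner_single_left]
    simp [mul_comm]
  constructor
  · rintro h p ⟨ψ, hψ, i, rfl⟩
    rw [inner_toLp, key ψ hψ i]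
    exact h ψ hψ i
  · intro h ψ hψ i
    have := h _ ⟨ψ, hψ, i, rfl⟩
    rwa [inner_toLp, key ψ hψ i] at this

theorem HasGrad.zero : S.HasGrad 0 0 := by
  obtain ⟨D, hD⟩ := S.exists_hasGrad_iff
  rw [hD]; intro p _; simp

theorem HasGrad.add {u v : S.L2} {G H : S.L2Vec} (hu : S.HasGrad u G) (hv : S.HasGrad v H) :
    S.HasGrad (u + v) (G + H) := by
  obtain ⟨D, hD⟩ := S.exists_hasGrad_iff
  rw [hD] at *
  intro p hp
  rw [inner_add_right, inner_add_right, hu p hp, hv p hp]; ring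

theorem HasGrad.smul {u : S.L2} {G : S.L2Vec} (c : ℝ) (hu : S.HasGrad u G) :
    S.HasGrad (c • u) (c • G) := by
  obtain ⟨D, hD⟩ := S.exists_hasGrad_iff
  rw [hD] at *
  intro p hp
  rw [inner_smul_right, inner_smul_right, hu p hp]; ring

theorem HasGrad.sub {u v : S.L2} {G H : S.L2Vec} (hu : S.HasGrad u G) (hv : S.HasGrad v H) :
    S.HasGrad (u - v) (G - H) := by
  have := hu.add (hv.smul (-1))
  rwa [neg_one_smul, neg_one_smul, ← sub_eq_add_neg, ← sub_eq_add_neg] at this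

/-- The weak gradient is unique. -/
theorem HasGrad.unique {u : S.L2} {G₁ G₂ : S.L2Vec} (h₁ : S.HasGrad u G₁) (h₂ : S.HasGrad u G₂) :
    G₁ = G₂ := by
  have h := hasGrad_isWeakGrad (h₁.sub h₂)
  rw [sub_self] at h
  have h0 : ∀ i : Fin d, ∀ᵐ x ∂S.mu, ((G₁ - G₂ : S.L2Vec) x) i = 0 := by
    intro i
    have hGi : Integrable (fun x => ((G₁ - G₂ : S.L2Vec) x) i) S.mu :=
      (EuclideanSpace.proj i : Space d →L[ℝ] ℝ).integrable_comp
        ((Lp.memLp (G₁ - G₂)).integrable one_le_two)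
    have hloc : LocallyIntegrableOn (fun x => ((G₁ - G₂ : S.L2Vec) x) i) S.domain volume :=
      IntegrableOn.locallyIntegrableOn hGi
    refine (ae_restrict_iff' S.isOpen_domain.measurableSet).2
      (S.isOpen_domain.ae_eq_zero_of_integral_contDiff_smul_eq_zero hloc fun ψ hψ hc hs => ?_)
    have h1 := h ψ hψ hc hs i
    have h2 : ∫ x in S.domain, (0 : S.L2) x * fderiv ℝ ψ x (EuclideanSpace.single i 1) = 0 := by
      rw [← integral_zero (Space d) ℝ (μ := S.mu)]
      refine integral_congr_ae ?_
      filter_upwards [Lp.coeFn_zero ℝ 2 S.mu] with x hx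
      rw [hx]; simp
    rw [h2, zero_eq_neg] at h1
    rw [← setIntegral_eq_integral_of_forall_compl_eq_zero (s := S.domain)
      (f := fun x => ψ x • ((G₁ - G₂ : S.L2Vec) x) i), ← h1]
    · refine integral_congr_ae (Eventually.of_forall fun x => ?_)
      simp [mul_comm]
    · intro x hx
      rw [image_eq_zero_of_notMem_tsupport (fun h => hx (hs h)), zero_smul]
  refine sub_eq_zero.1 ((Lp.eq_zero_iff_ae_eq_zero).2 ?_)
  filter_upwards [ae_all_iff.2 h0] with x hx
  ext i; exact hx i

/-- To determine the weak Laplacian it suffices to test with one gradient. -/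
theorem HasGrad.hasLap {u g : S.L2} {G : S.L2Vec} (hG : S.HasGrad u G)
    (h : ∀ (v : S.L2) (H : S.L2Vec), S.HasGrad v H → ⟪G, H⟫_ℝ = -⟪g, v⟫_ℝ) : S.HasLap u g :=
  ⟨⟨G, hG⟩, fun G' v H hG' hH => by rw [hG'.unique hG]; exact h v H hH⟩

theorem HasLap.zero : S.HasLap 0 0 :=
  HasGrad.zero.hasLap fun v H _ => by simp

theorem HasLap.add {u v g h : S.L2} (hu : S.HasLap u g) (hv : S.HasLap v h) :
    S.HasLap (u + v) (g + h) := by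
  obtain ⟨G, hG⟩ := hu.1
  obtain ⟨H, hH⟩ := hv.1
  refine (hG.add hH).hasLap fun w K hK => ?_
  rw [inner_add_left, inner_add_left, hu.2 G w K hG hK, hv.2 H w K hH hK]; ring

theorem HasLap.smul {u g : S.L2} (c : ℝ) (hu : S.HasLap u g) : S.HasLap (c • u) (c • g) := by
  obtain ⟨G, hG⟩ := hu.1
  refine (hG.smul c).hasLap fun w K hK => ?_
  rw [inner_smul_left, inner_smul_left, hu.2 G w K hG hK]; simp

theorem HasLap.neg {u g : S.L2} (hu : S.HasLap u g) : S.HasLap (-u) (-g) := by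
  have := hu.smul (-1)
  rwa [neg_one_smul, neg_one_smul] at this

theorem HasLap.sub {u v g h : S.L2} (hu : S.HasLap u g) (hv : S.HasLap v h) :
    S.HasLap (u - v) (g - h) := by
  rw [sub_eq_add_neg, sub_eq_add_neg]; exact hu.add hv.neg

theorem InDom.hasLap {u : S.L2} (h : S.InDom u) : S.HasLap u (S.lap u) := by
  obtain ⟨g, hg⟩ := h
  rwa [hg.lap_eq]

/-- The Sobolev space `H¹` as the graph of the weak gradient. -/
def sobolev (S : Setting d) : Submodule ℝ (WithLp 2 (S.L2 × S.L2Vec)) where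
  carrier := {p | S.HasGrad p.fst p.snd}
  add_mem' hp hq := HasGrad.add hp hq
  zero_mem' := HasGrad.zero
  smul_mem' c _ hp := HasGrad.smul c hp

theorem mem_sobolev {p : WithLp 2 (S.L2 × S.L2Vec)} : p ∈ S.sobolev ↔ S.HasGrad p.fst p.snd :=
  Iff.rfl

theorem sobolev_isClosed (S : Setting d) :
    IsClosed (S.sobolev : Set (WithLp 2 (S.L2 × S.L2Vec))) := by
  obtain ⟨D, hD⟩ := S.exists_hasGrad_iff
  have : (S.sobolev : Set (WithLp 2 (S.L2 × S.L2Vec))) =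
      ⋂ p ∈ D, {q : WithLp 2 (S.L2 × S.L2Vec) | ⟪p.1, q.fst⟫_ℝ = -⟪p.2, q.snd⟫_ℝ} := by
    ext q
    simp only [mem_iInter₂, SetLike.mem_coe, mem_sobolev, hD]
    rfl
  rw [this]
  refine isClosed_biInter fun p _ => isClosed_eq ?_ ?_
  · exact continuous_const.inner (WithLp.continuous_fst ..)
  · exact (continuous_const.inner (WithLp.continuous_snd ..)).neg

instance (S : Setting d) : CompleteSpace S.sobolev :=
  S.sobolev_isClosed.completeSpace_coe

/-- The function in an element of `H¹`. -/
def sobolevVal (S : Setting d) : S.sobolev →L[ℝ] S.L2 :=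
  (WithLp.fstL 2 ℝ S.L2 S.L2Vec).comp S.sobolev.subtypeL

/-- The gradient in an element of `H¹`. -/
def sobolevGrad (S : Setting d) : S.sobolev →L[ℝ] S.L2Vec :=
  (WithLp.sndL 2 ℝ S.L2 S.L2Vec).comp S.sobolev.subtypeL

theorem sobolev_hasGrad (p : S.sobolev) : S.HasGrad (S.sobolevVal p) (S.sobolevGrad p) := p.2

theorem exists_sobolev {u : S.L2} {G : S.L2Vec} (h : S.HasGrad u G) :
    ∃ p : S.sobolev, S.sobolevVal p = u ∧ S.sobolevGrad p = G :=
  ⟨⟨WithLp.toLp 2 (u, G), h⟩, rfl, rfl⟩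

theorem sobolev_inner (p q : S.sobolev) :
    ⟪p, q⟫_ℝ = ⟪S.sobolevVal p, S.sobolevVal q⟫_ℝ + ⟪S.sobolevGrad p, S.sobolevGrad q⟫_ℝ := by
  rw [Submodule.coe_inner, WithLp.prod_inner_apply]; rfl

/-- The resolvent `(I - Δ)⁻¹`. If `ι` denotes the embedding of `H¹` into `L²`, it is `ι ι*`. -/
def resolvent (S : Setting d) : S.L2 →L[ℝ] S.L2 :=
  S.sobolevVal.comp (ContinuousLinearMap.adjoint S.sobolevVal)

theorem inner_resolvent_comm (x y : S.L2) : ⟪S.resolvent x, y⟫_ℝ = ⟪x, S.resolvent y⟫_ℝ := by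
  simp only [resolvent, ContinuousLinearMap.comp_apply]
  rw [← ContinuousLinearMap.adjoint_inner_right, ContinuousLinearMap.adjoint_inner_left]

theorem hasLap_resolvent (z : S.L2) : S.HasLap (S.resolvent z) (S.resolvent z - z) := by
  refine (sobolev_hasGrad (ContinuousLinearMap.adjoint S.sobolevVal z)).hasLap fun v H hv => ?_
  obtain ⟨q, rfl, rfl⟩ := exists_sobolev hv
  have h1 := sobolev_inner (ContinuousLinearMap.adjoint S.sobolevVal z) q
  rw [ContinuousLinearMap.adjoint_inner_left] at h1
  rw [inner_sub_left]
  change _ = -(⟪S.sobolevVal (ContinuousLinearMap.adjoint S.sobolevVal z), S.sobolevVal q⟫_ℝ - _)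
  linarith

theorem lap_resolvent (z : S.L2) : S.lap (S.resolvent z) = S.resolvent z - z :=
  (hasLap_resolvent z).lap_eq

theorem norm_resolvent_sq_le (z : S.L2) : ‖S.resolvent z‖ ^ 2 ≤ ⟪S.resolvent z, z⟫_ℝ := by
  obtain ⟨G, hG⟩ := (hasLap_resolvent z).1
  have h := (hasLap_resolvent z).2 G _ G hG hG
  rw [inner_sub_left, real_inner_self_eq_norm_sq, real_inner_self_eq_norm_sq] at h
  rw [real_inner_comm]
  nlinarith [sq_nonneg ‖G‖]

theorem norm_sub_resolvent_sq_le (z : S.L2) :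
    ‖z - S.resolvent z‖ ^ 2 ≤ ⟪z - S.resolvent z, z⟫_ℝ := by
  have h := norm_resolvent_sq_le z
  rw [norm_sub_sq_real, inner_sub_left, real_inner_self_eq_norm_sq, real_inner_comm]
  linarith

/-- `D(Δ)` is the range of the resolvent. -/
theorem HasLap.resolvent_eq {u g : S.L2} (h : S.HasLap u g) : S.resolvent (u - g) = u := by
  have h1 := (hasLap_resolvent (u - g)).sub h
  set w := S.resolvent (u - g) - u with hw
  have h2 : S.resolvent (u - g) - (u - g) - g = w := by rw [hw]; abel
  rw [h2] at h1
  obtain ⟨G, hG⟩ := h1.1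
  have h3 := h1.2 G w G hG hG
  rw [real_inner_self_eq_norm_sq, real_inner_self_eq_norm_sq] at h3
  have h4 : ‖w‖ ^ 2 = 0 := by nlinarith [sq_nonneg ‖G‖, sq_nonneg ‖w‖]
  exact sub_eq_zero.1 (norm_eq_zero.1 (pow_eq_zero_iff two_ne_zero |>.1 h4))

/-! ### Mean values -/

/-- The constant function `1`. -/
def one (S : Setting d) : S.L2 := Lp.const 2 S.mu (1 : ℝ)

theorem one_coeFn (S : Setting d) : S.one =ᵐ[S.mu] fun _ => 1 := Lp.coeFn_const 2 S.mu (1 : ℝ)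

theorem hasGrad_one (S : Setting d) : S.HasGrad S.one 0 := by
  intro ψ hψ i
  have h := S.weakGrad_const 1 ψ hψ i
  have e1 : ∫ x, S.one x * fderiv ℝ ψ x (EuclideanSpace.single i 1) ∂S.mu =
      ∫ x, 1 * fderiv ℝ ψ x (EuclideanSpace.single i 1) ∂S.mu :=
    integral_congr_ae (by filter_upwards [S.one_coeFn] with x hx; rw [hx])
  have e2 : ∫ x, ((0 : S.L2Vec) x) i * ψ x ∂S.mu = ∫ x, ((0 : Space d) i) * ψ x ∂S.mu :=
    integral_congr_ae (by filter_upwards [Lp.coeFn_zero (Space d) 2 S.mu] with x hx; rw [hx]; rfl)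
  rw [e1, e2]; exact h

theorem hasLap_one (S : Setting d) : S.HasLap S.one 0 :=
  S.hasGrad_one.hasLap fun v H _ => by simp

theorem inner_one (u : S.L2) : ⟪u, S.one⟫_ℝ = ∫ x, u x ∂S.mu := by
  rw [L2.inner_def]
  refine integral_congr_ae ?_
  filter_upwards [S.one_coeFn] with x hx
  rw [hx]; simp

theorem norm_one_sq (S : Setting d) : ‖S.one‖ ^ 2 = S.vol := by
  rw [← real_inner_self_eq_norm_sq, inner_one, integral_congr_ae S.one_coeFn]
  simp [measureReal_def, vol]

theorem mean_eq_inner (u : S.L2) : S.mean u = ⟪u, S.one⟫_ℝ / S.vol := by rw [inner_one]; rfl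

theorem IsPoincareConst.norm_sub_le {C : ℝ} (hC : S.IsPoincareConst C) {u : S.L2} {G : S.L2Vec}
    (hG : S.HasGrad u G) : ‖u - S.mean u • S.one‖ ≤ C * ‖G‖ := by
  have h := hC.2 u G hG
  have e : eLpNorm (u - S.mean u • S.one : S.L2) 2 S.mu =
      eLpNorm (fun x => u x - S.mean u) 2 S.mu := by
    refine eLpNorm_congr_ae ?_
    filter_upwards [Lp.coeFn_sub u (S.mean u • S.one), Lp.coeFn_smul (S.mean u) S.one,
      S.one_coeFn] with x h1 h2 h3
    rw [h1, Pi.sub_apply, h2, Pi.smul_apply, h3]; simp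
  rw [Lp.norm_def, e]
  exact ENNReal.toReal_le_of_le_ofReal (mul_nonneg hC.1.le (norm_nonneg _)) h

theorem meanNorm_eq (u : S.L2) : S.meanNorm u = ‖S.mean u • S.one‖ := by
  rw [norm_smul, meanNorm, ← norm_one_sq, Real.sqrt_sq (norm_nonneg _), Real.norm_eq_abs]

/-- Poisson's equation is solvable for right-hand sides of mean zero. -/
theorem exists_hasLap_neg {C : ℝ} (hC : S.IsPoincareConst C) {z : S.L2} (hz : ⟪z, S.one⟫_ℝ = 0) :
    ∃ v, S.HasLap v (-z) := by
  let e : S.sobolev := ContinuousLinearMap.adjoint S.sobolevVal S.one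
  have he : ∀ q, ⟪e, q⟫_ℝ = ⟪S.sobolevVal q, S.one⟫_ℝ := fun q => by
    rw [ContinuousLinearMap.adjoint_inner_left, real_inner_comm]
  -- the form `(∇u, ∇v) + ∫ u ∫ v`, which is coercive by the Poincaré inequality
  let T : S.sobolev →L[ℝ] S.sobolev :=
    (ContinuousLinearMap.adjoint S.sobolevGrad).comp S.sobolevGrad + (innerSL ℝ e).smulRight e
  let B : S.sobolev →L[ℝ] S.sobolev →L[ℝ] ℝ := (innerSL ℝ).comp T
  have hB : ∀ p q, B p q = ⟪S.sobolevGrad p, S.sobolevGrad q⟫_ℝ +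
      ⟪S.sobolevVal p, S.one⟫_ℝ * ⟪S.sobolevVal q, S.one⟫_ℝ := fun p q => by
    rw [← he, ← he, ← ContinuousLinearMap.adjoint_inner_left]
    change ⟪T p, q⟫_ℝ = _
    simp only [T, add_apply, ContinuousLinearMap.comp_apply,
      ContinuousLinearMap.smulRight_apply, innerSL_apply_apply, inner_add_left, inner_smul_left,
      conj_trivial]
  have hv := S.vol_pos
  have hcoer : IsCoercive B := by
    refine ⟨(1 + 2 * C ^ 2 + 2 / S.vol)⁻¹, by positivity, fun p => ?_⟩
    set u := S.sobolevVal p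
    set G := S.sobolevGrad p
    have h1 := hC.norm_sub_le (sobolev_hasGrad p)
    have h2 : ‖S.mean u • S.one‖ ^ 2 = ⟪u, S.one⟫_ℝ ^ 2 / S.vol := by
      rw [norm_smul, mul_pow, norm_one_sq, mean_eq_inner, Real.norm_eq_abs, sq_abs]
      field_simp
    have h3 : ‖u‖ ^ 2 ≤ 2 * (C * ‖G‖) ^ 2 + 2 * (⟪u, S.one⟫_ℝ ^ 2 / S.vol) := by
      have h4 : ‖u‖ ≤ ‖u - S.mean u • S.one‖ + ‖S.mean u • S.one‖ := by
        simpa using norm_add_le (u - S.mean u • S.one) (S.mean u • S.one)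
      have h5 : ‖u - S.mean u • S.one‖ ^ 2 ≤ (C * ‖G‖) ^ 2 :=
        pow_le_pow_left₀ (norm_nonneg _) h1 2
      rw [← h2]
      nlinarith [sq_nonneg (‖u - S.mean u • S.one‖ - ‖S.mean u • S.one‖), norm_nonneg u,
        norm_nonneg (u - S.mean u • S.one), norm_nonneg (S.mean u • S.one)]
    have h6 : ‖p‖ ^ 2 = ‖u‖ ^ 2 + ‖G‖ ^ 2 := by
      rw [← real_inner_self_eq_norm_sq, sobolev_inner, real_inner_self_eq_norm_sq,
        real_inner_self_eq_norm_sq]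
    rw [mul_assoc, ← sq, inv_mul_le_iff₀ (by positivity), hB, real_inner_self_eq_norm_sq, h6, ← sq]
    have h7 : ⟪u, S.one⟫_ℝ ^ 2 / S.vol = 1 / S.vol * ⟪u, S.one⟫_ℝ ^ 2 := by ring
    have h8 : 0 ≤ 2 * C ^ 2 * ⟪u, S.one⟫_ℝ ^ 2 := by positivity
    have h9 : 0 ≤ 2 / S.vol * ‖G‖ ^ 2 := by positivity
    have h10 : 2 / S.vol * ⟪u, S.one⟫_ℝ ^ 2 = 2 * (1 / S.vol * ⟪u, S.one⟫_ℝ ^ 2) := by ring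
    rw [h7] at h3
    nlinarith [sq_nonneg ⟪u, S.one⟫_ℝ]
  set p := hcoer.continuousLinearEquivOfBilin.symm (ContinuousLinearMap.adjoint S.sobolevVal z)
    with hp
  have hpq : ∀ q, ⟪S.sobolevGrad p, S.sobolevGrad q⟫_ℝ +
      ⟪S.sobolevVal p, S.one⟫_ℝ * ⟪S.sobolevVal q, S.one⟫_ℝ = ⟪z, S.sobolevVal q⟫_ℝ := fun q => by
    rw [← hB, ← hcoer.continuousLinearEquivOfBilin_apply, hp,
      ContinuousLinearEquiv.apply_symm_apply, ContinuousLinearMap.adjoint_inner_left]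
  obtain ⟨q₁, h1, h2⟩ := exists_sobolev S.hasGrad_one
  have h3 := hpq q₁
  rw [h1, h2, hz, inner_zero_right, zero_add, real_inner_self_eq_norm_sq, norm_one_sq] at h3
  have h4 := (mul_eq_zero.1 h3).resolve_right hv.ne'
  refine ⟨S.sobolevVal p, (sobolev_hasGrad p).hasLap fun v H hv => ?_⟩
  obtain ⟨q, rfl, rfl⟩ := exists_sobolev hv
  rw [← zero_add ⟪S.sobolevGrad p, _⟫_ℝ, inner_neg_left, neg_neg, ← hpq q, h4]
  ring

end Setting

end PFC

namespace PFC

open Filter Topology Metric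

/-! ### The matrices of the scheme -/

variable {s : ℕ}

theorem symPart_diag (M : Matrix (Fin s) (Fin s) ℝ) (i : Fin s) : symPart M i i = M i i := by
  simp [symPart]; ring

theorem lowerOnes_symm (i j : Fin s) :
    lowerOnes s i j + lowerOnes s j i = 1 + (1 : Matrix (Fin s) (Fin s) ℝ) i j := by
  rcases lt_trichotomy i j with h | h | h
  · simp [lowerOnes, h.le, h.not_ge, h.ne]
  · subst h; simp [lowerOnes]
  · simp [lowerOnes, h.le, h.not_ge, h.ne']

/-- The smallest eigenvalue of a positive definite matrix is positive, and bounds it from below. -/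
theorem lambdaMin_pos {M : Matrix (Fin s) (Fin s) ℝ} (hs : 0 < s) (hM : M.PosDef) :
    0 < lambdaMin M ∧ (M - lambdaMin M • (1 : Matrix (Fin s) (Fin s) ℝ)).PosSemidef := by
  have : Nonempty (Fin s) := ⟨⟨0, hs⟩⟩
  have hsp := hM.1.spectrum_real_eq_range_eigenvalues
  obtain ⟨m, hm⟩ := Finite.exists_min hM.1.eigenvalues
  have hmin : IsLeast (spectrum ℝ M) (hM.1.eigenvalues m) := by
    rw [hsp]
    exact ⟨mem_range_self m, by rintro _ ⟨i, rfl⟩; exact hm i⟩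
  have hl : lambdaMin M = hM.1.eigenvalues m := hmin.csInf_eq
  refine ⟨hl ▸ hM.eigenvalues_pos m, ?_⟩
  rw [Matrix.posSemidef_iff_isHermitian_and_spectrum_nonneg]
  refine ⟨hM.1.sub ?_, fun x hx => ?_⟩
  · rw [Matrix.IsHermitian, Matrix.conjTranspose_smul]; simp
  · have h2 : x + lambdaMin M ∈ spectrum ℝ M := by
      rw [spectrum.add_mem_iff, neg_add_eq_sub, Algebra.algebraMap_eq_smul_one]
      exact hx
    have := hmin.2 h2
    rw [hl] at this
    change 0 ≤ x
    linarith

theorem posSemidef_smul_sub {M : Matrix (Fin s) (Fin s) ℝ} (hs : 0 < s) (hM : M.PosDef) {c t : ℝ}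
    (hc : 0 ≤ c) (ht : t ≤ c * lambdaMin M) :
    (c • M - t • (1 : Matrix (Fin s) (Fin s) ℝ)).PosSemidef := by
  have h := ((lambdaMin_pos hs hM).2.smul hc).add
    ((Matrix.PosSemidef.one (n := Fin s) (R := ℝ)).smul (sub_nonneg.2 ht))
  convert h using 1
  rw [smul_sub, smul_smul, sub_smul]; abel

theorem posDef_smul_sub {M : Matrix (Fin s) (Fin s) ℝ} (hs : 0 < s) (hM : M.PosDef) {c t : ℝ}
    (hc : 0 ≤ c) (ht : t < c * lambdaMin M) :
    (c • M - t • (1 : Matrix (Fin s) (Fin s) ℝ)).PosDef := by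
  have h := Matrix.PosDef.posSemidef_add ((lambdaMin_pos hs hM).2.smul hc)
    ((Matrix.PosDef.one (n := Fin s) (R := ℝ)).smul (sub_pos.2 ht))
  convert h using 1
  rw [smul_sub, smul_smul, sub_smul]; abel

/-- A positive semidefinite form in vector-valued arguments. -/
theorem sum_mul_inner_nonneg {E : Type*} [NormedAddCommGroup E] [InnerProductSpace ℝ E]
    {M : Matrix (Fin s) (Fin s) ℝ} (hM : (symPart M).PosSemidef) (x : Fin s → E) :
    0 ≤ ∑ i, ∑ j, M i j * ⟪x j, x i⟫_ℝ := by
  have h1 := (hM.hadamard (Matrix.posSemidef_gram ℝ x)).dotProduct_mulVec_nonneg (fun _ => 1)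
  have h2 : ∑ i, ∑ j, M j i * ⟪x j, x i⟫_ℝ = ∑ i, ∑ j, M i j * ⟪x j, x i⟫_ℝ := by
    rw [Finset.sum_comm]
    exact Finset.sum_congr rfl fun i _ => Finset.sum_congr rfl fun j _ => by rw [real_inner_comm]
  have h3 : star (fun _ : Fin s => (1 : ℝ)) ⬝ᵥ
      (((symPart M).hadamard (Matrix.gram ℝ x)).mulVec fun _ => 1) =
      ∑ i, ∑ j, 1 / 2 * (M i j * ⟪x j, x i⟫_ℝ + M j i * ⟪x j, x i⟫_ℝ) := by
    simp only [dotProduct, Matrix.mulVec, Pi.star_apply, star_one, one_mul, mul_one]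
    refine Finset.sum_congr rfl fun i _ => Finset.sum_congr rfl fun j _ => ?_
    simp only [Matrix.hadamard_apply, symPart, Matrix.smul_apply, Matrix.add_apply,
      Matrix.transpose_apply, Matrix.gram_apply, smul_eq_mul, real_inner_comm (x j) (x i)]
    ring
  rw [h3] at h1
  simp only [← Finset.mul_sum, Finset.sum_add_distrib] at h1
  rw [h2] at h1
  linarith

theorem lowerTriangular_mul_diag {M N : Matrix (Fin s) (Fin s) ℝ} (hM : ∀ i j, i < j → M i j = 0)
    (hN : ∀ i j, i < j → N i j = 0) (i : Fin s) : (M * N) i i = M i i * N i i := by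
  rw [Matrix.mul_apply]
  refine Finset.sum_eq_single i (fun j _ hj => ?_) (by simp)
  rcases hj.lt_or_gt with h | h
  · rw [hN j i h, mul_zero]
  · rw [hM i j h, zero_mul]

theorem lowerTriangular_mul {M N : Matrix (Fin s) (Fin s) ℝ} (hM : ∀ i j, i < j → M i j = 0)
    (hN : ∀ i j, i < j → N i j = 0) (i j : Fin s) (hij : i < j) : (M * N) i j = 0 := by
  rw [Matrix.mul_apply]
  refine Finset.sum_eq_zero fun k _ => ?_
  rcases lt_or_ge i k with h | h
  · rw [hM i k h, zero_mul]
  · rw [hN k j (h.trans_lt hij), mul_zero]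

theorem lowerOnes_lower (i j : Fin s) (hij : i < j) : lowerOnes s i j = 0 := by
  simp [lowerOnes, hij.not_ge]

namespace IMEXTable

variable (B : IMEXTable s)

theorem isUnit_det : IsUnit B.Ahat.det := (Matrix.isUnit_iff_isUnit_det _).1 B.Ahat_inv

theorem inv_lower (i j : Fin s) (hij : i < j) : B.Ahat⁻¹ i j = 0 := by
  have := B.isUnit_det
  have : Invertible B.Ahat := B.Ahat_inv.invertible
  exact Matrix.blockTriangular_inv_of_blockTriangular (b := OrderDual.toDual)
    (fun i j h => B.Ahat_lower i j h) hij

theorem invMul_lower (i j : Fin s) (hij : i < j) : (B.Ahat⁻¹ * B.A) i j = 0 :=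
  lowerTriangular_mul B.inv_lower B.A_lower i j hij

theorem H0_lower (i j : Fin s) (hij : i < j) : B.H0 i j = 0 :=
  lowerTriangular_mul B.inv_lower lowerOnes_lower i j hij

theorem Q_eq : B.Q = B.Ahat⁻¹ * B.A * lowerOnes s - lowerOnes s + 1 := by
  rw [Q, sub_mul, one_mul]

theorem Q_lower (i j : Fin s) (hij : i < j) : B.Q i j = 0 := by
  rw [Q_eq, Matrix.add_apply, Matrix.sub_apply,
    lowerTriangular_mul B.invMul_lower lowerOnes_lower i j hij, lowerOnes_lower i j hij,
    Matrix.one_apply_ne hij.ne]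
  simp

/-- The implicit part of every stage has a positive coefficient, because the diagonal entries of the
lower triangular matrices `H0` and `Q` are `1 / â_ii` and `a_ii / â_ii`. -/
theorem A_diag_pos (hQ : (symPart B.Q).PosDef) (hH : (symPart B.H0).PosDef) (i : Fin s) :
    0 < B.A i i := by
  have h1 : 0 < B.H0 i i := symPart_diag B.H0 i ▸ hH.diag_pos
  have h2 : 0 < B.Q i i := symPart_diag B.Q i ▸ hQ.diag_pos
  have e : lowerOnes s i i = 1 := by simp [lowerOnes]
  rw [H0, lowerTriangular_mul_diag B.inv_lower lowerOnes_lower, e, mul_one] at h1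
  rw [Q_eq, Matrix.add_apply, Matrix.sub_apply,
    lowerTriangular_mul_diag B.invMul_lower lowerOnes_lower, e,
    lowerTriangular_mul_diag B.inv_lower B.A_lower, Matrix.one_apply_eq, mul_one,
    sub_add_cancel] at h2
  exact (mul_pos_iff_of_pos_left h1).1 h2

theorem symPart_H1 (L β : ℝ) :
    symPart (B.H1 L β) = β • symPart B.Q - (L / 2) • (1 : Matrix (Fin s) (Fin s) ℝ) := by
  ext i j
  simp only [symPart, H1, Matrix.smul_apply, Matrix.add_apply, Matrix.sub_apply,
    Matrix.transpose_apply, smul_eq_mul, Matrix.one_apply, eq_comm (a := j)]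
  ring

/-- Since `Â⁻¹ A E_L = Q + E_L - I` and the symmetric part of `E_L` is `(E + I) / 2`, the matrix of ones
cancels. -/
theorem symPart_H2 (α : ℝ) :
    symPart (B.H2 α) = (α + 1) • symPart B.Q - (1 / 2 : ℝ) • (1 : Matrix (Fin s) (Fin s) ℝ) := by
  have h : B.Ahat⁻¹ * B.A * lowerOnes s = B.Q + lowerOnes s - 1 := by rw [Q_eq]; abel
  ext i j
  have e := lowerOnes_symm i j
  simp only [symPart, H2, h, Matrix.smul_apply, Matrix.add_apply, Matrix.sub_apply,
    Matrix.transpose_apply, smul_eq_mul, onesMat, Matrix.of_apply]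
  rw [Matrix.one_apply] at *
  simp only [Matrix.one_apply, eq_comm (a := j)] at *
  linear_combination (1 / 2) * e

theorem posSemidef_H1 (hs : 0 < s) (hQ : (symPart B.Q).PosDef) {L β : ℝ} (hL : 0 ≤ L)
    (hβ : L / (2 * lambdaMin (symPart B.Q)) ≤ β) : (symPart (B.H1 L β)).PosSemidef := by
  have hl := (lambdaMin_pos hs hQ).1
  rw [symPart_H1]
  refine posSemidef_smul_sub hs hQ ((by positivity : (0 : ℝ) ≤ _).trans hβ) ?_
  rw [div_le_iff₀ (by positivity)] at hβ
  linarith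

theorem posDef_H1 (hs : 0 < s) (hQ : (symPart B.Q).PosDef) {L β : ℝ} (hL : 0 ≤ L)
    (hβ : L / (2 * lambdaMin (symPart B.Q)) < β) : (symPart (B.H1 L β)).PosDef := by
  have hl := (lambdaMin_pos hs hQ).1
  rw [symPart_H1]
  refine posDef_smul_sub hs hQ ((by positivity : (0 : ℝ) ≤ _).trans hβ.le) ?_
  rw [div_lt_iff₀ (by positivity)] at hβ
  linarith

theorem one_add_pos (hs : 0 < s) (hQ : (symPart B.Q).PosDef) {α : ℝ}
    (hα : 1 / (2 * lambdaMin (symPart B.Q)) - 1 ≤ α) : 0 < 1 + α := by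
  have hl := (lambdaMin_pos hs hQ).1
  have : 0 < 1 / (2 * lambdaMin (symPart B.Q)) := by positivity
  linarith

theorem posSemidef_H2 (hs : 0 < s) (hQ : (symPart B.Q).PosDef) {α : ℝ}
    (hα : 1 / (2 * lambdaMin (symPart B.Q)) - 1 ≤ α) : (symPart (B.H2 α)).PosSemidef := by
  have hl := (lambdaMin_pos hs hQ).1
  have h1 := B.one_add_pos hs hQ hα
  rw [symPart_H2]
  refine posSemidef_smul_sub hs hQ (by linarith) ?_
  have := (div_le_iff₀ (by positivity)).1 (sub_le_iff_le_add.1 hα)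
  linarith

theorem posDef_H2 (hs : 0 < s) (hQ : (symPart B.Q).PosDef) {α : ℝ}
    (hα : 1 / (2 * lambdaMin (symPart B.Q)) - 1 < α) : (symPart (B.H2 α)).PosDef := by
  have hl := (lambdaMin_pos hs hQ).1
  have h1 := B.one_add_pos hs hQ hα.le
  rw [symPart_H2]
  refine posDef_smul_sub hs hQ (by linarith) ?_
  have := (div_lt_iff₀ (by positivity)).1 (sub_lt_iff_lt_add.1 hα)
  linarith

open Matrix in
/-- This is the equality of the row sums of the two tables. -/
theorem invMul_mulVec_one : (B.Ahat⁻¹ * B.A) *ᵥ (1 : Fin s → ℝ) = 1 := by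
  have h : B.A *ᵥ (1 : Fin s → ℝ) = B.Ahat *ᵥ 1 := by
    ext i
    rw [mulVec, dotProduct_one, mulVec, dotProduct_one, B.A_row, B.Ahat_row, B.c_eq]
  rw [← mulVec_mulVec, h, mulVec_mulVec, nonsing_inv_mul _ B.isUnit_det, one_mulVec]

open Matrix in
/-- The stage equations of the scheme, solved for the increments between consecutive stages: `d`
stands for the increments, `p`, `q` for the two linear parts of the increments, `p₀`, `q₀` for the
linear parts of the initial value, and `g` for the nonlinear part. -/
theorem stage_increments {α β τ p₀ q₀ : ℝ} {d p q g : Fin s → ℝ}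
    (h : lowerOnes s *ᵥ d = τ • (B.A *ᵥ ((1 + α) • (p₀ • 1 + lowerOnes s *ᵥ p) +
        β • (q₀ • 1 + lowerOnes s *ᵥ q)) +
      B.Ahat *ᵥ (g - α • (p₀ • 1 + lowerOnes s *ᵥ p - p) -
        β • (q₀ • 1 + lowerOnes s *ᵥ q - q)))) :
    B.H0 *ᵥ d = τ • (p₀ • 1 + (α • B.Q + B.Ahat⁻¹ * B.A * lowerOnes s) *ᵥ p +
      β • B.Q *ᵥ q + g) := by
  have h1 := congrArg (fun x => B.Ahat⁻¹ *ᵥ x) h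
  simp only [mulVec_mulVec, mulVec_smul, mulVec_add, nonsing_inv_mul _ B.isUnit_det, one_mulVec,
    invMul_mulVec_one] at h1
  rw [H0, h1]
  simp only [Q_eq, Matrix.mul_assoc, add_mulVec, smul_mulVec, sub_mulVec, one_mulVec, smul_add,
    smul_sub]
  module

end IMEXTable

end PFC

namespace PFC

open Filter Topology Metric

variable {d : ℕ}

/-! ### Solvability of the scheme -/

namespace Setting

variable {S : Setting d}

theorem norm_resolvent_le (z : S.L2) : ‖S.resolvent z‖ ≤ ‖z‖ := by
  have h := (norm_resolvent_sq_le z).trans (real_inner_le_norm _ _)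
  rcases (norm_nonneg (S.resolvent z)).eq_or_lt with h0 | h0
  · rw [← h0]; exact norm_nonneg z
  · rw [sq] at h
    exact le_of_mul_le_mul_left h h0

/-- The test functions of the scheme are the functions in the range of the square of the
resolvent. -/
theorem forall_test_iff {P : S.L2 → Prop} :
    (∀ v, S.InDom v → S.InDom (S.lap v) → P v) ↔ ∀ z, P (S.resolvent (S.resolvent z)) := by
  constructor
  · intro h z
    refine h _ ⟨_, hasLap_resolvent _⟩ ?_
    rw [lap_resolvent]
    exact ⟨_, (hasLap_resolvent _).sub (hasLap_resolvent _)⟩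
  · intro h v h1 h2
    have h3 : S.HasLap (v - S.lap v) _ := h1.hasLap.sub h2.hasLap
    have h4 := h (v - S.lap v - (S.lap v - S.lap (S.lap v)))
    rwa [h3.resolvent_eq, h1.hasLap.resolvent_eq] at h4

theorem lap_lap_resolvent (z : S.L2) : S.lap (S.resolvent (S.resolvent z) - S.resolvent z) =
    S.resolvent (S.resolvent z) - S.resolvent z - (S.resolvent z - z) :=
  ((hasLap_resolvent _).sub (hasLap_resolvent _)).lap_eq

/-- A functional on the test functions of the scheme that is bounded with respect to the norm of
`(I - Δ)² v`. -/
def IsTestFunctional (S : Setting d) (ℓ : S.L2 → ℝ) : Prop :=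
  ∃ f : S.L2, ∀ z, ℓ (S.resolvent (S.resolvent z)) = ⟪f, z⟫_ℝ

theorem IsTestFunctional.add {ℓ ℓ' : S.L2 → ℝ} (h : S.IsTestFunctional ℓ)
    (h' : S.IsTestFunctional ℓ') : S.IsTestFunctional fun v => ℓ v + ℓ' v := by
  obtain ⟨f, hf⟩ := h
  obtain ⟨f', hf'⟩ := h'
  exact ⟨f + f', fun z => by beta_reduce; rw [hf, hf', inner_add_left]⟩

theorem IsTestFunctional.const_mul {ℓ : S.L2 → ℝ} (c : ℝ) (h : S.IsTestFunctional ℓ) :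
    S.IsTestFunctional fun v => c * ℓ v := by
  obtain ⟨f, hf⟩ := h
  exact ⟨c • f, fun z => by beta_reduce; rw [hf, inner_smul_left]; rfl⟩

theorem IsTestFunctional.sum {ι : Type*} (t : Finset ι) {ℓ : ι → S.L2 → ℝ}
    (h : ∀ i, S.IsTestFunctional (ℓ i)) : S.IsTestFunctional fun v => ∑ i ∈ t, ℓ i v := by
  choose f hf using h
  exact ⟨∑ i ∈ t, f i, fun z => by simp only [hf, sum_inner]⟩

theorem isTestFunctional_inner (p : S.L2) : S.IsTestFunctional fun v => ⟪p, v⟫_ℝ :=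
  ⟨S.resolvent (S.resolvent p), fun z => by rw [inner_resolvent_comm, inner_resolvent_comm]⟩

theorem isTestFunctional_inner_lap (p : S.L2) : S.IsTestFunctional fun v => ⟪p, S.lap v⟫_ℝ :=
  ⟨S.resolvent (S.resolvent p) - S.resolvent p, fun z => by
    simp only [lap_resolvent, inner_sub_right, inner_sub_left, inner_resolvent_comm]⟩

theorem isTestFunctional_formP (a : ℝ) (u : S.L2) :
    S.IsTestFunctional fun v => S.formP a u (S.lap v) := by
  have h : S.IsTestFunctional fun v => ⟪S.lap u + u, S.lap (S.lap v) + S.lap v⟫_ℝ := by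
    set p := S.lap u + u
    refine ⟨2 • S.resolvent (S.resolvent p) - 3 • S.resolvent p + p, fun z => ?_⟩
    simp only [lap_resolvent, lap_lap_resolvent, inner_add_right, inner_add_left, inner_sub_right,
      inner_sub_left,
      succ_nsmul, inner_resolvent_comm, zero_smul, inner_zero_left]
    ring
  exact h.add ((isTestFunctional_inner_lap u).const_mul a)

theorem isTestFunctional_pairLin (a α β : ℝ) (u : S.L2) :
    S.IsTestFunctional (S.pairLin a α β u) :=
  ((isTestFunctional_formP a u).const_mul _).add ((isTestFunctional_inner_lap u).const_mul _)

theorem isTestFunctional_pairNonlin (a α β : ℝ) {g : ℝ → ℝ} {u : S.L2}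
    (hg : MemLp (fun x => g (u x)) 2 S.mu) : S.IsTestFunctional (S.pairNonlin a α β g u) := by
  have h : S.IsTestFunctional fun v => ∫ x, g (u x) * (S.lap v) x ∂S.mu := by
    obtain ⟨f, hf⟩ := isTestFunctional_inner_lap (hg.toLp _)
    refine ⟨f, fun z => ?_⟩
    rw [← hf]
    beta_reduce
    rw [inner_toLp]
    simp only [mul_comm]
  have h' := (((h.const_mul (-1)).add ((isTestFunctional_formP a u).const_mul α)).add
    ((isTestFunctional_inner_lap u).const_mul β)).const_mul (-1)
  refine (congrArg S.IsTestFunctional ?_).mp h'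
  ext v
  rw [pairNonlin]; ring

/-- The stage equation in terms of the resolvent `R`: with `u = R w` and `v = R² z` it becomes an
equation for `w` with a bounded and coercive form, a polynomial in `R`, to which the Lax–Milgram
theorem applies. -/
theorem existsUnique_resolvent {a α β c : ℝ} (ha : 0 ≤ a) (hα : 0 < 1 + α) (hβ : 0 ≤ β)
    (hc : 0 < c) (f : S.L2) : ∃! w, ∀ z, ⟪S.resolvent w, S.resolvent (S.resolvent z)⟫_ℝ -
      c * S.pairLin a α β (S.resolvent w) (S.resolvent (S.resolvent z)) = ⟪f, z⟫_ℝ := by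
  set R := S.resolvent with hR
  -- `Δ R = R - I`, `(I + Δ) R = 2 R - I`
  let T : S.L2 →L[ℝ] S.L2 := R * R * R + c • ((1 + α) • ((1 - R) * (R + R - 1) * (R + R - 1) +
    a • ((1 - R) * R * R)) + β • ((1 - R) * R * R))
  let B : S.L2 →L[ℝ] S.L2 →L[ℝ] ℝ := (innerSL ℝ).comp T
  have hlhs : ∀ w z, ⟪R w, R (R z)⟫_ℝ - c * S.pairLin a α β (R w) (R (R z)) =
      ⟪R w, R (R z)⟫_ℝ + c * ((1 + α) * (⟪R w + R w - w, (R z + R z - z) - R (R z + R z - z)⟫_ℝ +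
        a * ⟪R w, R z - R (R z)⟫_ℝ) + β * ⟪R w, R z - R (R z)⟫_ℝ) := fun w z => by
    simp only [pairLin, formP, hR, lap_resolvent, lap_lap_resolvent, inner_add_right,
      inner_add_left, inner_sub_right, inner_sub_left, map_add, map_sub]
    ring
  have hB : ∀ w z, B w z = ⟪R w, R (R z)⟫_ℝ - c * S.pairLin a α β (R w) (R (R z)) := fun w z => by
    rw [hlhs]
    change ⟪T w, z⟫_ℝ = _
    simp only [T, add_apply, sub_apply, smul_apply, mul_apply_eq_comp,
      one_apply_eq_self, map_add, map_sub, inner_add_left, inner_add_right,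
      inner_sub_left, inner_sub_right, inner_smul_left, hR, inner_resolvent_comm, conj_trivial]
    ring
  have hcoer : IsCoercive B := by
    set k := min 1 (c * (1 + α)) with hk
    have hk0 : 0 < k := lt_min one_pos (by positivity)
    refine ⟨k / 338, by positivity, fun z => ?_⟩
    set y := R z + R z - z with hy
    set x := y - R y with hx
    set p := R (R z) with hp
    have h1 : ‖p‖ ^ 2 ≤ ⟪R z, p⟫_ℝ := by
      rw [real_inner_comm]; exact norm_resolvent_sq_le (R z)
    have h2 : ‖x‖ ^ 2 ≤ ⟪y, x⟫_ℝ := by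
      rw [real_inner_comm]; exact norm_sub_resolvent_sq_le y
    have h3 : 0 ≤ ⟪R z, R z - p⟫_ℝ := by
      rw [real_inner_comm]; exact (sq_nonneg _).trans (norm_sub_resolvent_sq_le (R z))
    -- the Bézout identity `1 = (7 - 6 r) r² + (1 + 3 r) (1 - r) (1 - 2 r)`
    have h4 : z = (7 : ℝ) • p - (6 : ℝ) • R p - (x + (3 : ℝ) • R x) := by
      simp only [hx, hy, hp, map_add, map_sub]
      module
    have h5 : ‖z‖ ≤ 13 * ‖p‖ + 4 * ‖x‖ := by
      have e1 : ‖R p‖ ≤ ‖p‖ := norm_resolvent_le p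
      have e2 : ‖R x‖ ≤ ‖x‖ := norm_resolvent_le x
      calc ‖z‖ ≤ ‖(7 : ℝ) • p‖ + ‖(6 : ℝ) • R p‖ + (‖x‖ + ‖(3 : ℝ) • R x‖) := by
            conv_lhs => rw [h4]
            exact (norm_sub_le _ _).trans (add_le_add (norm_sub_le _ _) (norm_add_le _ _))
        _ = 7 * ‖p‖ + 6 * ‖R p‖ + (‖x‖ + 3 * ‖R x‖) := by simp [norm_smul]
        _ ≤ _ := by linarith
    have h6 : ‖z‖ ^ 2 ≤ 338 * (‖p‖ ^ 2 + ‖x‖ ^ 2) := by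
      have := pow_le_pow_left₀ (norm_nonneg z) h5 2
      nlinarith [sq_nonneg (13 * ‖p‖ - 4 * ‖x‖), sq_nonneg ‖x‖]
    have h7 : k * (‖p‖ ^ 2 + ‖x‖ ^ 2) ≤ B z z := by
      rw [hB, hlhs]
      have e1 : k * ‖p‖ ^ 2 ≤ 1 * ‖p‖ ^ 2 :=
        mul_le_mul_of_nonneg_right (min_le_left _ _) (sq_nonneg _)
      have e2 : k * ‖x‖ ^ 2 ≤ c * (1 + α) * ‖x‖ ^ 2 :=
        mul_le_mul_of_nonneg_right (min_le_right _ _) (sq_nonneg _)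
      have e3 : c * (1 + α) * ‖x‖ ^ 2 ≤ c * (1 + α) * ⟪y, x⟫_ℝ :=
        mul_le_mul_of_nonneg_left h2 (by positivity)
      have e4 : 0 ≤ c * ((1 + α) * (a * ⟪R z, R z - p⟫_ℝ)) := by positivity
      have e5 : 0 ≤ c * (β * ⟪R z, R z - p⟫_ℝ) := by positivity
      linarith
    calc k / 338 * ‖z‖ * ‖z‖ = k / 338 * ‖z‖ ^ 2 := by ring
      _ ≤ k / 338 * (338 * (‖p‖ ^ 2 + ‖x‖ ^ 2)) := by gcongr
      _ = k * (‖p‖ ^ 2 + ‖x‖ ^ 2) := by ring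
      _ ≤ _ := h7
  refine ⟨hcoer.continuousLinearEquivOfBilin.symm f, fun z => ?_, fun w hw => ?_⟩
  · rw [← hB, ← hcoer.continuousLinearEquivOfBilin_apply,
      ContinuousLinearEquiv.apply_symm_apply]
  · rw [ContinuousLinearEquiv.eq_symm_apply]
    refine (hcoer.unique_continuousLinearEquivOfBilin fun z => ?_).symm
    rw [hB, hw]

/-- A stage of the scheme, with the explicit terms collected in `ℓ`, is uniquely solvable. -/
theorem existsUnique_stage {a α β c : ℝ} (ha : 0 ≤ a) (hα : 0 < 1 + α) (hβ : 0 ≤ β) (hc : 0 < c)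
    {ℓ : S.L2 → ℝ} (hℓ : S.IsTestFunctional ℓ) : ∃! u, S.InDom u ∧ ∀ v, S.InDom v →
      S.InDom (S.lap v) → ⟪u, v⟫_ℝ - c * S.pairLin a α β u v = ℓ v := by
  obtain ⟨f, hf⟩ := hℓ
  obtain ⟨w, hw, hw'⟩ := S.existsUnique_resolvent ha hα hβ hc f
  refine ⟨S.resolvent w, ⟨⟨_, hasLap_resolvent w⟩, forall_test_iff.2 fun z => ?_⟩, ?_⟩
  · rw [hw, hf]
  · rintro u ⟨hu, h⟩
    rw [← hu.hasLap.resolvent_eq]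
    refine congrArg S.resolvent (hw' _ fun z => ?_)
    rw [hu.hasLap.resolvent_eq, ← hf]
    exact forall_test_iff.1 h z

/-- Uniqueness for a stage. The explicit terms cancel, so nothing has to be known about the
nonlinearity; this makes it applicable to the original scheme as well. -/
theorem stage_unique {a α β c : ℝ} (ha : 0 ≤ a) (hα : 0 < 1 + α) (hβ : 0 ≤ β) (hc : 0 < c)
    {u u' : S.L2} (hu : S.InDom u) (hu' : S.InDom u')
    (h : ∀ v, S.InDom v → S.InDom (S.lap v) → ⟪u, v⟫_ℝ - c * S.pairLin a α β u v =
      ⟪u', v⟫_ℝ - c * S.pairLin a α β u' v) : u = u' := by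
  have hℓ : S.IsTestFunctional fun v => ⟪u', v⟫_ℝ + -c * S.pairLin a α β u' v :=
    (isTestFunctional_inner u').add ((isTestFunctional_pairLin a α β u').const_mul _)
  refine (existsUnique_stage ha hα hβ hc hℓ).unique ⟨hu, fun v h1 h2 => ?_⟩
    ⟨hu', fun v h1 h2 => ?_⟩
  · rw [h v h1 h2]; ring
  · ring

variable {s : ℕ}

/-- The equation for stage `i + 1` in a single step `U` of the scheme. -/
def StageEq (S : Setting d) (B : IMEXTable s) (a α β : ℝ) (g : ℝ → ℝ) (τ : ℝ)
    (U : Fin (s + 1) → S.L2) (i : Fin s) : Prop :=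
  ∀ v : S.L2, S.InDom v → S.InDom (S.lap v) →
    ⟪U i.succ, v⟫_ℝ = ⟪U 0, v⟫_ℝ +
      τ * (∑ j ∈ Finset.Iic i, B.A i j * S.pairLin a α β (U j.succ) v +
        ∑ j ∈ Finset.Iic i, B.Ahat i j * S.pairNonlin a α β g (U j.castSucc) v)

/-- The explicit part of a stage equation. -/
def stageRhs (S : Setting d) (B : IMEXTable s) (a α β : ℝ) (g : ℝ → ℝ) (τ : ℝ)
    (U : Fin (s + 1) → S.L2) (i : Fin s) (v : S.L2) : ℝ :=
  ⟪U 0, v⟫_ℝ + τ * (∑ j ∈ Finset.Iio i, B.A i j * S.pairLin a α β (U j.succ) v +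
    ∑ j ∈ Finset.Iic i, B.Ahat i j * S.pairNonlin a α β g (U j.castSucc) v)

theorem stageEq_iff {B : IMEXTable s} {a α β : ℝ} {g : ℝ → ℝ} {τ : ℝ} {U : Fin (s + 1) → S.L2}
    {i : Fin s} : S.StageEq B a α β g τ U i ↔ ∀ v, S.InDom v → S.InDom (S.lap v) →
      ⟪U i.succ, v⟫_ℝ - τ * B.A i i * S.pairLin a α β (U i.succ) v =
        S.stageRhs B a α β g τ U i v := by
  refine forall_congr' fun v => imp_congr_right fun _ => imp_congr_right fun _ => ?_
  rw [stageRhs, ← Finset.Iio_insert i, Finset.sum_insert (by simp)]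
  constructor <;> intro h <;> linarith

theorem stageRhs_congr {B : IMEXTable s} {a α β : ℝ} {g : ℝ → ℝ} {τ : ℝ}
    {U U' : Fin (s + 1) → S.L2} {i : Fin s} (h : ∀ j ≤ i.castSucc, U j = U' j) :
    S.stageRhs B a α β g τ U i = S.stageRhs B a α β g τ U' i := by
  ext v
  rw [stageRhs, stageRhs, h 0 (Fin.zero_le _)]
  congr 3
  · refine Finset.sum_congr rfl fun j hj => ?_
    rw [h j.succ (Fin.succ_le_castSucc_iff.2 (Finset.mem_Iio.1 hj))]
  · refine Finset.sum_congr rfl fun j hj => ?_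
    rw [h j.castSucc (Fin.castSucc_le_castSucc_iff.2 (Finset.mem_Iic.1 hj))]

theorem isTestFunctional_stageRhs (B : IMEXTable s) (a α β : ℝ) {g : ℝ → ℝ} (τ : ℝ)
    (hg : ∀ u : S.L2, MemLp (fun x => g (u x)) 2 S.mu) (U : Fin (s + 1) → S.L2) (i : Fin s) :
    S.IsTestFunctional (S.stageRhs B a α β g τ U i) :=
  (isTestFunctional_inner _).add (((IsTestFunctional.sum _ fun _ =>
    (isTestFunctional_pairLin _ _ _ _).const_mul _).add (IsTestFunctional.sum _ fun _ =>
      (isTestFunctional_pairNonlin _ _ _ (hg _)).const_mul _)).const_mul τ)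

/-- Existence for a single step. -/
theorem exists_step {B : IMEXTable s} {a α β : ℝ} {g : ℝ → ℝ} {τ : ℝ} (ha : 0 ≤ a)
    (hα : 0 < 1 + α) (hβ : 0 ≤ β) (hτ : 0 < τ) (hB : ∀ i, 0 < B.A i i)
    (hg : ∀ u : S.L2, MemLp (fun x => g (u x)) 2 S.mu) {u₀ : S.L2} (hu₀ : S.InDom u₀) :
    ∃ U : Fin (s + 1) → S.L2, U 0 = u₀ ∧ (∀ i, S.InDom (U i)) ∧
      ∀ i, S.StageEq B a α β g τ U i := by
  have key : ∀ k ≤ s, ∃ U : Fin (s + 1) → S.L2, U 0 = u₀ ∧ (∀ i, S.InDom (U i)) ∧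
      ∀ i : Fin s, (i : ℕ) < k → S.StageEq B a α β g τ U i := by
    intro k
    induction k with
    | zero => exact fun _ => ⟨fun _ => u₀, rfl, fun _ => hu₀, fun i hi => absurd hi (by omega)⟩
    | succ k ih =>
      intro hk
      obtain ⟨U, h0, hdom, hst⟩ := ih (by omega)
      let i₀ : Fin s := ⟨k, hk⟩
      obtain ⟨u, ⟨hu, hu'⟩, -⟩ := existsUnique_stage ha hα hβ (mul_pos hτ (hB i₀))
        (isTestFunctional_stageRhs B a α β τ hg U i₀)
      have hlow : ∀ j ≤ i₀.castSucc, Function.update U i₀.succ u j = U j := fun j hj =>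
        Function.update_of_ne (hj.trans_lt Fin.castSucc_lt_succ).ne _ _
      refine ⟨Function.update U i₀.succ u, ?_, fun i => ?_, fun i hi => ?_⟩
      · rw [hlow 0 (Fin.zero_le _), h0]
      · rcases eq_or_ne i i₀.succ with rfl | h
        · rwa [Function.update_self]
        · rw [Function.update_of_ne h]; exact hdom i
      · rw [stageEq_iff]
        rcases eq_or_ne i i₀ with rfl | h
        · rw [Function.update_self, stageRhs_congr hlow]
          exact hu'
        · have hlt : i < i₀ := by
            refine lt_of_le_of_ne ?_ h
            exact Nat.lt_succ_iff.1 hi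
          rw [hlow i.succ (Fin.succ_le_castSucc_iff.2 hlt), stageRhs_congr fun j hj =>
            hlow j (hj.trans (Fin.castSucc_le_castSucc_iff.2 hlt.le))]
          exact stageEq_iff.1 (hst i hlt)
  obtain ⟨U, h0, hdom, hst⟩ := key s le_rfl
  exact ⟨U, h0, hdom, fun i => hst i i.2⟩

/-- Uniqueness for a single step. -/
theorem step_unique {B : IMEXTable s} {a α β : ℝ} {g : ℝ → ℝ} {τ : ℝ} (ha : 0 ≤ a)
    (hα : 0 < 1 + α) (hβ : 0 ≤ β) (hτ : 0 < τ) (hB : ∀ i, 0 < B.A i i)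
    {U U' : Fin (s + 1) → S.L2} (h0 : U 0 = U' 0) (hU : ∀ i, S.InDom (U i))
    (hU' : ∀ i, S.InDom (U' i)) (h : ∀ i, S.StageEq B a α β g τ U i)
    (h' : ∀ i, S.StageEq B a α β g τ U' i) : U = U' := by
  have key : ∀ k : ℕ, ∀ j : Fin (s + 1), (j : ℕ) ≤ k → U j = U' j := by
    intro k
    induction k with
    | zero =>
      intro j hj
      obtain rfl : j = 0 := Fin.ext (by simpa using hj)
      exact h0
    | succ k ih =>
      intro j hj
      rcases Fin.eq_zero_or_eq_succ j with rfl | ⟨i, rfl⟩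
      · exact h0
      · refine stage_unique ha hα hβ (mul_pos hτ (hB i)) (hU _) (hU' _) fun v h1 h2 => ?_
        rw [stageEq_iff.1 (h i) v h1 h2, stageEq_iff.1 (h' i) v h1 h2, stageRhs_congr fun l hl => ?_]
        refine ih l ?_
        have : (l : ℕ) ≤ i := hl
        simp only [Fin.val_succ] at hj
        omega
  exact funext fun j => key s j (Nat.lt_succ_iff.1 j.2)

theorem isSolution_unique {B : IMEXTable s} {a α β : ℝ} {g : ℝ → ℝ} {τ : ℝ} (ha : 0 ≤ a)
    (hα : 0 < 1 + α) (hβ : 0 ≤ β) (hτ : 0 < τ) (hB : ∀ i, 0 < B.A i i) {φ₀ : S.L2} {K : ℕ}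
    {u u' : Fin K → Fin (s + 1) → S.L2} (h : S.IsSolution B a α β g τ φ₀ K u)
    (h' : S.IsSolution B a α β g τ φ₀ K u') : u = u' := by
  have key : ∀ n (hn : n < K), u ⟨n, hn⟩ = u' ⟨n, hn⟩ := by
    intro n
    induction n with
    | zero =>
      intro hn
      exact step_unique ha hα hβ hτ hB ((h.init _ rfl).trans (h'.init _ rfl).symm) (h.inDom _)
        (h'.inDom _) (h.stage _) (h'.stage _)
    | succ n ih =>
      intro hn
      refine step_unique ha hα hβ hτ hB ?_ (h.inDom _) (h'.inDom _) (h.stage _) (h'.stage _)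
      rw [h.next ⟨n, by omega⟩ ⟨n + 1, hn⟩ rfl, h'.next ⟨n, by omega⟩ ⟨n + 1, hn⟩ rfl, ih]
  exact funext fun n => key n n.2

theorem exists_isSolution {B : IMEXTable s} {a α β : ℝ} {g : ℝ → ℝ} {τ : ℝ} (ha : 0 ≤ a)
    (hα : 0 < 1 + α) (hβ : 0 ≤ β) (hτ : 0 < τ) (hB : ∀ i, 0 < B.A i i)
    (hg : ∀ u : S.L2, MemLp (fun x => g (u x)) 2 S.mu) {φ₀ : S.L2} (hφ : S.InDom φ₀) (K : ℕ) :
    ∃ u, S.IsSolution B a α β g τ φ₀ K u := by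
  choose! step h0 hdom hst using fun (u₀ : S.L2) (hu₀ : S.InDom u₀) =>
    exists_step (B := B) ha hα hβ hτ hB hg hu₀
  let seq : ℕ → Fin (s + 1) → S.L2 := fun n =>
    Nat.rec (step φ₀) (fun _ U => step (U (Fin.last s))) n
  have hseq : ∀ n i, S.InDom (seq n i) := by
    intro n
    induction n with
    | zero => exact hdom φ₀ hφ
    | succ n ih => exact hdom _ (ih _)
  refine ⟨fun n => seq n, fun n i => hseq n i, fun n hn => ?_, fun n m hm => ?_, fun n i => ?_⟩
  · simp only [hn]; exact h0 φ₀ hφ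
  · simp only [hm]; exact h0 _ (hseq n _)
  · rcases n with ⟨_ | n, hn⟩
    · exact hst φ₀ hφ i
    · exact hst _ (hseq n _) i

end Setting

end PFC

namespace PFC

open Filter Topology Metric

/-! ### The truncated nonlinearity -/

/-- The quadratic upper bound for a function with Lipschitz continuous derivative. -/
theorem le_add_of_lipschitz_deriv {F f : ℝ → ℝ} {L : ℝ≥0} (hF : ∀ x, HasDerivAt F (f x) x)
    (hf : LipschitzWith L f) (x y : ℝ) : F y ≤ F x + f x * (y - x) + L / 2 * (y - x) ^ 2 := by
  set h : ℝ → ℝ := fun t => F x + f x * (t - x) + L / 2 * (t - x) ^ 2 - F t with hh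
  have hd : ∀ t, HasDerivAt h (f x + L * (t - x) - f t) t := fun t => by
    have h1 : HasDerivAt (fun t => t - x) 1 t := (hasDerivAt_id t).sub_const x
    have h2 := (((h1.const_mul (f x)).const_add (F x)).add
      ((h1.pow 2).const_mul (L / 2 : ℝ))).sub (hF t)
    refine h2.congr_deriv ?_
    push_cast
    ring
  have hlip : ∀ t, |f t - f x| ≤ L * |t - x| := fun t => by
    simpa [Real.dist_eq] using hf.dist_le_mul t x
  have hc : Continuous h := continuous_iff_continuousAt.2 fun t => (hd t).continuousAt
  have hx : h x = 0 := by simp [hh]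
  have hy : 0 ≤ h y := by
    rcases le_total x y with hxy | hxy
    · rw [← hx]
      refine monotoneOn_of_deriv_nonneg (convex_Ici x) hc.continuousOn
        (fun t _ => (hd t).differentiableAt.differentiableWithinAt) (fun t ht => ?_)
        self_mem_Ici hxy hxy
      rw [interior_Ici] at ht
      have h3 := (abs_le.1 (hlip t)).2
      rw [abs_of_pos (sub_pos.2 ht)] at h3
      rw [(hd t).deriv]; linarith
    · rw [← hx]
      refine antitoneOn_of_deriv_nonpos (convex_Iic x) hc.continuousOn
        (fun t _ => (hd t).differentiableAt.differentiableWithinAt) (fun t ht => ?_)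
        hxy self_mem_Iic hxy
      rw [interior_Iic] at ht
      have h3 := (abs_le.1 (hlip t)).1
      rw [abs_of_neg (sub_neg.2 ht)] at h3
      rw [(hd t).deriv]; linarith
  simp only [hh] at hy
  linarith

theorem truncReaction_eq {ε a M x : ℝ} (hx : |x| ≤ M) : truncReaction ε a M x = reaction ε a x := by
  obtain ⟨h1, h2⟩ := abs_le.1 hx
  rw [truncReaction, if_neg h2.not_gt, if_neg h1.not_gt, reaction]

/-- The primitive of the truncated nonlinearity. -/
def truncPotential (ε a M x : ℝ) : ℝ := ∫ t in 0..x, truncReaction ε a M t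

variable {ε a M : ℝ} {L : ℝ≥0}

theorem truncPotential_hasDerivAt (hL : LipschitzWith L (truncReaction ε a M)) (x : ℝ) :
    HasDerivAt (truncPotential ε a M) (truncReaction ε a M x) x :=
  intervalIntegral.integral_hasDerivAt_right (hL.continuous.intervalIntegrable _ _)
    (hL.continuous.stronglyMeasurableAtFilter _ _) hL.continuous.continuousAt

theorem truncPotential_zero : truncPotential ε a M 0 = 0 := by simp [truncPotential]

theorem potential_hasDerivAt (x : ℝ) : HasDerivAt (potential ε a) (reaction ε a x) x := by
  have h := ((hasDerivAt_pow 4 x).div_const 4).sub ((hasDerivAt_pow 2 x).const_mul ((ε + a) / 2))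
  refine h.congr_deriv ?_
  rw [reaction]; push_cast; ring

theorem truncPotential_eq (hM : 0 ≤ M) {x : ℝ} (hx : |x| ≤ M) :
    truncPotential ε a M x = potential ε a x := by
  have h1 : truncPotential ε a M x = ∫ t in 0..x, reaction ε a t := by
    refine intervalIntegral.integral_congr fun t ht => truncReaction_eq ?_
    have h2 : t ∈ uIcc (-M) M := by
      refine uIcc_subset_uIcc ?_ ?_ ht
      · rw [uIcc_of_le (by linarith)]; exact ⟨by linarith, hM⟩
      · rw [uIcc_of_le (by linarith)]; exact abs_le.1 hx
    rw [uIcc_of_le (by linarith)] at h2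
    exact abs_le.2 h2
  have hc : Continuous (reaction ε a) := by unfold reaction; fun_prop
  rw [h1, intervalIntegral.integral_eq_sub_of_hasDerivAt (fun t _ => potential_hasDerivAt t)
    (hc.intervalIntegrable _ _)]
  simp [potential]

theorem potential_lower (hε1 : ε < 1) (x : ℝ) :
    0 ≤ potential ε a x + (a - 1) / 2 * x ^ 2 + 1 := by
  rw [potential]
  nlinarith [sq_nonneg (x ^ 2 / 2 - 1), mul_nonneg (sub_nonneg.2 hε1.le) (sq_nonneg x)]

/-- The truncated potential satisfies the same lower bound as the original one, provided that the
truncation level is not too small. -/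
theorem truncPotential_lower (hε : 0 < ε) (hε1 : ε < 1) (hM : 0 ≤ M) (hM3 : 3 ≤ M ^ 2)
    (hL : LipschitzWith L (truncReaction ε a M)) (x : ℝ) :
    0 ≤ truncPotential ε a M x + (a - 1) / 2 * x ^ 2 + 1 := by
  set G : ℝ → ℝ := fun x => truncPotential ε a M x + (a - 1) / 2 * x ^ 2 + 1 with hG
  have hd : ∀ t, HasDerivAt G (truncReaction ε a M t + (a - 1) * t) t := fun t => by
    refine (((truncPotential_hasDerivAt hL t).add
      ((hasDerivAt_pow 2 t).const_mul ((a - 1) / 2))).add_const 1).congr_deriv ?_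
    push_cast; ring
  have hc : Continuous G := continuous_iff_continuousAt.2 fun t => (hd t).continuousAt
  have hin : ∀ t, |t| ≤ M → 0 ≤ G t := fun t ht => by
    simp only [hG, truncPotential_eq hM ht]
    exact potential_lower hε1 t
  -- the derivative of `G` at `M`; beyond `M` the slope `3 M² - ε - 1` of the derivative is positive too
  have hslope : 0 ≤ M * (M ^ 2 - ε - 1) := mul_nonneg hM (by linarith)
  change 0 ≤ G x
  rcases le_or_gt |x| M with h | h
  · exact hin x h
  rcases lt_abs.1 h with h | h
  · refine (hin M (abs_of_nonneg hM).le).trans ?_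
    refine monotoneOn_of_deriv_nonneg (convex_Ici M) hc.continuousOn
      (fun t _ => (hd t).differentiableAt.differentiableWithinAt) (fun t ht => ?_)
      self_mem_Ici h.le h.le
    rw [interior_Ici] at ht
    have ht' : M < t := ht
    rw [(hd t).deriv, truncReaction, if_pos ht']
    nlinarith [mul_nonneg (by linarith : (0 : ℝ) ≤ 3 * M ^ 2 - ε - 1) (sub_nonneg.2 ht'.le)]
  · refine (hin (-M) (by rw [abs_neg, abs_of_nonneg hM])).trans ?_
    have hx : x < -M := by linarith
    refine antitoneOn_of_deriv_nonpos (convex_Iic (-M)) hc.continuousOn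
      (fun t _ => (hd t).differentiableAt.differentiableWithinAt) (fun t ht => ?_)
      hx.le self_mem_Iic hx.le
    rw [interior_Iic] at ht
    have ht' : t < -M := ht
    rw [(hd t).deriv, truncReaction, if_neg (by linarith), if_pos ht']
    nlinarith [mul_nonneg (by linarith : (0 : ℝ) ≤ 3 * M ^ 2 - ε - 1) (sub_nonneg.2 ht'.le)]

theorem truncReaction_zero (hM : 0 ≤ M) : truncReaction ε a M 0 = 0 := by
  rw [truncReaction_eq (by simpa using hM), reaction]; ring

theorem abs_truncPotential_le (hM : 0 ≤ M) (hL : LipschitzWith L (truncReaction ε a M)) (x : ℝ) :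
    |truncPotential ε a M x| ≤ L / 2 * x ^ 2 := by
  have h1 := le_add_of_lipschitz_deriv (truncPotential_hasDerivAt hL) hL 0 x
  have h2 := le_add_of_lipschitz_deriv (F := fun x => -truncPotential ε a M x)
    (fun x => (truncPotential_hasDerivAt hL x).neg) hL.neg 0 x
  simp only [truncPotential_zero, truncReaction_zero hM, sub_zero, zero_mul, zero_add, neg_zero] at h1 h2
  exact abs_le.2 ⟨by linarith, h1⟩

/-! ### Energy bounds -/

namespace Setting

variable {d : ℕ} {S : Setting d}

theorem integral_sq (u : S.L2) : ∫ x, u x ^ 2 ∂S.mu = ‖u‖ ^ 2 := by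
  rw [← real_inner_self_eq_norm_sq, L2.inner_def]
  refine integral_congr_ae (Eventually.of_forall fun x => ?_)
  simp [sq]

theorem integrable_sq (u : S.L2) : Integrable (fun x => u x ^ 2) S.mu := (Lp.memLp u).integrable_sq

theorem mu_real_univ (S : Setting d) : S.mu.real univ = S.vol := by
  simp [measureReal_def, vol]

theorem memLp_truncReaction (hM : 0 ≤ M) (hL : LipschitzWith L (truncReaction ε a M)) (u : S.L2) :
    MemLp (fun x => truncReaction ε a M (u x)) 2 S.mu :=
  hL.comp_memLp (truncReaction_zero hM) (Lp.memLp u)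

theorem integrable_truncPotential (hM : 0 ≤ M) (hL : LipschitzWith L (truncReaction ε a M))
    (u : S.L2) : Integrable (fun x => truncPotential ε a M (u x)) S.mu := by
  have hc : Continuous (truncPotential ε a M) := continuous_iff_continuousAt.2 fun t =>
    (truncPotential_hasDerivAt hL t).continuousAt
  refine ((integrable_sq u).const_mul (L / 2 : ℝ)).mono'
    (hc.comp_aestronglyMeasurable (Lp.aestronglyMeasurable u)) (Eventually.of_forall fun x => ?_)
  exact abs_truncPotential_le hM hL (u x)

theorem ae_abs_le_of_supNorm_le {u : S.L2} (hM : 0 ≤ M) (h : S.supNorm u ≤ ENNReal.ofReal M) :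
    ∀ᵐ x ∂S.mu, |u x| ≤ M := by
  filter_upwards [enorm_ae_le_eLpNormEssSup (u : Space d → ℝ) S.mu] with x hx
  rw [supNorm, eLpNorm_exponent_top] at h
  have := hx.trans h
  rw [← ofReal_norm, ENNReal.ofReal_le_ofReal_iff hM] at this
  exact this

theorem exists_supNorm_le {C : ℝ} (hC : S.IsSobolevConst C) {u : S.L2} (hu : S.InDom u) :
    ∃ K, 0 ≤ K ∧ S.supNorm u ≤ ENNReal.ofReal K := by
  obtain ⟨G, hG⟩ := hu.hasLap.1
  exact ⟨_, mul_nonneg hC.1.le (Real.sqrt_nonneg _), hC.2 u G _ hG hu.hasLap⟩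

theorem integrable_potential {C : ℝ} (hC : S.IsSobolevConst C) {u : S.L2} (hu : S.InDom u)
    (ε a : ℝ) : Integrable (fun x => potential ε a (u x)) S.mu := by
  obtain ⟨K, hK, h⟩ := exists_supNorm_le hC hu
  have hc : Continuous (potential ε a) := by unfold potential; fun_prop
  obtain ⟨B, hB⟩ := (isCompact_Icc (a := -K) (b := K)).exists_bound_of_continuousOn hc.continuousOn
  refine (integrable_const B).mono' (hc.comp_aestronglyMeasurable (Lp.aestronglyMeasurable u)) ?_
  filter_upwards [ae_abs_le_of_supNorm_le hK h] with x hx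
  exact hB _ (abs_le.1 hx)

/-- Completing the square, `F(x) + a x² / 2 ≥ - ε² / 4`. -/
theorem neg_vol_le_energy {C : ℝ} (hC : S.IsSobolevConst C) {u : S.L2} (hu : S.InDom u)
    (hε : 0 < ε) (hε1 : ε < 1) : -(S.vol / 4) ≤ S.energy ε a u := by
  have h1 : ∫ x, (-(a / 2) * u x ^ 2 - 1 / 4) ∂S.mu ≤ ∫ x, potential ε a (u x) ∂S.mu := by
    refine integral_mono (((integrable_sq u).const_mul _).sub (integrable_const _))
      (integrable_potential hC hu ε a) fun x => ?_
    simp only [potential]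
    nlinarith [sq_nonneg (u x ^ 2 - ε)]
  rw [integral_sub ((integrable_sq u).const_mul _) (integrable_const _), integral_const_mul,
    integral_sq, integral_const, mu_real_univ, smul_eq_mul] at h1
  rw [energy]
  nlinarith [sq_nonneg ‖S.lap u + u‖]

/-- The Sobolev constant cannot be small, as constants are admissible functions. -/
theorem one_le_of_isSobolevConst {C : ℝ} (hC : S.IsSobolevConst C) : 1 ≤ C * √S.vol := by
  have h := hC.2 S.one 0 0 S.hasGrad_one S.hasLap_one
  have h0 : 0 ≤ C * √S.vol := mul_nonneg hC.1.le (Real.sqrt_nonneg _)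
  rw [norm_one_sq, norm_zero, norm_zero] at h
  have h1 : S.supNorm S.one ≤ ENNReal.ofReal (C * √S.vol) := by simpa using h
  have h2 := ae_abs_le_of_supNorm_le h0 h1
  have : NeZero S.mu := ⟨fun h => by
    have h3 := S.vol_pos
    rw [← mu_real_univ, measureReal_def, h] at h3
    simp at h3⟩
  obtain ⟨x, hx, hx'⟩ := (h2.and S.one_coeFn).exists
  rw [hx', abs_one] at hx
  exact hx

theorem boundSup_nonneg {CΩ : ℝ} (hCΩ : 0 < CΩ) (Cp δ ε a : ℝ) (v : S.L2) :
    0 ≤ S.boundSup CΩ Cp δ ε a v := mul_nonneg hCΩ.le (Real.sqrt_nonneg _)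

/-- The truncation level is not too small: the energy is at least `-|Ω| / 4`, so that the bound for
the Laplacian is at least `√(3 |Ω|)`, and the Sobolev constant is at least `1 / √|Ω|`. -/
theorem three_le_boundSup_sq {CΩ : ℝ} (hC : S.IsSobolevConst CΩ) (Cp δ : ℝ) {u : S.L2}
    (hu : S.InDom u) (hε : 0 < ε) (hε1 : ε < 1) : 3 ≤ S.boundSup CΩ Cp δ ε a u ^ 2 := by
  have h1 := neg_vol_le_energy (a := a) hC hu hε hε1
  have hv := S.vol_pos
  have h2 : S.boundLap ε a u ^ 2 = 4 * (S.energy ε a u + S.vol) := by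
    rw [boundLap, mul_pow, Real.sq_sqrt (by linarith)]; ring
  have h3 : 1 ≤ CΩ ^ 2 * S.vol := by
    have := pow_le_pow_left₀ zero_le_one (one_le_of_isSobolevConst hC) 2
    rwa [one_pow, mul_pow, Real.sq_sqrt hv.le] at this
  rw [boundSup, mul_pow, Real.sq_sqrt (by positivity), h2]
  calc (3 : ℝ) ≤ CΩ ^ 2 * (3 * S.vol) := by linarith
    _ ≤ _ := by
      refine mul_le_mul_of_nonneg_left ?_ (sq_nonneg _)
      nlinarith [sq_nonneg (S.boundVal Cp δ ε a u), sq_nonneg (S.boundGrad Cp δ ε a u)]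

/-- A function whose energy, with an arbitrary potential that obeys the lower bound of the
original one, is at most the initial energy, and whose mean value is the initial one, is bounded
by `boundSup`. -/
theorem supNorm_le_boundSup {CΩ Cp δ : ℝ} (hC : S.IsSobolevConst CΩ) (hP : S.IsPoincareConst Cp)
    (hδ : 0 < δ) (hδC : δ / 2 * Cp ≤ 1 / 2) {Φ : ℝ → ℝ}
    (hΦ : ∀ x, 0 ≤ Φ x + (a - 1) / 2 * x ^ 2 + 1) {u φ₀ : S.L2} (hu : S.InDom u)
    (hi : Integrable (fun x => Φ (u x)) S.mu)
    (hE : 1 / 2 * ‖S.lap u + u‖ ^ 2 + a / 2 * ‖u‖ ^ 2 + ∫ x, Φ (u x) ∂S.mu ≤ S.energy ε a φ₀)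
    (hm : ⟪u, S.one⟫_ℝ = ⟪φ₀, S.one⟫_ℝ) :
    S.supNorm u ≤ ENNReal.ofReal (S.boundSup CΩ Cp δ ε a φ₀) := by
  have hlow : 0 ≤ ∫ x, Φ (u x) ∂S.mu + (a - 1) / 2 * ‖u‖ ^ 2 + S.vol := by
    have h1 : 0 ≤ ∫ x, (Φ (u x) + (a - 1) / 2 * u x ^ 2 + 1) ∂S.mu :=
      integral_nonneg fun x => hΦ (u x)
    have i1 : Integrable (fun x => (a - 1) / 2 * u x ^ 2) S.mu := (integrable_sq u).const_mul _
    have i2 : Integrable (fun x => Φ (u x) + (a - 1) / 2 * u x ^ 2) S.mu := hi.add i1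
    rwa [integral_add i2 (integrable_const _), integral_add hi i1, integral_const_mul, integral_sq,
      integral_const, mu_real_univ, smul_eq_mul, mul_one] at h1
  have hin : -(‖S.lap u‖ ^ 2 / 4 + ‖u‖ ^ 2) ≤ ⟪S.lap u, u⟫_ℝ := by
    have h1 := neg_le_of_abs_le (abs_real_inner_le_norm (S.lap u) u)
    nlinarith [sq_nonneg (‖S.lap u‖ / 2 - ‖u‖)]
  -- by the lower bound of the potential, `‖Δu‖² / 2 + (Δu, u) + ‖u‖²` is at most the initial energy
  -- plus `|Ω|`; the cross term is absorbed by half of the first and all of the last summand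
  have hlap : ‖S.lap u‖ ≤ S.boundLap ε a φ₀ := by
    rw [boundLap, ← div_le_iff₀' two_pos]
    refine Real.le_sqrt_of_sq_le ?_
    rw [norm_add_sq_real] at hE
    nlinarith
  obtain ⟨G, hG⟩ := hu.hasLap.1
  -- interpolation: `‖∇u‖² = -(Δu, u)`
  have hgrad : ‖G‖ ≤ δ / 2 * ‖u‖ + 1 / (2 * δ) * ‖S.lap u‖ := by
    have h1 := hu.hasLap.2 G u G hG hG
    have h2 := neg_le_of_abs_le (abs_real_inner_le_norm (S.lap u) u)
    rw [real_inner_self_eq_norm_sq] at h1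
    refine abs_le_of_sq_le_sq (a := ‖G‖) ?_ (by positivity) |> (le_abs_self _).trans
    have h3 : (δ / 2 * ‖u‖ + 1 / (2 * δ) * ‖S.lap u‖) ^ 2 =
        (δ / 2 * ‖u‖ - 1 / (2 * δ) * ‖S.lap u‖) ^ 2 + ‖S.lap u‖ * ‖u‖ := by
      field_simp; ring
    rw [h3]
    nlinarith [sq_nonneg (δ / 2 * ‖u‖ - 1 / (2 * δ) * ‖S.lap u‖)]
  have hmean : S.mean u = S.mean φ₀ := by rw [mean_eq_inner, mean_eq_inner, hm]
  have hpoin : ‖u‖ ≤ Cp * ‖G‖ + S.meanNorm φ₀ := by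
    have h1 := hP.norm_sub_le hG
    have h2 : ‖u‖ ≤ ‖u - S.mean u • S.one‖ + ‖S.mean u • S.one‖ := by
      simpa using norm_add_le (u - S.mean u • S.one) (S.mean u • S.one)
    rw [meanNorm_eq, ← hmean]
    linarith
  have hCp := hP.1
  have hval : ‖u‖ ≤ S.boundVal Cp δ ε a φ₀ := by
    have h1 : Cp * ‖G‖ ≤ Cp * (δ / 2 * ‖u‖ + 1 / (2 * δ) * S.boundLap ε a φ₀) :=
      mul_le_mul_of_nonneg_left (hgrad.trans (by gcongr)) hCp.le
    have h2 : δ / 2 * Cp * ‖u‖ ≤ 1 / 2 * ‖u‖ := mul_le_mul_of_nonneg_right hδC (norm_nonneg _)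
    have h3 : Cp / δ * S.boundLap ε a φ₀ = 2 * (Cp * (1 / (2 * δ) * S.boundLap ε a φ₀)) := by
      field_simp
    rw [boundVal, h3]
    linarith
  have hgr : ‖G‖ ≤ S.boundGrad Cp δ ε a φ₀ := by
    have h1 : ‖G‖ ≤ δ / 2 * S.boundVal Cp δ ε a φ₀ + 1 / (2 * δ) * S.boundLap ε a φ₀ :=
      hgrad.trans (by gcongr)
    refine h1.trans_eq ?_
    rw [boundGrad, boundVal]
    field_simp
    ring
  refine (hC.2 u G _ hG hu.hasLap).trans (ENNReal.ofReal_le_ofReal ?_)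
  rw [boundSup]
  refine mul_le_mul_of_nonneg_left (Real.sqrt_le_sqrt ?_) hC.1.le
  have h1 := pow_le_pow_left₀ (norm_nonneg _) hlap 2
  have h2 := pow_le_pow_left₀ (norm_nonneg _) hval 2
  have h3 := pow_le_pow_left₀ (norm_nonneg _) hgr 2
  linarith

end Setting

end PFC

namespace PFC

open Filter Topology Metric

/-! ### Energy dissipation -/

/-- A telescoping sum of increments, truncated at the index `m`. -/
theorem sum_ite_castSucc_lt {s : ℕ} {E : Type*} [AddCommGroup E] (f : Fin (s + 1) → E)
    (m : Fin (s + 1)) :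
    ∑ j : Fin s, (if j.castSucc < m then f j.succ - f j.castSucc else 0) = f m - f 0 := by
  induction m using Fin.induction with
  | zero => simp
  | succ i ih =>
    have h : ∀ j : Fin s, (if j.castSucc < i.succ then f j.succ - f j.castSucc else 0) =
        (if j.castSucc < i.castSucc then f j.succ - f j.castSucc else 0) +
          if j = i then f j.succ - f j.castSucc else 0 := by
      intro j
      rcases lt_trichotomy j i with hj | rfl | hj
      · have h1 : j.castSucc < i.castSucc := hj
        rw [if_pos h1, if_pos (h1.trans Fin.castSucc_lt_succ), if_neg hj.ne, add_zero]
      · rw [if_pos Fin.castSucc_lt_succ, if_neg (lt_irrefl _), if_pos rfl, zero_add]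
      · have h1 : ¬ j.castSucc < i.castSucc := not_lt.2 (le_of_lt hj)
        have h2 : ¬ j.castSucc < i.succ := fun hh => h1 (lt_of_le_of_ne
          (Fin.le_castSucc_iff.2 hh) fun e => hj.ne' (Fin.castSucc_injective _ e))
        rw [if_neg h1, if_neg h2, if_neg hj.ne', add_zero]
    simp only [h, Finset.sum_add_distrib, ih, Finset.sum_ite_eq', Finset.mem_univ, if_true]
    abel

open Matrix in
/-- The values at the stages are sums of increments. -/
theorem lowerOnes_mulVec_increments {s : ℕ} (f : Fin (s + 1) → ℝ) (r : Fin s) :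
    (lowerOnes s *ᵥ fun j => f j.succ - f j.castSucc) r = f r.succ - f 0 := by
  rw [← sum_ite_castSucc_lt f r.succ, mulVec, dotProduct]
  refine Finset.sum_congr rfl fun j _ => ?_
  have : j.castSucc < r.succ ↔ j ≤ r := by rw [← Fin.le_castSucc_iff]; exact Iff.rfl
  simp only [lowerOnes, Matrix.of_apply, this, ite_mul, one_mul, zero_mul]

/-- If a lower triangular form is paired with sequences that vanish from some index on, then only
the part of the other sequence before that index matters. -/
theorem sum_lower_congr {s : ℕ} {E F : Type*} [Zero E] {M : Matrix (Fin s) (Fin s) ℝ}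
    (hM : ∀ i j, i < j → M i j = 0) {m : Fin (s + 1)} {x x' : Fin s → E} {y : Fin s → F}
    (hx : ∀ j : Fin s, j.castSucc < m → x' j = x j) (b : E → F → ℝ)
    (hb : ∀ i j : Fin s, ¬ i.castSucc < m → b (x j) (y i) = 0 ∧ b (x' j) (y i) = 0) :
    ∑ i, ∑ j, M i j * b (x j) (y i) = ∑ i, ∑ j, M i j * b (x' j) (y i) := by
  refine Finset.sum_congr rfl fun i _ => Finset.sum_congr rfl fun j _ => ?_
  by_cases hi : i.castSucc < m
  · rcases lt_or_ge i j with h | h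
    · rw [hM i j h, zero_mul, zero_mul]
    · rw [hx j (lt_of_le_of_lt (Fin.castSucc_le_castSucc_iff.2 h) hi)]
  · rw [(hb i j hi).1, (hb i j hi).2]

namespace Setting

variable {d : ℕ} {S : Setting d} {s : ℕ} {B : IMEXTable s} {a α β τ : ℝ} {g : ℝ → ℝ}
  {U : Fin (s + 1) → S.L2}

/-- The scheme conserves the mean value. -/
theorem StageEq.inner_one {i : Fin s} (h : S.StageEq B a α β g τ U i) :
    ⟪U i.succ, S.one⟫_ℝ = ⟪U 0, S.one⟫_ℝ := by
  have h0 : S.lap S.one = 0 := S.hasLap_one.lap_eq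
  have h00 : S.lap 0 = 0 := HasLap.zero.lap_eq
  have h1 := h S.one ⟨_, S.hasLap_one⟩ (by rw [h0]; exact ⟨_, HasLap.zero⟩)
  have e1 : ∀ u : S.L2, S.pairLin a α β u S.one = 0 := fun u => by
    simp [pairLin, formP, h0, h00]
  have e2 : ∀ u : S.L2, S.pairNonlin a α β g u S.one = 0 := fun u => by
    have : ∫ x, g (u x) * (0 : S.L2) x ∂S.mu = 0 := by
      rw [← integral_zero (Space d) ℝ (μ := S.mu)]
      refine integral_congr_ae ?_
      filter_upwards [Lp.coeFn_zero ℝ 2 S.mu] with x hx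
      rw [hx]; simp
    rw [pairNonlin, h0, this]
    simp [formP, h00]
  simpa [e1, e2] using h1

open Matrix in
/-- The stage equations in terms of the increments between consecutive stages, tested with `v`. -/
theorem stage_increments_test (h : ∀ i, S.StageEq B a α β g τ U i) {v : S.L2} (hv : S.InDom v)
    (hv' : S.InDom (S.lap v)) (i : Fin s) :
    ∑ j, B.H0 i j * ⟪U j.succ - U j.castSucc, v⟫_ℝ = τ * (S.formP a (U 0) (S.lap v) +
      ∑ j, (α • B.Q + B.Ahat⁻¹ * B.A * lowerOnes s) i j *
        (S.formP a (U j.succ) (S.lap v) - S.formP a (U j.castSucc) (S.lap v)) +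
      β * ∑ j, B.Q i j * ⟪U j.succ - U j.castSucc, S.lap v⟫_ℝ +
      ∫ x, g (U i.castSucc x) * (S.lap v) x ∂S.mu) := by
  set w := S.lap v with hw
  have key := B.stage_increments (α := α) (β := β) (τ := τ) (p₀ := S.formP a (U 0) w)
    (q₀ := ⟪U 0, w⟫_ℝ) (d := fun j => ⟪U j.succ, v⟫_ℝ - ⟪U j.castSucc, v⟫_ℝ)
    (p := fun j => S.formP a (U j.succ) w - S.formP a (U j.castSucc) w)
    (q := fun j => ⟪U j.succ, w⟫_ℝ - ⟪U j.castSucc, w⟫_ℝ)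
    (g := fun j => ∫ x, g (U j.castSucc x) * w x ∂S.mu) (by
      have e1 : lowerOnes s *ᵥ (fun j => ⟪U j.succ, v⟫_ℝ - ⟪U j.castSucc, v⟫_ℝ) =
          fun r => ⟪U r.succ, v⟫_ℝ - ⟪U 0, v⟫_ℝ :=
        funext fun r => lowerOnes_mulVec_increments (fun j => ⟪U j, v⟫_ℝ) r
      have e2 : lowerOnes s *ᵥ (fun j => S.formP a (U j.succ) w - S.formP a (U j.castSucc) w) =
          fun r => S.formP a (U r.succ) w - S.formP a (U 0) w :=
        funext fun r => lowerOnes_mulVec_increments (fun j => S.formP a (U j) w) r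
      have e3 : lowerOnes s *ᵥ (fun j => ⟪U j.succ, w⟫_ℝ - ⟪U j.castSucc, w⟫_ℝ) =
          fun r => ⟪U r.succ, w⟫_ℝ - ⟪U 0, w⟫_ℝ :=
        funext fun r => lowerOnes_mulVec_increments (fun j => ⟪U j, w⟫_ℝ) r
      rw [e1, e2, e3]
      ext r
      have hr := h r v hv hv'
      have hs : ∀ (M : Matrix (Fin s) (Fin s) ℝ) (hM : ∀ i j, i < j → M i j = 0) (x : Fin s → ℝ),
          ∑ j ∈ Finset.Iic r, M r j * x j = ∑ j, M r j * x j := fun M hM x =>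
        Finset.sum_subset (Finset.subset_univ _) fun j _ hj => by
          rw [hM r j (not_le.1 fun hh => hj (Finset.mem_Iic.2 hh)), zero_mul]
      rw [hs B.A B.A_lower (fun j => S.pairLin a α β (U j.succ) v),
        hs B.Ahat B.Ahat_lower (fun j => S.pairNonlin a α β g (U j.castSucc) v)] at hr
      simp only [Pi.smul_apply, Pi.add_apply, mulVec, dotProduct, Pi.sub_apply, Pi.one_apply,
        smul_eq_mul, mul_one]
      rw [hr, add_sub_cancel_left]
      congr 2
      · refine Finset.sum_congr rfl fun j _ => ?_
        rw [pairLin]; ring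
      · refine Finset.sum_congr rfl fun j _ => ?_
        rw [pairNonlin]; ring)
  have key' := congrFun key i
  simp only [Pi.smul_apply, Pi.add_apply, mulVec, dotProduct, Pi.one_apply, smul_eq_mul,
    mul_one] at key'
  simp only [inner_sub_left]
  rw [key', Finset.mul_sum]

variable {ε M : ℝ} {L : ℝ≥0}

/-- The energy with the truncated potential. -/
def truncEnergy (S : Setting d) (ε a M : ℝ) (u : S.L2) : ℝ :=
  1 / 2 * ‖S.lap u + u‖ ^ 2 + a / 2 * ‖u‖ ^ 2 + ∫ x, truncPotential ε a M (u x) ∂S.mu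

theorem truncEnergy_eq {u : S.L2} (hM : 0 ≤ M) (h : S.supNorm u ≤ ENNReal.ofReal M) :
    S.truncEnergy ε a M u = S.energy ε a u := by
  rw [truncEnergy, energy]
  congr 1
  refine integral_congr_ae ?_
  filter_upwards [ae_abs_le_of_supNorm_le hM h] with x hx
  exact truncPotential_eq hM hx

theorem integral_truncPotential_le (hM : 0 ≤ M) (hL : LipschitzWith L (truncReaction ε a M))
    (u v : S.L2) : ∫ x, truncPotential ε a M (v x) ∂S.mu - ∫ x, truncPotential ε a M (u x) ∂S.mu ≤
      ∫ x, truncReaction ε a M (u x) * (v - u : S.L2) x ∂S.mu + L / 2 * ‖v - u‖ ^ 2 := by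
  have i1 := integrable_truncPotential hM hL u
  have i2 := integrable_truncPotential hM hL v
  have i3 : Integrable (fun x => truncReaction ε a M (u x) * (v - u : S.L2) x) S.mu :=
    (memLp_truncReaction hM hL u).integrable_mul (Lp.memLp (v - u))
  have i4 : Integrable (fun x => (L / 2 : ℝ) * (v - u : S.L2) x ^ 2) S.mu :=
    (integrable_sq _).const_mul _
  rw [← integral_sub i2 i1, ← integral_sq, ← integral_const_mul, ← integral_add i3 i4]
  refine integral_mono_ae (i2.sub i1) (i3.add i4) ?_
  filter_upwards [Lp.coeFn_sub v u] with x hx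
  have := le_add_of_lipschitz_deriv (truncPotential_hasDerivAt hL) hL (u x) (v x)
  rw [hx]
  simp only [Pi.sub_apply]
  linarith

theorem formP_sub_left (a : ℝ) {u v w : S.L2} (hu : S.InDom u) (hv : S.InDom v) :
    S.formP a (u - v) w = S.formP a u w - S.formP a v w := by
  have h : S.lap (u - v) = S.lap u - S.lap v := (hu.hasLap.sub hv.hasLap).lap_eq
  simp only [formP, h, inner_add_left, inner_sub_left]
  ring

theorem formP_neg_right (a : ℝ) {u w : S.L2} (hw : S.InDom w) :
    S.formP a u (-w) = -S.formP a u w := by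
  have h : S.lap (-w) = -S.lap w := hw.hasLap.neg.lap_eq
  simp only [formP, h, inner_add_right, inner_neg_right]
  ring

/-- The truncated energy at every stage is at most that at the beginning of the step. The equations
for the increments are tested with `(-Δ)⁻¹` of the increments up to stage `m`; the test functions
for later stages are zero, and by lower triangularity later increments do not enter either. -/
theorem truncEnergy_le {Cp : ℝ} (hP : S.IsPoincareConst Cp) (hM : 0 ≤ M)
    (hL : LipschitzWith L (truncReaction ε a M)) (ha : 0 ≤ a) (hτ : 0 < τ)
    (hH0 : (symPart B.H0).PosSemidef) (hH1 : (symPart (B.H1 L β)).PosSemidef)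
    (hH2 : (symPart (B.H2 α)).PosSemidef) (hU : ∀ i, S.InDom (U i))
    (h : ∀ i, S.StageEq B a α β (truncReaction ε a M) τ U i) (m : Fin (s + 1)) :
    S.truncEnergy ε a M (U m) ≤ S.truncEnergy ε a M (U 0) := by
  set f := truncReaction ε a M with hf
  -- the increments up to stage `m`, and their images under `I + Δ`
  set ξ : Fin s → S.L2 := fun j => if j.castSucc < m then U j.succ - U j.castSucc else 0 with hξ
  set η : Fin s → S.L2 := fun j => if j.castSucc < m then
    (S.lap (U j.succ) + U j.succ) - (S.lap (U j.castSucc) + U j.castSucc) else 0 with hη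
  have hξ0 : ∀ j : Fin s, ¬ j.castSucc < m → ξ j = 0 := fun j hj => if_neg hj
  have hξ1 : ∀ j : Fin s, j.castSucc < m → ξ j = U j.succ - U j.castSucc := fun j hj => if_pos hj
  have hξlap : ∀ j, S.HasLap (ξ j) (η j - ξ j) := fun j => by
    by_cases hj : j.castSucc < m
    · simp only [hξ, hη, if_pos hj]
      convert (hU j.succ).hasLap.sub (hU j.castSucc).hasLap using 1
      abel
    · simp only [hξ, hη, if_neg hj, sub_zero]
      exact HasLap.zero
  have hξdom : ∀ j, S.InDom (ξ j) := fun j => ⟨_, hξlap j⟩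
  have hmean : ∀ j, ⟪U j, S.one⟫_ℝ = ⟪U 0, S.one⟫_ℝ := fun j => by
    rcases Fin.eq_zero_or_eq_succ j with rfl | ⟨i, rfl⟩
    · rfl
    · exact (h i).inner_one
  have hξmean : ∀ j, ⟪ξ j, S.one⟫_ℝ = 0 := fun j => by
    by_cases hj : j.castSucc < m
    · rw [hξ1 j hj, inner_sub_left, hmean, hmean j.castSucc, sub_self]
    · rw [hξ0 j hj, inner_zero_left]
  -- the increments have mean zero, so that the Laplacian can be inverted on them
  have hex : ∀ j, ∃ v, S.HasLap v (-(ξ j)) ∧ (ξ j = 0 → v = 0) := fun j => by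
    by_cases hj : ξ j = 0
    · exact ⟨0, by rw [hj, neg_zero]; exact HasLap.zero, fun _ => rfl⟩
    · obtain ⟨v, hv⟩ := exists_hasLap_neg hP (hξmean j)
      exact ⟨v, hv, fun h => absurd h hj⟩
  choose v hv hv0 using hex
  choose V hV using fun j => (hv j).1
  have hrow : ∀ i, ∑ j, B.H0 i j * ⟪U j.succ - U j.castSucc, v i⟫_ℝ =
      -τ * (S.formP a (U 0) (ξ i) +
        ∑ j, (α • B.Q + B.Ahat⁻¹ * B.A * lowerOnes s) i j *
          S.formP a (U j.succ - U j.castSucc) (ξ i) +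
        β * ∑ j, B.Q i j * ⟪U j.succ - U j.castSucc, ξ i⟫_ℝ +
        ∫ x, f (U i.castSucc x) * (ξ i) x ∂S.mu) := fun i => by
    have e := stage_increments_test h ⟨_, hv i⟩ (by
      rw [(hv i).lap_eq]; exact ⟨_, (hξlap i).neg⟩) i
    have e1 : ∫ x, f (U i.castSucc x) * (-ξ i : S.L2) x ∂S.mu =
        -∫ x, f (U i.castSucc x) * (ξ i) x ∂S.mu := by
      rw [← integral_neg]
      refine integral_congr_ae ?_
      filter_upwards [Lp.coeFn_neg (ξ i)] with x hx
      rw [hx, Pi.neg_apply, mul_neg]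
    rw [(hv i).lap_eq, e1] at e
    rw [e]
    simp only [formP_neg_right _ (hξdom i), formP_sub_left _ (hU _) (hU _), inner_neg_right,
      mul_neg, Finset.sum_neg_distrib, neg_sub_neg]
    have e2 : ∀ j : Fin s, S.formP a (U j.castSucc) (ξ i) - S.formP a (U j.succ) (ξ i) =
        -(S.formP a (U j.succ) (ξ i) - S.formP a (U j.castSucc) (ξ i)) := fun j => by ring
    simp only [e2, mul_neg, Finset.sum_neg_distrib]
    ring
  set N : Matrix (Fin s) (Fin s) ℝ := α • B.Q + B.Ahat⁻¹ * B.A * lowerOnes s with hN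
  have hNlow : ∀ i j, i < j → N i j = 0 := fun i j hij => by
    rw [hN, Matrix.add_apply, Matrix.smul_apply, B.Q_lower i j hij,
      lowerTriangular_mul B.invMul_lower lowerOnes_lower i j hij, smul_zero, add_zero]
  have hform0 : ∀ u : S.L2, S.formP a u 0 = 0 := fun u => by
    simp [formP, (HasLap.zero (S := S)).lap_eq]
  have hformξ : ∀ i j, S.formP a (ξ j) (ξ i) = ⟪η j, η i⟫_ℝ + a * ⟪ξ j, ξ i⟫_ℝ := fun i j => by
    rw [formP, (hξlap j).lap_eq, (hξlap i).lap_eq, sub_add_cancel, sub_add_cancel]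
  have hform0ξ : ∀ i, S.formP a (U 0) (ξ i) =
      ⟪S.lap (U 0) + U 0, η i⟫_ℝ + a * ⟪U 0, ξ i⟫_ℝ := fun i => by
    rw [formP, (hξlap i).lap_eq, sub_add_cancel]
  -- the left-hand side is nonnegative, as `H0` acts on gradients
  have hlhs : 0 ≤ ∑ i, ∑ j, B.H0 i j * ⟪U j.succ - U j.castSucc, v i⟫_ℝ := by
    have e1 := sum_lower_congr B.H0_lower (m := m) (x := fun j => U j.succ - U j.castSucc)
      (x' := ξ) (y := v) hξ1 (fun x y => ⟪x, y⟫_ℝ) fun i j hi => by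
        rw [hv0 i (hξ0 i hi), inner_zero_right, inner_zero_right]; exact ⟨rfl, rfl⟩
    rw [e1]
    have e2 : ∀ i j, ⟪ξ j, v i⟫_ℝ = ⟪V j, V i⟫_ℝ := fun i j => by
      rw [(hv j).2 (V j) (v i) (V i) (hV j) (hV i), inner_neg_left, neg_neg]
    simp only [e2]
    exact sum_mul_inner_nonneg hH0 V
  have hrhs : ∑ i, (S.formP a (U 0) (ξ i) + ∑ j, N i j * S.formP a (U j.succ - U j.castSucc) (ξ i) +
      β * ∑ j, B.Q i j * ⟪U j.succ - U j.castSucc, ξ i⟫_ℝ +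
      ∫ x, f (U i.castSucc x) * (ξ i) x ∂S.mu) ≤ 0 := by
    simp only [hrow, ← Finset.mul_sum] at hlhs
    by_contra hcon
    nlinarith [mul_pos hτ (not_le.1 hcon)]
  have hNsum : ∑ i, ∑ j, N i j * S.formP a (U j.succ - U j.castSucc) (ξ i) =
      ∑ i, ∑ j, N i j * S.formP a (ξ j) (ξ i) :=
    sum_lower_congr hNlow (x := fun j => U j.succ - U j.castSucc) hξ1 (fun x y => S.formP a x y)
      fun i j hi => by rw [hξ0 i hi, hform0, hform0]; exact ⟨rfl, rfl⟩
  have hQsum : ∑ i, ∑ j, B.Q i j * ⟪U j.succ - U j.castSucc, ξ i⟫_ℝ =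
      ∑ i, ∑ j, B.Q i j * ⟪ξ j, ξ i⟫_ℝ :=
    sum_lower_congr B.Q_lower (x := fun j => U j.succ - U j.castSucc) hξ1 (fun x y => ⟪x, y⟫_ℝ)
      fun i j hi => by rw [hξ0 i hi, inner_zero_right, inner_zero_right]; exact ⟨rfl, rfl⟩
  -- completing the squares with the matrices `H2` and `H1`
  have hN2 : ∀ {E : Type} [NormedAddCommGroup E] [InnerProductSpace ℝ E] (x : Fin s → E),
      1 / 2 * ‖∑ i, x i‖ ^ 2 ≤ ∑ i, ∑ j, N i j * ⟪x j, x i⟫_ℝ := fun x => by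
    have e1 := sum_mul_inner_nonneg hH2 x
    have e2 : ∀ i j, B.H2 α i j = N i j - 1 / 2 := fun i j => by
      simp only [IMEXTable.H2, hN, Matrix.add_apply, Matrix.sub_apply, Matrix.smul_apply, onesMat,
        Matrix.of_apply, smul_eq_mul]
      ring
    have e3 : ‖∑ i, x i‖ ^ 2 = ∑ i, ∑ j, ⟪x j, x i⟫_ℝ := by
      rw [← real_inner_self_eq_norm_sq, inner_sum]
      simp only [sum_inner]
    simp only [e2, sub_mul, Finset.sum_sub_distrib, ← Finset.mul_sum] at e1
    rw [e3]
    linarith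
  have hQ1 : L / 2 * ∑ i, ‖ξ i‖ ^ 2 ≤ β * ∑ i, ∑ j, B.Q i j * ⟪ξ j, ξ i⟫_ℝ := by
    have e1 := sum_mul_inner_nonneg hH1 ξ
    have e2 : ∀ i j, B.H1 L β i j = β * B.Q i j - L / 2 * (1 : Matrix (Fin s) (Fin s) ℝ) i j :=
      fun i j => by
        simp only [IMEXTable.H1, Matrix.sub_apply, Matrix.smul_apply, smul_eq_mul]
    have e3 : ∑ i, ∑ j, (1 : Matrix (Fin s) (Fin s) ℝ) i j * ⟪ξ j, ξ i⟫_ℝ = ∑ i, ‖ξ i‖ ^ 2 := by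
      refine Finset.sum_congr rfl fun i _ => ?_
      simp [Matrix.one_apply]
    simp only [e2, sub_mul, Finset.sum_sub_distrib, mul_assoc, ← Finset.mul_sum] at e1
    rw [e3] at e1
    linarith
  -- the explicit terms are differences of the potential up to the squares of the increments, which
  -- the matrix `H1` absorbs
  have hpot : ∫ x, truncPotential ε a M (U m x) ∂S.mu - ∫ x, truncPotential ε a M (U 0 x) ∂S.mu ≤
      ∑ i, ∫ x, f (U i.castSucc x) * (ξ i) x ∂S.mu + L / 2 * ∑ i, ‖ξ i‖ ^ 2 := by
    rw [← sum_ite_castSucc_lt (fun j => ∫ x, truncPotential ε a M (U j x) ∂S.mu) m,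
      Finset.mul_sum, ← Finset.sum_add_distrib]
    refine Finset.sum_le_sum fun i _ => ?_
    by_cases hi : i.castSucc < m
    · rw [if_pos hi, hξ1 i hi]
      exact integral_truncPotential_le hM hL _ _
    · rw [if_neg hi, hξ0 i hi]
      have e1 : ∫ x, f (U i.castSucc x) * (0 : S.L2) x ∂S.mu = 0 := by
        rw [← integral_zero (Space d) ℝ (μ := S.mu)]
        refine integral_congr_ae ?_
        filter_upwards [Lp.coeFn_zero ℝ 2 S.mu] with x hx
        rw [hx]; simp
      rw [e1]; simp
  have hξsum : ∑ i, ξ i = U m - U 0 := sum_ite_castSucc_lt U m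
  have hηsum : ∑ i, η i = S.lap (U m) + U m - (S.lap (U 0) + U 0) :=
    sum_ite_castSucc_lt (fun j => S.lap (U j) + U j) m
  have hη2 := hN2 η
  have hξ2 := mul_le_mul_of_nonneg_left (hN2 ξ) ha
  rw [hηsum] at hη2
  rw [hξsum] at hξ2
  simp only [Finset.sum_add_distrib, ← Finset.mul_sum] at hrhs
  rw [hNsum, hQsum] at hrhs
  have hs1 : ∑ i, S.formP a (U 0) (ξ i) =
      ⟪S.lap (U 0) + U 0, S.lap (U m) + U m - (S.lap (U 0) + U 0)⟫_ℝ + a * ⟪U 0, U m - U 0⟫_ℝ := by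
    simp only [hform0ξ, Finset.sum_add_distrib, ← Finset.mul_sum, ← inner_sum]
    rw [hξsum, hηsum]
  have hs2 : ∑ i, ∑ j, N i j * S.formP a (ξ j) (ξ i) =
      ∑ i, ∑ j, N i j * ⟪η j, η i⟫_ℝ + a * ∑ i, ∑ j, N i j * ⟪ξ j, ξ i⟫_ℝ := by
    simp only [hformξ, mul_add, Finset.sum_add_distrib, Finset.mul_sum]
    congr 1
    exact Finset.sum_congr rfl fun i _ => Finset.sum_congr rfl fun j _ => by ring
  rw [hs1, hs2] at hrhs
  have hsq : ∀ x y : S.L2, 1 / 2 * ‖x‖ ^ 2 - 1 / 2 * ‖y‖ ^ 2 =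
      ⟪y, x - y⟫_ℝ + 1 / 2 * ‖x - y‖ ^ 2 := fun x y => by
    rw [norm_sub_sq_real, inner_sub_right, real_inner_self_eq_norm_sq, real_inner_comm]; ring
  have h1 := hsq (S.lap (U m) + U m) (S.lap (U 0) + U 0)
  have h2 := congrArg (fun t => a * t) (hsq (U m) (U 0))
  simp only [mul_add, mul_sub] at h2
  rw [truncEnergy, truncEnergy]
  linarith

end Setting

end PFC

namespace PFC

/-! ### The scheme over many steps -/

namespace Setting

variable {d : ℕ} {S : Setting d} {s : ℕ} {B : IMEXTable s} {ε a α β τ M : ℝ} {L : ℝ≥0}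

theorem pairNonlin_trunc_eq {u : S.L2} (hM : 0 ≤ M) (h : S.supNorm u ≤ ENNReal.ofReal M) (v : S.L2) :
    S.pairNonlin a α β (truncReaction ε a M) u v = S.pairNonlin a α β (reaction ε a) u v := by
  have e : ∫ x, truncReaction ε a M (u x) * (S.lap v) x ∂S.mu =
      ∫ x, reaction ε a (u x) * (S.lap v) x ∂S.mu := by
    refine integral_congr_ae ?_
    filter_upwards [ae_abs_le_of_supNorm_le hM h] with x hx
    rw [truncReaction_eq hx]
  rw [pairNonlin, pairNonlin, e]

/-- Solutions of the auxiliary scheme that respect the truncation level solve the original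
scheme. -/
theorem IsSolution.reaction_of_trunc {φ₀ : S.L2} {K : ℕ} {u : Fin K → Fin (s + 1) → S.L2}
    (h : S.IsSolution B a α β (truncReaction ε a M) τ φ₀ K u) (hM : 0 ≤ M)
    (hb : ∀ n i, S.supNorm (u n i) ≤ ENNReal.ofReal M) :
    S.IsSolution B a α β (reaction ε a) τ φ₀ K u where
  inDom := h.inDom
  init := h.init
  next := h.next
  stage n i v h1 h2 := by
    rw [h.stage n i v h1 h2]
    simp only [pairNonlin_trunc_eq hM (hb n _)]

/-- A quantity that does not grow within a step does not exceed its initial value. -/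
theorem IsSolution.le_initial {φ₀ : S.L2} {K : ℕ} {g : ℝ → ℝ} {u : Fin K → Fin (s + 1) → S.L2}
    (h : S.IsSolution B a α β g τ φ₀ K u) {E : S.L2 → ℝ} (hE : ∀ n i, E (u n i) ≤ E (u n 0))
    (n : Fin K) (i : Fin (s + 1)) : E (u n i) ≤ E φ₀ := by
  have key : ∀ n (hn : n < K), E (u ⟨n, hn⟩ 0) ≤ E φ₀ := by
    intro n
    induction n with
    | zero => intro hn; rw [h.init ⟨0, hn⟩ rfl]
    | succ n ih =>
      intro hn
      rw [h.next ⟨n, by omega⟩ ⟨n + 1, hn⟩ rfl]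
      exact (hE _ _).trans (ih _)
  exact (hE n i).trans (key n n.2)

theorem IsSolution.inner_one {φ₀ : S.L2} {K : ℕ} {g : ℝ → ℝ} {u : Fin K → Fin (s + 1) → S.L2}
    (h : S.IsSolution B a α β g τ φ₀ K u) (n : Fin K) (i : Fin (s + 1)) :
    ⟪u n i, S.one⟫_ℝ = ⟪φ₀, S.one⟫_ℝ := by
  have key : ∀ n i, ⟪u n i, S.one⟫_ℝ = ⟪u n 0, S.one⟫_ℝ := fun n i => by
    rcases Fin.eq_zero_or_eq_succ i with rfl | ⟨i, rfl⟩
    · rfl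
    · exact StageEq.inner_one (h.stage n i)
  refine le_antisymm (h.le_initial (E := fun v => ⟪v, S.one⟫_ℝ) (fun n i => (key n i).le) n i) ?_
  have := h.le_initial (E := fun v => -⟪v, S.one⟫_ℝ) (fun n i => (neg_le_neg (key n i).ge)) n i
  exact neg_le_neg_iff.1 this

/-- The truncation is not active at the initial value. -/
theorem supNorm_initial_le {CΩ Cp δ : ℝ} (hC : S.IsSobolevConst CΩ) (hP : S.IsPoincareConst Cp)
    (hδ : 0 < δ) (hδC : δ / 2 * Cp ≤ 1 / 2) (hε1 : ε < 1) {φ₀ : S.L2} (hφ : S.InDom φ₀) :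
    S.supNorm φ₀ ≤ ENNReal.ofReal (S.boundSup CΩ Cp δ ε a φ₀) :=
  supNorm_le_boundSup hC hP hδ hδC (fun x => potential_lower hε1 x) hφ
    (integrable_potential hC hφ ε a) le_rfl rfl

end Setting

end PFC

end

theorem theorem3p3 {d : ℕ} (hd : d = 2 ∨ d = 3) (S : PFC.Setting d) :
    -- constants `C_Ω` and `C_p`, depending on the domain only, exist
    (∃ CΩ Cp : ℝ, S.IsSobolevConst CΩ ∧ S.IsPoincareConst Cp) ∧
    ∀ CΩ Cp δ : ℝ, S.IsSobolevConst CΩ → S.IsPoincareConst Cp → 0 < δ → δ / 2 * Cp ≤ 1 / 2 →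
    ∀ ε a : ℝ, 0 < ε → ε < 1 → 0 ≤ a →
    ∀ φ₀ : S.L2, S.InDom φ₀ →
    ∀ M₀ : ℝ, M₀ = S.boundSup CΩ Cp δ ε a φ₀ →
    ∀ L : ℝ≥0, LipschitzWith L (PFC.truncReaction ε a M₀) →
    ∀ (s : ℕ) (B : PFC.IMEXTable s), 0 < s →
      (PFC.symPart B.Q).PosDef → (PFC.symPart B.H0).PosDef →
    ∀ α β : ℝ, 1 / (2 * PFC.lambdaMin (PFC.symPart B.Q)) - 1 ≤ α →
      (L : ℝ) / (2 * PFC.lambdaMin (PFC.symPart B.Q)) ≤ β →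
      -- the stabilized matrices
      (PFC.symPart (B.H1 L β)).PosSemidef ∧ (PFC.symPart (B.H2 α)).PosSemidef ∧
      ((L : ℝ) / (2 * PFC.lambdaMin (PFC.symPart B.Q)) < β → (PFC.symPart (B.H1 L β)).PosDef) ∧
      (1 / (2 * PFC.lambdaMin (PFC.symPart B.Q)) - 1 < α → (PFC.symPart (B.H2 α)).PosDef) ∧
      -- every step size and every number of steps
      ∀ τ : ℝ, 0 < τ → ∀ K : ℕ,
        -- the auxiliary scheme has exactly one solution
        (∃! u, S.IsSolution B a α β (PFC.truncReaction ε a M₀) τ φ₀ K u) ∧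
        (∀ u, S.IsSolution B a α β (PFC.truncReaction ε a M₀) τ φ₀ K u →
          -- (i) energy dissipation
          (∀ n, S.energy ε a (u n (Fin.last s)) ≤ S.energy ε a (u n 0)) ∧
          -- (ii) uniform bound for all stage values
          (∀ n i, S.supNorm (u n i) ≤ ENNReal.ofReal M₀)) ∧
        -- (iii) the original and the auxiliary scheme have the same solution
        (∀ u, S.IsSolution B a α β (PFC.reaction ε a) τ φ₀ K u ↔
          S.IsSolution B a α β (PFC.truncReaction ε a M₀) τ φ₀ K u) := by
  refine ⟨?_, ?_⟩
  · obtain ⟨CΩ, hC⟩ := PFC.Setting.exists_isSobolevConst hd S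
    obtain ⟨Cp, hP⟩ := PFC.Setting.exists_isPoincareConst hd S
    exact ⟨CΩ, Cp, hC, hP⟩
  intro CΩ Cp δ hC hP hδ hδC ε a hε hε1 ha φ₀ hφ M₀ hM₀ L hL s B hs hQ hH0 α β hα hβ
  have hH1 := B.posSemidef_H1 hs hQ L.2 hβ
  have hH2 := B.posSemidef_H2 hs hQ hα
  refine ⟨hH1, hH2, B.posDef_H1 hs hQ L.2, B.posDef_H2 hs hQ, fun τ hτ K => ?_⟩
  have hM : 0 ≤ M₀ := hM₀ ▸ PFC.Setting.boundSup_nonneg hC.1 Cp δ ε a φ₀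
  have hM3 : 3 ≤ M₀ ^ 2 := hM₀ ▸ PFC.Setting.three_le_boundSup_sq hC Cp δ hφ hε hε1
  have hα1 := B.one_add_pos hs hQ hα
  have hl := (PFC.lambdaMin_pos hs hQ).1
  have hβ0 : 0 ≤ β := (div_nonneg L.2 (by positivity)).trans hβ
  have hA := B.A_diag_pos hQ hH0
  have hdiss : ∀ u, S.IsSolution B a α β (PFC.truncReaction ε a M₀) τ φ₀ K u → ∀ n i,
      S.truncEnergy ε a M₀ (u n i) ≤ S.truncEnergy ε a M₀ (u n 0) := fun u hu n i =>
    PFC.Setting.truncEnergy_le hP hM hL ha hτ hH0.posSemidef hH1 hH2 (hu.inDom n) (hu.stage n) i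
  have hφ0 : S.truncEnergy ε a M₀ φ₀ = S.energy ε a φ₀ :=
    PFC.Setting.truncEnergy_eq hM (hM₀ ▸ PFC.Setting.supNorm_initial_le hC hP hδ hδC hε1 hφ)
  have hbd : ∀ u, S.IsSolution B a α β (PFC.truncReaction ε a M₀) τ φ₀ K u → ∀ n i,
      S.supNorm (u n i) ≤ ENNReal.ofReal M₀ := fun u hu n i => by
    have h1 := (hu.le_initial (hdiss u hu) n i).trans_eq hφ0
    have h2 := PFC.Setting.supNorm_le_boundSup hC hP hδ hδC
      (PFC.truncPotential_lower hε hε1 hM hM3 hL) (hu.inDom n i)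
      (PFC.Setting.integrable_truncPotential hM hL (u n i)) h1 (hu.inner_one n i)
    rwa [← hM₀] at h2
  obtain ⟨u, hu⟩ := PFC.Setting.exists_isSolution (B := B) (β := β) ha hα1 hβ0 hτ hA
    (PFC.Setting.memLp_truncReaction hM hL) hφ K
  refine ⟨⟨u, hu, fun u' hu' => PFC.Setting.isSolution_unique ha hα1 hβ0 hτ hA hu' hu⟩,
    fun u' hu' => ⟨fun n => ?_, hbd u' hu'⟩, fun u' => ⟨fun hu' => ?_, fun hu' =>
      hu'.reaction_of_trunc hM (hbd u' hu')⟩⟩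
  · rw [← PFC.Setting.truncEnergy_eq hM (hbd u' hu' n _), ← PFC.Setting.truncEnergy_eq hM (hbd u' hu' n _)]
    exact hdiss u' hu' n _
  -- the solution of the auxiliary scheme solves the original one, whose solutions are unique
  · rwa [PFC.Setting.isSolution_unique ha hα1 hβ0 hτ hA hu'
      (hu.reaction_of_trunc hM (hbd u hu))]
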